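/- **Theorem 3.** Let $H\in(1/2,3/4)$, let $B^H=(B^H_t)_{t\ge 0}$ be a fractional Brownian motion with Hurst parameter $H$ on a probability space $(\Omega,P)$ (a continuous centered Gaussian process with $B^H_0=0$ and $E(B^H_sB^H_t)=\frac12(t^{2H}+s^{2H}-|t-s|^{2H})$), and let $\sigma:[0,1]\to\mathbb{R}$ be a bounded measurable deterministic function. Let $S=(S_t)_{0\le t\le 1}$ be a square integrable stock price following the diffusion equation without drift $$dS_t=\sigma_tS_t\,dB^H_t,\qquad S_0=s_0>0,\qquad 0\le t\le 1,$$ where the stochastic integral is the Wick–Itô–Skorohod integral, $\int_0^t Y_s\,dB^H_s=\int_0^t Y_s\diamond W^H_s\,ds$, $W^H_s=dB^H_s/ds$. For a function $f$ on $\mathbb{R}$ put $$Mf(x)=C_H\int_{\mathbb{R}}\frac{f(t)}{|t-x|^{3/2-H}}\,dt,\qquad C_H=\frac{[\Gamma(2H+1)\sin(\pi H)]^{1/2}}{2\,\Gamma(H-\frac12)\cos(\frac{\pi}{2}(H-\frac12))},$$ and let $\int_{\mathbb{R}} f\,dB^H$ be the Wiener integral, i.e. the $L^2(P)$-limit of $\sum_j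 a_jB^H_{t_j}$ along step functions $\sum_j a_j\chi_{[0,t_j]}$ that converge to $f$ in the norm $\|f\|_{L^2_H}=\|Mf\|_{L^2(\mathbb{R})}$. For $N\ge1$ let $h=1/N$ and, for $0\le k<N$, $$f_k=\sigma\,\chi_{[k/N,(k+1)/N]},\quad \eta_k=\int_{\mathbb{R}} f_k\,dB^H,\quad \tilde\theta_N=\sum_{k=0}^{N-1}h^{1-2H}E(\eta_k^2),\quad \hat{\sigma^2}=\frac{1}{Nh^{2H}}\sum_{k=0}^{N-1}\bigl(\log S_{(k+1)h}-\log S_{kh}\bigr)^2 .$$ Then the limit $$\sigma^2_{H,2,*}=\lim_{N\to\infty}2N^{4H-1}\sum_{k=0}^{N-1}\sum_{k'=0}^{N-1}\Bigl(\int_{\mathbb{R}}Mf_k(s)\,Mf_{k'}(s)\,ds\Bigr)^2$$ exists in $[0,\infty)$, and, as $N\to\infty$, $$\sqrt N\,\bigl(\hat{\sigma^2}-\tilde\theta_N\bigr)\Longrightarrow\mathcal N(0,\sigma^2_{H,2,*})$$ in distribution (where $\mathcal N(0,0)$ is the point mass at $0$). -/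

import Mathlib

open MeasureTheory ProbabilityTheory Filter Topology
open scoped NNReal ENNReal

noncomputable section

namespace FracMarket

variable {Ω : Type*} [MeasurableSpace Ω]

/-- `B` is a fractional Brownian motion with Hurst parameter `H` on `(Ω, P)`: a continuous centered
Gaussian process on `[0, ∞)` starting at `0` with covariance `(t^{2H} + s^{2H} - |t - s|^{2H}) / 2`.
The index is a real number, but only the times `t ≥ 0` matter. -/
structure IsFBM (H : ℝ) (B : ℝ → Ω → ℝ) (P : Measure Ω) : Prop where
  measurable : ∀ t : ℝ, 0 ≤ t → Measurable (B t)
  zero : ∀ᵐ ω ∂P, B 0 ω = 0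
  continuous : ∀ᵐ ω ∂P, ContinuousOn (fun t : ℝ => B t ω) (Set.Ici 0)
  gaussian : IsGaussianProcess (fun t : ℝ≥0 => B (t : ℝ)) P
  mean : ∀ t : ℝ, 0 ≤ t → ∫ ω, B t ω ∂P = 0
  covariance : ∀ s t : ℝ, 0 ≤ s → 0 ≤ t →
    ∫ ω, B s ω * B t ω ∂P = (t ^ (2 * H) + s ^ (2 * H) - |t - s| ^ (2 * H)) / 2

/-! ### The operator `M` and the space `L²_H` (for `1/2 < H < 1`) -/

/-- The constant `C_H`. -/
def constC (H : ℝ) : ℝ :=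
  √(Real.Gamma (2 * H + 1) * Real.sin (Real.pi * H)) /
    (2 * Real.Gamma (H - 1 / 2) * Real.cos (Real.pi / 2 * (H - 1 / 2)))

/-- `M f (x) = C_H ∫ f(t) / |t - x|^{3/2 - H} dt`, the form of the operator `M` for
`1/2 < H < 1`. -/
def opM (H : ℝ) (f : ℝ → ℝ) (x : ℝ) : ℝ :=
  constC H * ∫ t : ℝ, f t / |t - x| ^ (3 / 2 - H)

/-- `f ∈ L²_H(ℝ)`: `M f` is defined almost everywhere and belongs to `L²(ℝ)`. -/
def MemL2H (H : ℝ) (f : ℝ → ℝ) : Prop :=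
  (∀ᵐ x : ℝ, Integrable (fun t : ℝ => f t / |t - x| ^ (3 / 2 - H))) ∧
    MemLp (opM H f) 2 volume

/-! ### Wiener integrals with respect to fractional Brownian motion -/

/-- A step function `∑ⱼ aⱼ 1_{[0, tⱼ]}` on `[0, ∞)`, stored through its coefficients `tⱼ ↦ aⱼ`. -/
abbrev StepFn : Type := ℝ≥0 →₀ ℝ

/-- The function `∑ⱼ aⱼ 1_{[0, tⱼ]}`. -/
def StepFn.eval (φ : StepFn) (s : ℝ) : ℝ :=
  φ.sum fun t a => (Set.Icc (0 : ℝ) (t : ℝ)).indicator (fun _ => a) s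

/-- The integral `B(φ) = ∑ⱼ aⱼ B_{tⱼ}` of a step function. -/
def StepFn.integral (B : ℝ → Ω → ℝ) (φ : StepFn) (ω : Ω) : ℝ :=
  φ.sum fun t a => a * B (t : ℝ) ω

/-- `I` is a version of the Wiener integral `∫ f dB^H`: it is the `L²(P)`-limit of `B(φₙ)` for some
step functions `φₙ` that converge to `f` in `L²_H`, i.e. with `‖M (f - φₙ)‖_{L²} → 0`. -/
def IsWienerIntegral (H : ℝ) (B : ℝ → Ω → ℝ) (P : Measure Ω) (f : ℝ → ℝ) (I : Ω → ℝ) : Prop :=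
  MemLp I 2 P ∧ ∃ φ : ℕ → StepFn,
    (∀ n, MemL2H H (fun s => f s - (φ n).eval s)) ∧
    Tendsto (fun n => eLpNorm (opM H (fun s => f s - (φ n).eval s)) 2 volume) atTop (𝓝 0) ∧
    Tendsto (fun n => eLpNorm (fun ω => I ω - (φ n).integral B ω) 2 P) atTop (𝓝 0)

open Classical in
/-- The Wiener integral `∫ f dB^H` (a version of it, unique up to null sets). -/
def wienerIntegral (H : ℝ) (B : ℝ → Ω → ℝ) (P : Measure Ω) (f : ℝ → ℝ) : Ω → ℝ :=
  if h : ∃ I : Ω → ℝ, IsWienerIntegral H B P f I then h.choose else 0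

/-! ### Wick-Itô-Skorohod integral and the diffusion equation -/

/-- The σ-algebra generated by `(B_t)_{t ≥ 0}`. -/
abbrev noiseAlgebra (B : ℝ → Ω → ℝ) : MeasurableSpace Ω :=
  ⨆ t : ℝ≥0, MeasurableSpace.comap (B (t : ℝ)) inferInstance

/-- Square integrable functionals of the noise `(B_t)_{t ≥ 0}`. -/
def MemL2Noise (B : ℝ → Ω → ℝ) (P : Measure Ω) (F : Ω → ℝ) : Prop :=
  MemLp F 2 P ∧ AEStronglyMeasurable[noiseAlgebra B] F P

/-- The Wick exponential `exp(B(φ) - E[B(φ)²] / 2)`. -/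
def wickExp (B : ℝ → Ω → ℝ) (P : Measure Ω) (φ : StepFn) (ω : Ω) : ℝ :=
  Real.exp (φ.integral B ω - (∫ ω', (φ.integral B ω') ^ 2 ∂P) / 2)

/-- The `S`-transform `φ ↦ E[F exp(B(φ) - E[B(φ)²] / 2)]`, which determines `F` among the square
integrable functionals of the noise, and turns Wick products into products. -/
def sTransform (B : ℝ → Ω → ℝ) (P : Measure Ω) (F : Ω → ℝ) (φ : StepFn) : ℝ :=
  ∫ ω, F ω * wickExp B P φ ω ∂P

/-- The `S`-transform of the fractional white noise `W^H_s = dB^H_s / ds`. -/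
def whiteNoise (B : ℝ → Ω → ℝ) (P : Measure Ω) (s : ℝ) (φ : StepFn) : ℝ :=
  deriv (fun r : ℝ => sTransform B P (B r) φ) s

/-- `Φ` is the Wick-Itô-Skorohod integral `∫₀ᵗ Y_s dB^H_s = ∫₀ᵗ Y_s ◇ W^H_s ds`: its `S`-transform
is the integral over `[0, t]` of that of the Wick product `Y_s ◇ W^H_s`, that is, of the product of
the `S`-transforms of `Y_s` and `W^H_s`. -/
def IsWISIntegral (B : ℝ → Ω → ℝ) (P : Measure Ω) (Y : ℝ → Ω → ℝ) (t : ℝ) (Φ : Ω → ℝ) : Prop :=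
  (∀ s ∈ Set.Icc 0 t, MemL2Noise B P (Y s)) ∧ MemL2Noise B P Φ ∧
    ∀ φ : StepFn,
      IntervalIntegrable (fun s => sTransform B P (Y s) φ * whiteNoise B P s φ) volume 0 t ∧
      sTransform B P Φ φ = ∫ s in (0 : ℝ)..t, sTransform B P (Y s) φ * whiteNoise B P s φ

/-- `S` solves `dS_t = μ_t S_t dt + σ_t S_t dB^H_t`, `S_0 = s₀`, on `[0, T]`, with the stochastic
integral in the Wick-Itô-Skorohod sense. -/
def IsWISSolution (B : ℝ → Ω → ℝ) (P : Measure Ω) (μ σ : ℝ → ℝ) (s₀ T : ℝ)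
    (S : ℝ → Ω → ℝ) : Prop :=
  ∀ t ∈ Set.Icc 0 T, ∃ Φ : Ω → ℝ,
    IsWISIntegral B P (fun s ω => σ s * S s ω) t Φ ∧
    ∀ᵐ ω ∂P, IntervalIntegrable (fun s => μ s * S s ω) volume 0 t ∧
      S t ω = s₀ + (∫ s in (0 : ℝ)..t, μ s * S s ω) + Φ ω

/-! ### The estimator, its centering and the asymptotic variance -/

/-- The estimator `(N h^{2H})⁻¹ ∑_{k < N} (log S_{(k+1)h} - log S_{kh})²` with `h = 1 / N`. -/
def volEstimator (H : ℝ) (S : ℝ → Ω → ℝ) (N : ℕ) (ω : Ω) : ℝ :=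
  1 / ((N : ℝ) * (1 / (N : ℝ)) ^ (2 * H)) *
    ∑ k ∈ Finset.range N,
      (Real.log (S (((k : ℝ) + 1) / N) ω) - Real.log (S ((k : ℝ) / N) ω)) ^ 2

/-- `f_k = σ 1_{[k/N, (k+1)/N]}`. -/
def volPiece (σ : ℝ → ℝ) (N k : ℕ) : ℝ → ℝ :=
  (Set.Icc ((k : ℝ) / N) (((k : ℝ) + 1) / N)).indicator σ

/-- `∑_{k < N} h^{1 - 2H} E[η_k²]` with `h = 1 / N` and `η_k = ∫ f_k dB^H`. -/
def thetaTilde (H : ℝ) (B : ℝ → Ω → ℝ) (P : Measure Ω) (σ : ℝ → ℝ) (N : ℕ) : ℝ :=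
  ∑ k ∈ Finset.range N,
    (1 / (N : ℝ)) ^ (-2 * H + 1) * ∫ ω, (wienerIntegral H B P (volPiece σ N k) ω) ^ 2 ∂P

/-- `N^{4H - 1} · 2 ∑_{k < N} ∑_{k' < N} (∫ M f_k(s) M f_{k'}(s) ds)²`. -/
def approxVariance (H : ℝ) (σ : ℝ → ℝ) (N : ℕ) : ℝ :=
  (N : ℝ) ^ (4 * H - 1) * (2 * ∑ k ∈ Finset.range N, ∑ k' ∈ Finset.range N,
    (∫ s : ℝ, opM H (volPiece σ N k) s * opM H (volPiece σ N k') s) ^ 2)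

end FracMarket

end

/-!
On functions that are bounded with bounded support in `[0, ∞)`, the operator `M` turns the `L²(ℝ)`
inner product into `⟨f, g⟩ = H(2H - 1) ∬ f(u) g(v) |u - v|^{2H-2}` (`integral_opM_mul`): this is the
composition formula for Riesz kernels, whose constant is a sum of Beta values that `C_H` normalizes
(`constC_sq_mul_beta`). Step functions show that Wiener integrals are jointly Gaussian and centred
with this covariance (`IsWienerIntegral.integral_mul`, `hasGaussianLaw_wienerIntegral_pi`).

The stochastic equation is solved through the `S`-transform. Applied to both sides, it gives for
each test function a linear integral equation in time with a bounded coefficient, whose only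
solution is an exponential (`IsWISSolution.sTransform_eq`, `eq_mul_exp_of_integral_eq`). The
`S`-transform is injective on square integrable functionals of the noise
(`ae_eq_zero_of_sTransform_eq_zero`), because, if it vanishes, the positive and negative parts of
the functional, taken as densities, give every `B(φ)` the same moment generating function. So `S_t =
s₀ exp(I_t - ‖σ 1_{[0,t]}‖² / 2)`, where `I_t` is the Wiener integral of `σ 1_{[0,t]}`
(`IsWISSolution.ae_eq_exp`), and the log-increments of `S` are the `η_k` minus deterministic Itô
corrections, of size `O(1/N)` (`log_increment_ae_eq`, `abs_itoCorrection_le`).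

Hence the normalized error is `√N N^{2H-1} ∑_k (η_k² - E η_k²)` plus a remainder that involves the
Itô corrections and tends to `0` in `L²` (`tendsto_eLpNorm_remainder`). The main term is a centred
quadratic form in a Gaussian vector, and its variance is `2 N^{4H-1} ∑_{k,k'} ⟨f_k, f_{k'}⟩²`. Near
a Lebesgue point `t` of `σ` the function is almost constant on the cells of the grid, so that
`N^{2H} ⟨f_k, f_{k+j}⟩` is close to `σ(t)² ρ(j)`, with `ρ` the covariance of fractional Gaussian
noise. Dominated convergence then gives the limit `2 ∑_j ρ(j)² ∫₀¹ σ⁴`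
(`exists_tendsto_approxVariance`); the series converges because `ρ(j) = O(|j|^{2H-2})` and `H < 3/4`
(`summable_fgnCov_sq`).

Diagonalizing the covariance matrix writes the main term as a combination of independent centred
squares of normal variables with weights the eigenvalues. When the largest weight tends to `0` and
the variance converges, a second order expansion of the characteristic functions gives the central
limit theorem (`tendstoInDistribution_quadraticForm`). The eigenvalues are at most the row sums of
the covariance matrix, which are `O(1/N)` (`sum_abs_fracInner_volPiece_le`); the normalized weights
are therefore `O(N^{2H-3/2})`, and `H < 3/4` is used once more.
-/

namespace FracMarket

/-! ### The Riesz kernel and the constant `C_H` -/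

section

lemma integrableOn_betaKernel {α β : ℝ} (hα : 0 < α) (hβ : 0 < β) :
    IntegrableOn (fun x : ℝ => x ^ (α - 1) * (1 - x) ^ (β - 1)) (Set.Ioo 0 1) ∧
      ∫ x in Set.Ioo (0 : ℝ) 1, x ^ (α - 1) * (1 - x) ^ (β - 1) = beta α β := by
  have hB := beta_pos hα hβ
  have h1 := lintegral_betaPDF_eq_one hα hβ
  rw [lintegral_betaPDF] at h1
  have hmeas : AEStronglyMeasurable
      (fun x : ℝ => 1 / beta α β * x ^ (α - 1) * (1 - x) ^ (β - 1))
      (volume.restrict (Set.Ioo 0 1)) := by fun_prop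
  have hnn : 0 ≤ᵐ[volume.restrict (Set.Ioo 0 1)]
      (fun x : ℝ => 1 / beta α β * x ^ (α - 1) * (1 - x) ^ (β - 1)) := by
    filter_upwards [ae_restrict_mem measurableSet_Ioo] with x hx
    have := hx.1; have : 0 < 1 - x := by linarith [hx.2]
    simp only [Pi.zero_apply]; positivity
  have hint : IntegrableOn (fun x : ℝ => 1 / beta α β * x ^ (α - 1) * (1 - x) ^ (β - 1))
      (Set.Ioo 0 1) :=
    (lintegral_ofReal_ne_top_iff_integrable hmeas hnn).1 (by rw [h1]; simp)
  have hval : ∫ x in Set.Ioo (0 : ℝ) 1, 1 / beta α β * x ^ (α - 1) * (1 - x) ^ (β - 1) = 1 := by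
    rw [integral_eq_lintegral_of_nonneg_ae hnn hmeas, h1]; simp
  have heq : (fun x : ℝ => x ^ (α - 1) * (1 - x) ^ (β - 1)) =
      fun x => beta α β * (1 / beta α β * x ^ (α - 1) * (1 - x) ^ (β - 1)) := by
    funext x; field_simp
  rw [heq]
  refine ⟨hint.const_mul _, ?_⟩
  rw [integral_const_mul, hval, mul_one]

/-- The substitution `x ↦ 1 / x` turns the integral over `(1, ∞)` into a Beta integral. -/
lemma integrableOn_rieszKernel_Ioi {a : ℝ} (ha : 1 / 2 < a) (ha' : a < 1) :
    IntegrableOn (fun x : ℝ => |x| ^ (-a) * |1 - x| ^ (-a)) (Set.Ioi 1) ∧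
      ∫ x in Set.Ioi (1 : ℝ), |x| ^ (-a) * |1 - x| ^ (-a) = beta (2 * a - 1) (1 - a) := by
  have himg : (fun x : ℝ => x⁻¹) '' Set.Ioo 0 1 = Set.Ioi 1 := by
    ext y
    constructor
    · rintro ⟨x, hx, rfl⟩
      exact (one_lt_inv₀ hx.1).2 hx.2
    · intro hy
      have hy : 1 < y := hy
      exact ⟨y⁻¹, ⟨by positivity, inv_lt_one_of_one_lt₀ hy⟩, inv_inv y⟩
  have hderiv : ∀ x ∈ Set.Ioo (0 : ℝ) 1,
      HasDerivWithinAt (fun x : ℝ => x⁻¹) (-(x ^ 2)⁻¹) (Set.Ioo 0 1) x := fun x hx =>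
    (hasDerivAt_inv hx.1.ne').hasDerivWithinAt
  have hinj : Set.InjOn (fun x : ℝ => x⁻¹) (Set.Ioo 0 1) := fun x _ y _ h => inv_injective h
  have hfun : Set.EqOn
      (fun x : ℝ => |-(x ^ 2)⁻¹| • (|x⁻¹| ^ (-a) * |1 - x⁻¹| ^ (-a)))
      (fun x => x ^ (2 * a - 1 - 1) * (1 - x) ^ (1 - a - 1)) (Set.Ioo 0 1) := by
    intro x hx
    have hx0 : 0 < x := hx.1
    have hx1 : 0 < 1 - x := by linarith [hx.2]
    have e1 : |1 - x⁻¹| = (1 - x) * x⁻¹ := by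
      rw [abs_of_nonpos]
      · field_simp; ring
      · linarith [(one_lt_inv₀ hx0).2 hx.2]
    have e2 : |-(x ^ 2)⁻¹| = x ^ (-2 : ℝ) := by
      rw [abs_neg, abs_of_pos (by positivity), Real.rpow_neg hx0.le]; norm_num
    simp only [smul_eq_mul]
    rw [e1, e2, abs_of_pos (inv_pos.2 hx0), Real.mul_rpow hx1.le (by positivity),
      ← Real.rpow_neg_one, ← Real.rpow_mul hx0.le,
      show 2 * a - 1 - 1 = -2 + (-1 * -a + -1 * -a) by ring, Real.rpow_add hx0,
      Real.rpow_add hx0, show 1 - a - 1 = -a by ring]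
    ring
  have hb := integrableOn_betaKernel (α := 2 * a - 1) (β := 1 - a) (by linarith) (by linarith)
  rw [← himg]
  constructor
  · rw [integrableOn_image_iff_integrableOn_abs_deriv_smul measurableSet_Ioo hderiv hinj]
    exact hb.1.congr_fun hfun.symm measurableSet_Ioo
  · rw [integral_image_eq_integral_abs_deriv_smul measurableSet_Ioo hderiv hinj,
      setIntegral_congr_fun measurableSet_Ioo hfun, hb.2]

lemma integrableOn_rieszKernel_Ioc {a : ℝ} (ha' : a < 1) :
    IntegrableOn (fun x : ℝ => |x| ^ (-a) * |1 - x| ^ (-a)) (Set.Ioc 0 1) ∧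
      ∫ x in Set.Ioc (0 : ℝ) 1, |x| ^ (-a) * |1 - x| ^ (-a) = beta (1 - a) (1 - a) := by
  have hb := integrableOn_betaKernel (α := 1 - a) (β := 1 - a) (by linarith) (by linarith)
  have hfun : Set.EqOn (fun x : ℝ => |x| ^ (-a) * |1 - x| ^ (-a))
      (fun x => x ^ (1 - a - 1) * (1 - x) ^ (1 - a - 1)) (Set.Ioo 0 1) := by
    intro x hx
    have hx1 : 0 < 1 - x := by linarith [hx.2]
    simp only [abs_of_pos hx.1, abs_of_pos hx1, show 1 - a - 1 = -a by ring]
  rw [integral_Ioc_eq_integral_Ioo, integrableOn_Ioc_iff_integrableOn_Ioo,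
    setIntegral_congr_fun measurableSet_Ioo hfun]
  exact ⟨hb.1.congr_fun hfun.symm measurableSet_Ioo, hb.2⟩

lemma integrable_rieszKernel_zero_one {a : ℝ} (ha : 1 / 2 < a) (ha' : a < 1) :
    Integrable (fun x : ℝ => |x| ^ (-a) * |1 - x| ^ (-a)) ∧
      ∫ x : ℝ, |x| ^ (-a) * |1 - x| ^ (-a) =
        2 * beta (2 * a - 1) (1 - a) + beta (1 - a) (1 - a) := by
  set f : ℝ → ℝ := fun x => |x| ^ (-a) * |1 - x| ^ (-a) with hf
  obtain ⟨i1, v1⟩ := integrableOn_rieszKernel_Ioi ha ha'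
  obtain ⟨i2, v2⟩ := integrableOn_rieszKernel_Ioc ha'
  have hsymm : ∀ x, f (1 - x) = f x := fun x => by simp [hf, mul_comm]
  have hind : (Set.Iio (0 : ℝ)).indicator f = fun x => (Set.Ioi (1 : ℝ)).indicator f (1 - x) := by
    funext x
    by_cases hx : x < 0
    · rw [Set.indicator_of_mem (show x ∈ Set.Iio (0:ℝ) from hx),
        Set.indicator_of_mem (show 1 - x ∈ Set.Ioi (1:ℝ) by simp; linarith), hsymm]
    · rw [Set.indicator_of_notMem (show x ∉ Set.Iio (0:ℝ) from hx),
        Set.indicator_of_notMem (show 1 - x ∉ Set.Ioi (1:ℝ) by simp; linarith)]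
  have i0 : IntegrableOn f (Set.Iic 0) := by
    rw [integrableOn_Iic_iff_integrableOn_Iio, ← integrable_indicator_iff measurableSet_Iio, hind]
    exact ((integrable_indicator_iff measurableSet_Ioi).2 i1).comp_sub_left 1
  have v0 : ∫ x in Set.Iic (0 : ℝ), f x = beta (2 * a - 1) (1 - a) := by
    rw [integral_Iic_eq_integral_Iio, ← integral_indicator measurableSet_Iio, hind,
      integral_sub_left_eq_self, integral_indicator measurableSet_Ioi, v1]
  have hU : Set.Ioc (0 : ℝ) 1 ∪ Set.Ioi 1 = Set.Ioi 0 := Set.Ioc_union_Ioi_eq_Ioi zero_le_one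
  have i3 : IntegrableOn f (Set.Ioi 0) := by rw [← hU]; exact i2.union i1
  have v3 : ∫ x in Set.Ioi (0 : ℝ), f x = beta (1 - a) (1 - a) + beta (2 * a - 1) (1 - a) := by
    rw [← hU, setIntegral_union (Set.Ioc_disjoint_Ioi le_rfl) measurableSet_Ioi i2 i1, v1, v2]
  constructor
  · rw [← integrableOn_univ, ← Set.Iic_union_Ioi (a := (0 : ℝ))]; exact i0.union i3
  · rw [← intervalIntegral.integral_Iic_add_Ioi i0 i3, v0, v3]; ring

/-- The Riesz composition formula in dimension one: the convolution of `|x|^{-a}` with itself. -/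
lemma integrable_rieszKernel {a : ℝ} (ha : 1 / 2 < a) (ha' : a < 1) {u v : ℝ} (huv : u ≠ v) :
    Integrable (fun x : ℝ => |u - x| ^ (-a) * |v - x| ^ (-a)) ∧
      ∫ x : ℝ, |u - x| ^ (-a) * |v - x| ^ (-a) =
        (2 * beta (2 * a - 1) (1 - a) + beta (1 - a) (1 - a)) * |u - v| ^ (1 - 2 * a) := by
  obtain ⟨i, e⟩ := integrable_rieszKernel_zero_one ha ha'
  have hd : v - u ≠ 0 := sub_ne_zero.2 huv.symm
  have hpos : 0 < |v - u| := abs_pos.2 hd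
  set g : ℝ → ℝ := fun x => |u - x| ^ (-a) * |v - x| ^ (-a) with hg
  have hscale : (fun y : ℝ => g (u + (v - u) * y)) =
      fun y => |v - u| ^ (-2 * a) * (|y| ^ (-a) * |1 - y| ^ (-a)) := by
    funext y
    simp only [hg]
    rw [show u - (u + (v - u) * y) = -((v - u) * y) by ring,
      show v - (u + (v - u) * y) = (v - u) * (1 - y) by ring, abs_neg, abs_mul, abs_mul,
      Real.mul_rpow hpos.le (abs_nonneg _), Real.mul_rpow hpos.le (abs_nonneg _),
      show -2 * a = -a + -a by ring, Real.rpow_add hpos]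
    ring
  have i2 : Integrable (fun y : ℝ => g (u + (v - u) * y)) := by
    rw [hscale]; exact i.const_mul _
  constructor
  · have := (integrable_comp_mul_left_iff (fun x => g (u + x)) hd).1 i2
    simpa using this.comp_sub_right u
  · have h1 : ∫ y : ℝ, g (u + (v - u) * y) = |v - u|⁻¹ * ∫ x, g x := by
      rw [Measure.integral_comp_mul_left (fun x => g (u + x)) (v - u),
        integral_add_left_eq_self, abs_inv, smul_eq_mul]
    rw [hscale, integral_const_mul, e] at h1
    rw [show (1 - 2 * a) = 1 + -2 * a by ring, abs_sub_comm u v, Real.rpow_add hpos,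
      Real.rpow_one]
    have h2 : ∫ x, g x = |v - u| * (|v - u|⁻¹ * ∫ x, g x) := by
      rw [mul_inv_cancel_left₀ hpos.ne']
    change ∫ x, g x = _
    rw [h2, ← h1]
    ring

/-- The normalization of `M` by `C_H`: the reflection formula of `Γ` and the double-angle formulas
reduce the constant of the composition formula to `H(2H - 1)`. -/
lemma constC_sq_mul_beta {H : ℝ} (h1 : 1 / 2 < H) (h2 : H < 1) :
    constC H ^ 2 * (2 * beta (2 * (3 / 2 - H) - 1) (1 - (3 / 2 - H)) +
      beta (1 - (3 / 2 - H)) (1 - (3 / 2 - H))) = H * (2 * H - 1) := by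
  have hpi := Real.pi_pos
  obtain ⟨α, hα⟩ : ∃ α : ℝ, α = H - 1 / 2 := ⟨_, rfl⟩
  have ha0 : 0 < α := by linarith
  have ha1 : α < 1 / 2 := by linarith
  have hH : H = α + 1 / 2 := by linarith
  have g1 := Real.Gamma_pos_of_pos ha0
  have g2 : 0 < Real.Gamma (2 * α) := Real.Gamma_pos_of_pos (by linarith)
  have g3 : 0 < Real.Gamma (1 - α) := Real.Gamma_pos_of_pos (by linarith)
  have g4 : 0 < Real.Gamma (1 - 2 * α) := Real.Gamma_pos_of_pos (by linarith)
  have s1 : 0 < Real.sin (Real.pi * α) :=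
    Real.sin_pos_of_pos_of_lt_pi (by positivity) (by nlinarith)
  have s2 : 0 < Real.sin (Real.pi * (2 * α)) :=
    Real.sin_pos_of_pos_of_lt_pi (by positivity) (by nlinarith)
  have c1 : 0 < Real.cos (Real.pi / 2 * α) :=
    Real.cos_pos_of_mem_Ioo ⟨by nlinarith, by nlinarith⟩
  have c2 : 0 < Real.cos (Real.pi * α) := Real.cos_pos_of_mem_Ioo ⟨by nlinarith, by nlinarith⟩
  have r1 := Real.Gamma_mul_Gamma_one_sub α
  have r2 := Real.Gamma_mul_Gamma_one_sub (2 * α)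
  have d1 : Real.sin (Real.pi * (2 * α)) = 2 * Real.sin (Real.pi * α) * Real.cos (Real.pi * α) := by
    rw [← Real.sin_two_mul]; ring_nf
  have d2 : Real.cos (Real.pi * α) = 2 * Real.cos (Real.pi / 2 * α) ^ 2 - 1 := by
    rw [← Real.cos_two_mul]; ring_nf
  have d3 : Real.sin (Real.pi * H) = Real.cos (Real.pi * α) := by
    rw [← Real.sin_add_pi_div_two, hH]; ring_nf
  have gH : Real.Gamma (2 * H + 1) = (2 * α + 1) * (2 * α) * Real.Gamma (2 * α) := by
    rw [Real.Gamma_add_one (by linarith), show 2 * H = 2 * α + 1 by linarith,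
      Real.Gamma_add_one (by linarith)]; ring
  have e1 : Real.Gamma (1 - 2 * α) =
      Real.pi / Real.sin (Real.pi * (2 * α)) / Real.Gamma (2 * α) := by
    rw [← r2]; field_simp
  have e2 : Real.Gamma (1 - α) = Real.pi / Real.sin (Real.pi * α) / Real.Gamma α := by
    rw [← r1]; field_simp
  unfold constC beta
  rw [show 2 * (3 / 2 - H) - 1 = 1 - 2 * α by rw [hα]; ring,
    show 1 - (3 / 2 - H) = α by rw [hα]; ring, show 1 - 2 * α + α = 1 - α by ring,
    show α + α = 2 * α by ring, ← hα, div_pow, Real.sq_sqrt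
      (by rw [gH, d3]; positivity), gH, d3, e1, e2, d1, show H = α + 1 / 2 from hH]
  generalize Real.Gamma α = A at *
  generalize Real.Gamma (2 * α) = A₂ at *
  generalize Real.sin (Real.pi * α) = s at *
  generalize Real.cos (Real.pi * α) = c at *
  generalize Real.cos (Real.pi / 2 * α) = d at *
  have : c + 1 = 2 * d ^ 2 := by linarith
  field_simp
  linear_combination α * this

end

/-! ### The kernel `|u - v|^{2H-2}` on intervals -/

section

lemma intervalIntegrable_abs_rpow {q : ℝ} (hq : -1 < q) (a b : ℝ) :
    IntervalIntegrable (fun v : ℝ => |v| ^ q) volume a b := by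
  have hpos : ∀ b : ℝ, 0 ≤ b → IntervalIntegrable (fun v : ℝ => |v| ^ q) volume 0 b := by
    intro b hb
    refine (intervalIntegral.intervalIntegrable_rpow' hq).congr ?_
    intro v hv
    rw [Set.uIoc_of_le hb] at hv
    simp only [abs_of_pos hv.1]
  have h0 : ∀ b : ℝ, IntervalIntegrable (fun v : ℝ => |v| ^ q) volume 0 b := by
    intro b
    rcases le_total 0 b with hb | hb
    · exact hpos b hb
    · have := IntervalIntegrable.comp_sub_left (hpos (-b) (by linarith)) 0
      simpa using this
  exact (h0 a).symm.trans (h0 b)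

lemma intervalIntegrable_abs_sub_rpow {q : ℝ} (hq : -1 < q) (u a b : ℝ) :
    IntervalIntegrable (fun v : ℝ => |u - v| ^ q) volume a b := by
  have := (intervalIntegrable_abs_rpow hq (u - a) (u - b)).comp_sub_left u
  simpa using this

/-- The odd power `|w|^{r-1} w`, that is, `sign w * |w| ^ r`. -/
noncomputable def oddPow (r w : ℝ) : ℝ := |w| ^ (r - 1) * w

lemma oddPow_of_nonneg {r w : ℝ} (hr : 0 < r) (hw : 0 ≤ w) : oddPow r w = w ^ r := by
  rcases hw.eq_or_lt with rfl | hw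
  · simp [oddPow, Real.zero_rpow hr.ne']
  · rw [oddPow, abs_of_pos hw, Real.rpow_sub_one hw.ne', div_mul_cancel₀ _ hw.ne']

lemma oddPow_neg (r w : ℝ) : oddPow r (-w) = -oddPow r w := by simp [oddPow]

lemma continuous_oddPow {r : ℝ} (hr : 0 < r) : Continuous (oddPow r) := by
  have : oddPow r = fun w => (max w 0) ^ r - (max (-w) 0) ^ r := by
    funext w
    rcases le_total 0 w with hw | hw
    · rw [oddPow_of_nonneg hr hw, max_eq_left hw, max_eq_right (by linarith),
        Real.zero_rpow hr.ne', sub_zero]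
    · rw [← neg_neg w, oddPow_neg, oddPow_of_nonneg hr (by linarith), neg_neg,
        max_eq_left (by linarith : 0 ≤ -w), max_eq_right hw, Real.zero_rpow hr.ne', zero_sub]
  rw [this]
  have h1 : Continuous fun w : ℝ => (max w 0) ^ r :=
    (continuous_id.max continuous_const).rpow_const fun _ => Or.inr hr.le
  have h2 : Continuous fun w : ℝ => (max (-w) 0) ^ r :=
    (continuous_neg.max continuous_const).rpow_const fun _ => Or.inr hr.le
  exact h1.sub h2

lemma hasDerivAt_oddPow {r w : ℝ} (hw : w ≠ 0) :
    HasDerivAt (oddPow r) (r * |w| ^ (r - 1)) w := by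
  have habs : HasDerivAt (fun x : ℝ => |x|) (SignType.sign w : ℝ) w := hasDerivAt_abs hw
  have h := (habs.rpow_const (p := r - 1) (Or.inl (abs_ne_zero.2 hw))).mul (hasDerivAt_id w)
  refine h.congr_deriv ?_
  have hp := abs_pos.2 hw
  have e : (SignType.sign w : ℝ) * w = |w| := sign_mul_self w
  simp only [id_eq, mul_one]
  rw [Real.rpow_sub_one hp.ne' (r - 1)]
  calc _ = ((SignType.sign w : ℝ) * w) / |w| * (r - 1) * |w| ^ (r - 1) + |w| ^ (r - 1) := by ring
    _ = _ := by rw [e, div_self hp.ne']; ring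

lemma oddPow_sub_le {r x y : ℝ} (hr : 0 < r) (hr1 : r ≤ 1) (hxy : y ≤ x) :
    oddPow r x - oddPow r y ≤ 2 * (x - y) ^ r := by
  have key : ∀ x y : ℝ, 0 ≤ y → y ≤ x → oddPow r x - oddPow r y ≤ 2 * (x - y) ^ r := by
    intro x y hy hxy
    rw [oddPow_of_nonneg hr (hy.trans hxy), oddPow_of_nonneg hr hy]
    have h := Real.rpow_add_le_add_rpow (sub_nonneg.2 hxy) hy hr.le hr1
    rw [sub_add_cancel] at h
    have : 0 ≤ (x - y) ^ r := Real.rpow_nonneg (sub_nonneg.2 hxy) _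
    linarith
  rcases le_total 0 y with hy | hy
  · exact key x y hy hxy
  · rcases le_total 0 x with hx | hx
    · have e : oddPow r y = -(-y) ^ r := by
        rw [← neg_neg y, oddPow_neg, oddPow_of_nonneg hr (by linarith), neg_neg]
      rw [oddPow_of_nonneg hr hx, e]
      have h1 : x ^ r ≤ (x - y) ^ r := Real.rpow_le_rpow hx (by linarith) hr.le
      have h2 : (-y) ^ r ≤ (x - y) ^ r := Real.rpow_le_rpow (by linarith) (by linarith) hr.le
      linarith
    · have h := key (-y) (-x) (by linarith) (by linarith)
      rw [oddPow_neg, oddPow_neg, show -y - -x = x - y by ring] at h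
      linarith

lemma integral_abs_sub_rpow {r : ℝ} (hr : 0 < r) (u a b : ℝ) :
    r * ∫ v in a..b, |u - v| ^ (r - 1) = oddPow r (u - a) - oddPow r (u - b) := by
  rw [← intervalIntegral.integral_const_mul]
  have h := integral_eq_of_hasDerivAt_off_countable (fun v => -oddPow r (u - v))
    (fun v => r * |u - v| ^ (r - 1)) (a := a) (b := b) (Set.countable_singleton u)
    (((continuous_oddPow hr).comp (continuous_const.sub continuous_id)).neg.continuousOn)
    (fun x hx => by
      have hx' : u - x ≠ 0 := sub_ne_zero.2 fun h => hx.2 h.symm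
      have := ((hasDerivAt_oddPow (r := r) hx').comp x ((hasDerivAt_id x).const_sub u)).neg
      refine this.congr_deriv ?_
      simp)
    ((intervalIntegrable_abs_sub_rpow (by linarith) u a b).const_mul r)
  rw [h]; ring

/-- The density `u ↦ H(2H-1) ∫_a^b |u - v|^{2H-2} dv`, in closed form. -/
noncomputable def cellKernel (H a b u : ℝ) : ℝ :=
  H * (oddPow (2 * H - 1) (u - a) - oddPow (2 * H - 1) (u - b))

lemma continuous_cellKernel {H : ℝ} (h1 : 1 / 2 < H) (a b : ℝ) : Continuous (cellKernel H a b) := by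
  have := continuous_oddPow (r := 2 * H - 1) (by linarith)
  unfold cellKernel
  fun_prop

lemma integral_kernel_Icc {H : ℝ} (h1 : 1 / 2 < H) {a b : ℝ} (hab : a ≤ b) (u : ℝ) :
    H * (2 * H - 1) * ∫ v in Set.Icc a b, |u - v| ^ (2 * H - 2) = cellKernel H a b u := by
  have := integral_abs_sub_rpow (r := 2 * H - 1) (by linarith) u a b
  rw [cellKernel, ← this, intervalIntegral.integral_of_le hab, integral_Icc_eq_integral_Ioc,
    show 2 * H - 1 - 1 = 2 * H - 2 by ring]
  ring

lemma cellKernel_le {H : ℝ} (h1 : 1 / 2 < H) (h2 : H < 1) {a b : ℝ} (hab : a ≤ b) (u : ℝ) :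
    cellKernel H a b u ≤ 2 * H * (b - a) ^ (2 * H - 1) := by
  have := oddPow_sub_le (r := 2 * H - 1) (x := u - a) (y := u - b) (by linarith) (by linarith)
    (by linarith)
  rw [show u - a - (u - b) = b - a by ring] at this
  rw [cellKernel]
  nlinarith

lemma integrableOn_kernel_prod {H : ℝ} (h1 : 1 / 2 < H) (T : ℝ) :
    IntegrableOn (fun p : ℝ × ℝ => |p.1 - p.2| ^ (2 * H - 2)) (Set.Icc 0 T ×ˢ Set.Icc 0 T) := by
  rcases lt_or_ge T 0 with hT | hT
  · simp [Set.Icc_eq_empty (not_le.2 hT)]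
  rw [IntegrableOn, Measure.volume_eq_prod, ← Measure.prod_restrict, integrable_prod_iff]
  · have hc : H * (2 * H - 1) ≠ 0 := by
      have : 0 < 2 * H - 1 := by linarith
      positivity
    constructor
    · refine ae_of_all _ fun u => ?_
      have := intervalIntegrable_abs_sub_rpow (q := 2 * H - 2) (by linarith) u 0 T
      rw [intervalIntegrable_iff_integrableOn_Icc_of_le hT] at this
      exact this
    · have : (fun u : ℝ => ∫ v in Set.Icc 0 T, ‖|u - v| ^ (2 * H - 2)‖) =
          fun u => (H * (2 * H - 1))⁻¹ * cellKernel H 0 T u := by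
        funext u
        rw [← integral_kernel_Icc h1 hT, inv_mul_cancel_left₀ hc]
        congr 1
        funext v
        rw [Real.norm_of_nonneg (by positivity)]
      simp only
      rw [this]
      exact ((continuous_cellKernel h1 0 T).const_mul _).integrableOn_Icc
  · exact Measurable.aestronglyMeasurable (by fun_prop)

/-! ### Bounded functions with bounded support in `[0, ∞)` -/

/-- `f` is measurable (up to null sets), bounded, and supported in some interval `[0, T]`. -/
structure BddSupp (f : ℝ → ℝ) : Prop where
  aemeasurable : AEMeasurable f
  bound : ∃ C T : ℝ, 0 ≤ C ∧ 0 ≤ T ∧ ∀ x, |f x| ≤ (Set.Icc 0 T).indicator (fun _ => C) x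

namespace BddSupp
variable {f g : ℝ → ℝ}

lemma add (hf : BddSupp f) (hg : BddSupp g) : BddSupp (fun x => f x + g x) := by
  refine ⟨hf.aemeasurable.add hg.aemeasurable, ?_⟩
  obtain ⟨C, T, hC, hT, h⟩ := hf.bound
  obtain ⟨C', T', hC', hT', h'⟩ := hg.bound
  refine ⟨C + C', max T T', by positivity, le_max_of_le_left hT, fun x => ?_⟩
  refine (abs_add_le _ _).trans ((add_le_add (h x) (h' x)).trans ?_)
  simp only [Set.indicator_apply, Set.mem_Icc, le_max_iff]
  split_ifs <;> first | linarith | (exfalso; tauto)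

lemma const_mul (hf : BddSupp f) (c : ℝ) : BddSupp (fun x => c * f x) := by
  refine ⟨hf.aemeasurable.const_mul c, ?_⟩
  obtain ⟨C, T, hC, hT, h⟩ := hf.bound
  refine ⟨|c| * C, T, by positivity, hT, fun x => ?_⟩
  rw [abs_mul]
  refine (mul_le_mul_of_nonneg_left (h x) (abs_nonneg c)).trans (le_of_eq ?_)
  simp only [Set.indicator_apply]
  split_ifs <;> simp

lemma sub (hf : BddSupp f) (hg : BddSupp g) : BddSupp (fun x => f x - g x) := by
  simpa [sub_eq_add_neg] using hf.add (hg.const_mul (-1))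

lemma zero : BddSupp (fun _ => 0) :=
  ⟨aemeasurable_const, 0, 0, le_rfl, le_rfl, fun x => by simp⟩

lemma sum {ι : Type*} (s : Finset ι) {f : ι → ℝ → ℝ} (hf : ∀ i ∈ s, BddSupp (f i)) :
    BddSupp (fun x => ∑ i ∈ s, f i x) := by
  classical
  induction s using Finset.induction_on with
  | empty => simpa using zero
  | insert i s hi ih =>
    simp only [Finset.sum_insert hi]
    exact (hf i (by simp)).add (ih fun j hj => hf j (by simp [hj]))

lemma integrable_mul (hf : BddSupp f) {k : ℝ → ℝ} (hk : ∀ T, IntegrableOn k (Set.Icc 0 T)) :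
    Integrable (fun x => f x * k x) := by
  obtain ⟨C, T, hC, hT, h⟩ := hf.bound
  have h0 : Integrable ((Set.Icc 0 T).indicator fun x => C * ‖k x‖) :=
    (integrable_indicator_iff measurableSet_Icc).2 ((hk T).norm.const_mul C)
  have hfz : (fun x => f x * k x) = fun x => f x * (Set.Icc 0 T).indicator k x := by
    funext x
    by_cases hx : x ∈ Set.Icc 0 T
    · simp [hx]
    · have := h x
      simp only [Set.indicator_of_notMem hx, abs_nonpos_iff] at this
      simp [this]
  rw [hfz]
  refine h0.mono' ?_ (ae_of_all _ fun x => ?_)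
  · exact hf.aemeasurable.aestronglyMeasurable.mul
      ((integrable_indicator_iff measurableSet_Icc).2 (hk T)).aestronglyMeasurable
  · rw [norm_mul, Real.norm_eq_abs]
    refine (mul_le_mul_of_nonneg_right (h x) (norm_nonneg _)).trans (le_of_eq ?_)
    by_cases hx : x ∈ Set.Icc 0 T <;> simp [hx]

lemma integrable (hf : BddSupp f) : Integrable f := by
  simpa using hf.integrable_mul (k := fun _ => 1) fun T => by simp

lemma integrable_div (hf : BddSupp f) {H : ℝ} (h1 : 1 / 2 < H) (x : ℝ) :
    Integrable (fun t : ℝ => f t / |t - x| ^ (3 / 2 - H)) := by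
  have : (fun t : ℝ => f t / |t - x| ^ (3 / 2 - H)) =
      fun t => f t * |x - t| ^ (-(3 / 2 - H)) := by
    funext t
    rw [Real.rpow_neg (abs_nonneg _), div_eq_mul_inv, abs_sub_comm]
  rw [this]
  refine hf.integrable_mul fun T => ?_
  rcases lt_or_ge T 0 with hT | hT
  · simp [Set.Icc_eq_empty (not_le.2 hT)]
  · rw [← intervalIntegrable_iff_integrableOn_Icc_of_le hT]
    exact intervalIntegrable_abs_sub_rpow (by linarith) x 0 T

lemma integrable_kernel (hf : BddSupp f) (hg : BddSupp g) {H : ℝ} (h1 : 1 / 2 < H) :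
    Integrable (fun p : ℝ × ℝ => f p.1 * g p.2 * |p.1 - p.2| ^ (2 * H - 2)) := by
  obtain ⟨C, T, hC, hT, h⟩ := hf.bound
  obtain ⟨C', T', hC', hT', h'⟩ := hg.bound
  have h0 : Integrable ((Set.Icc 0 (max T T') ×ˢ Set.Icc 0 (max T T')).indicator
      fun p : ℝ × ℝ => C * C' * |p.1 - p.2| ^ (2 * H - 2)) :=
    (integrable_indicator_iff (measurableSet_Icc.prod measurableSet_Icc)).2
      ((integrableOn_kernel_prod h1 _).const_mul _)
  refine h0.mono' ?_ (ae_of_all _ fun p => ?_)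
  · rw [Measure.volume_eq_prod]
    exact ((hf.aemeasurable.comp_fst.mul hg.aemeasurable.comp_snd).mul
      (Measurable.aemeasurable (by fun_prop))).aestronglyMeasurable
  · have hk : 0 ≤ |p.1 - p.2| ^ (2 * H - 2) := by positivity
    rw [norm_mul, Real.norm_of_nonneg hk, norm_mul, Real.norm_eq_abs, Real.norm_eq_abs]
    have hp : |f p.1| * |g p.2| ≤ (Set.Icc 0 T).indicator (fun _ => C) p.1 *
        (Set.Icc 0 T').indicator (fun _ => C') p.2 :=
      mul_le_mul (h _) (h' _) (abs_nonneg _) ((abs_nonneg _).trans (h _))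
    refine (mul_le_mul_of_nonneg_right hp hk).trans ?_
    simp only [Set.indicator_apply, Set.mem_prod, Set.mem_Icc, le_max_iff]
    split_ifs with a1 a2 a3 <;> first | (exfalso; tauto) | exact le_rfl |
      (simp only [mul_zero, zero_mul]; positivity)
end BddSupp

lemma bddSupp_indicator {f : ℝ → ℝ} (hf : BddSupp f) {s : Set ℝ} (hs : MeasurableSet s) :
    BddSupp (s.indicator f) := by
  refine ⟨hf.aemeasurable.indicator hs, ?_⟩
  obtain ⟨C, T, hC, hT, h⟩ := hf.bound
  refine ⟨C, T, hC, hT, fun x => le_trans ?_ (h x)⟩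
  by_cases hx : x ∈ s <;> simp [hx]

lemma bddSupp_Icc {a b : ℝ} (ha : 0 ≤ a) (c : ℝ) :
    BddSupp ((Set.Icc a b).indicator fun _ => c) := by
  refine ⟨aemeasurable_const.indicator measurableSet_Icc, |c|, max b 0, abs_nonneg _,
    le_max_right _ _, fun x => ?_⟩
  simp only [Set.indicator_apply, Set.mem_Icc, le_max_iff]
  split_ifs with h1 h2 h2
  · exact le_rfl
  · exact absurd ⟨ha.trans h1.1, Or.inl h1.2⟩ h2
  · simp
  · simp

lemma bddSupp_stepFn (φ : StepFn) : BddSupp φ.eval := by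
  have : φ.eval = fun s => ∑ t ∈ φ.support, (Set.Icc (0 : ℝ) (t : ℝ)).indicator
      (fun _ => φ t) s := by
    funext s; rfl
  rw [this]
  exact BddSupp.sum _ fun t _ => bddSupp_Icc le_rfl _

/-! ### The inner product of `L²_H` -/

/-- The bilinear form `H(2H-1) ∬ f(u) g(v) |u - v|^{2H-2} du dv`. -/
noncomputable def fracInner (H : ℝ) (f g : ℝ → ℝ) : ℝ :=
  H * (2 * H - 1) * ∫ p : ℝ × ℝ, f p.1 * g p.2 * |p.1 - p.2| ^ (2 * H - 2)

section Inner
variable {H : ℝ} {f g k : ℝ → ℝ}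

lemma fracInner_comm (f g : ℝ → ℝ) : fracInner H f g = fracInner H g f := by
  unfold fracInner
  rw [Measure.volume_eq_prod, ← integral_prod_swap]
  congr 2
  funext p
  simp only [Prod.fst_swap, Prod.snd_swap]
  rw [abs_sub_comm]; ring

lemma fracInner_add_left (h1 : 1 / 2 < H) (hf : BddSupp f) (hg : BddSupp g) (hk : BddSupp k) :
    fracInner H (fun x => f x + g x) k = fracInner H f k + fracInner H g k := by
  unfold fracInner
  rw [← mul_add, ← integral_add (hf.integrable_kernel hk h1) (hg.integrable_kernel hk h1)]
  congr 2
  funext p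
  ring

lemma fracInner_const_mul_left (c : ℝ) (f k : ℝ → ℝ) :
    fracInner H (fun x => c * f x) k = c * fracInner H f k := by
  unfold fracInner
  rw [mul_left_comm c, ← integral_const_mul c]
  congr 2
  funext p
  ring

lemma fracInner_zero_left (k : ℝ → ℝ) : fracInner H (fun _ => 0) k = 0 := by
  simp [fracInner]

lemma fracInner_sum_left (h1 : 1 / 2 < H) {ι : Type*} (s : Finset ι) {f : ι → ℝ → ℝ}
    (hf : ∀ i ∈ s, BddSupp (f i)) (hk : BddSupp k) :
    fracInner H (fun x => ∑ i ∈ s, f i x) k = ∑ i ∈ s, fracInner H (f i) k := by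
  classical
  induction s using Finset.induction_on with
  | empty => simp [fracInner_zero_left]
  | insert i s hi ih =>
    simp only [Finset.sum_insert hi]
    rw [fracInner_add_left h1 (hf i (by simp)) (BddSupp.sum s fun j hj => hf j (by simp [hj])) hk,
      ih fun j hj => hf j (by simp [hj])]

lemma fracInner_add_right (h1 : 1 / 2 < H) (hf : BddSupp f) (hg : BddSupp g) (hk : BddSupp k) :
    fracInner H k (fun x => f x + g x) = fracInner H k f + fracInner H k g := by
  rw [fracInner_comm, fracInner_add_left h1 hf hg hk, fracInner_comm f, fracInner_comm g]

lemma fracInner_const_mul_right (c : ℝ) (f k : ℝ → ℝ) :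
    fracInner H k (fun x => c * f x) = c * fracInner H k f := by
  rw [fracInner_comm, fracInner_const_mul_left, fracInner_comm]

lemma fracInner_sum_right (h1 : 1 / 2 < H) {ι : Type*} (s : Finset ι) {f : ι → ℝ → ℝ}
    (hf : ∀ i ∈ s, BddSupp (f i)) (hk : BddSupp k) :
    fracInner H k (fun x => ∑ i ∈ s, f i x) = ∑ i ∈ s, fracInner H k (f i) := by
  rw [fracInner_comm, fracInner_sum_left h1 s hf hk]
  exact Finset.sum_congr rfl fun i _ => fracInner_comm _ _

lemma fracInner_congr_ae {f' g' : ℝ → ℝ} (hf : f =ᵐ[volume] f') (hg : g =ᵐ[volume] g') :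
    fracInner H f g = fracInner H f' g' := by
  unfold fracInner
  congr 1
  refine integral_congr_ae ?_
  rw [Measure.volume_eq_prod]
  filter_upwards [Measure.quasiMeasurePreserving_fst.ae_eq hf,
    Measure.quasiMeasurePreserving_snd.ae_eq hg] with p h1 h2
  simp only [Function.comp_apply] at h1 h2
  rw [h1, h2]

/-- Domination of the bilinear form, for functions dominated by multiples of indicators. -/
lemma abs_fracInner_le (h1 : 1 / 2 < H) {C D : ℝ} {F G : ℝ → ℝ} (hF : BddSupp F)
    (hG : BddSupp G) (hf : ∀ x, |f x| ≤ C * F x) (hg : ∀ x, |g x| ≤ D * G x) :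
    |fracInner H f g| ≤ C * D * fracInner H F G := by
  have hc : 0 < H * (2 * H - 1) := by
    have : 0 < 2 * H - 1 := by linarith
    positivity
  unfold fracInner
  rw [abs_mul, abs_of_pos hc, mul_left_comm, ← integral_const_mul]
  refine mul_le_mul_of_nonneg_left ?_ hc.le
  rw [← Real.norm_eq_abs]
  refine norm_integral_le_of_norm_le ((hF.integrable_kernel hG h1).const_mul _)
    (ae_of_all _ fun p => ?_)
  have hk : 0 ≤ |p.1 - p.2| ^ (2 * H - 2) := by positivity
  rw [norm_mul, Real.norm_of_nonneg hk, norm_mul, Real.norm_eq_abs, Real.norm_eq_abs]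
  calc _ ≤ (C * F p.1 * (D * G p.2)) * |p.1 - p.2| ^ (2 * H - 2) := by
        refine mul_le_mul_of_nonneg_right ?_ hk
        exact mul_le_mul (hf _) (hg _) (abs_nonneg _) ((abs_nonneg _).trans (hf _))
    _ = _ := by ring

lemma fracInner_Icc_right (h1 : 1 / 2 < H) (hf : BddSupp f) {a b : ℝ} (ha : 0 ≤ a) (hab : a ≤ b) :
    fracInner H f ((Set.Icc a b).indicator fun _ => 1) = ∫ u, f u * cellKernel H a b u := by
  unfold fracInner
  rw [Measure.volume_eq_prod, integral_prod _ (by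
    simpa [Measure.volume_eq_prod] using hf.integrable_kernel (bddSupp_Icc (b := b) ha 1) h1),
    ← integral_const_mul]
  congr 1
  funext u
  rw [← integral_kernel_Icc h1 hab, ← integral_indicator measurableSet_Icc, mul_left_comm (f u),
    ← integral_const_mul (f u)]
  congr 2
  funext v
  by_cases hv : v ∈ Set.Icc a b <;> simp [hv]

/-- The covariance of fractional Brownian motion as an inner product of indicators. -/
lemma fracInner_Icc_Icc (h1 : 1 / 2 < H) {s t : ℝ} (hs : 0 ≤ s) (ht : 0 ≤ t) :
    fracInner H ((Set.Icc 0 s).indicator fun _ => 1) ((Set.Icc 0 t).indicator fun _ => 1) =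
      (t ^ (2 * H) + s ^ (2 * H) - |t - s| ^ (2 * H)) / 2 := by
  rw [fracInner_Icc_right h1 (bddSupp_Icc le_rfl 1) le_rfl ht]
  have e : (fun u => (Set.Icc 0 s).indicator (fun _ => (1 : ℝ)) u * cellKernel H 0 t u) =
      (Set.Icc 0 s).indicator (cellKernel H 0 t) := by
    funext u
    by_cases hu : u ∈ Set.Icc 0 s <;> simp [hu]
  rw [e, integral_indicator measurableSet_Icc, integral_Icc_eq_integral_Ioc,
    ← intervalIntegral.integral_of_le hs]
  have hd : ∀ u : ℝ, HasDerivAt (fun u : ℝ => (|u| ^ (2 * H) - |u - t| ^ (2 * H)) / 2)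
      (cellKernel H 0 t u) u := by
    intro u
    have a1 := hasDerivAt_abs_rpow u (p := 2 * H) (by linarith)
    have a2 := (hasDerivAt_abs_rpow (u - t) (p := 2 * H) (by linarith)).comp u
      ((hasDerivAt_id u).sub_const t)
    refine ((a1.sub a2).div_const 2).congr_deriv ?_
    simp only [cellKernel, oddPow, sub_zero, show 2 * H - 1 - 1 = 2 * H - 2 by ring]
    ring
  rw [intervalIntegral.integral_eq_sub_of_hasDerivAt (fun u _ => hd u)
    ((continuous_cellKernel h1 0 t).intervalIntegrable _ _)]
  have h0 : (0 : ℝ) ^ (2 * H) = 0 := Real.zero_rpow (by linarith)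
  simp only [abs_zero, h0, zero_sub, abs_neg, abs_of_nonneg hs, abs_of_nonneg ht]
  rw [abs_sub_comm s t]
  ring

/-- Schur's test for the kernel `|u - v|^{2H-2}` on `[0, T]²`. -/
lemma fracInner_self_le (h1 : 1 / 2 < H) (h2 : H < 1) (hf : BddSupp f) {T : ℝ} (hT : 0 ≤ T)
    (hfT : ∀ x, x ∉ Set.Icc 0 T → f x = 0) :
    fracInner H f f ≤ 2 * H * T ^ (2 * H - 1) * ∫ x, f x ^ 2 := by
  have hc : 0 < H * (2 * H - 1) := by
    have : 0 < 2 * H - 1 := by linarith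
    positivity
  set I : ℝ → ℝ := (Set.Icc 0 T).indicator fun _ => 1 with hI
  have hIb : BddSupp I := bddSupp_Icc le_rfl 1
  have hsq : BddSupp (fun x => f x ^ 2) := by
    obtain ⟨C, T', hC, hT', h⟩ := hf.bound
    refine ⟨hf.aemeasurable.pow_const 2, C ^ 2, T', by positivity, hT', fun x => ?_⟩
    rw [abs_pow]
    refine (pow_le_pow_left₀ (abs_nonneg _) (h x) 2).trans (le_of_eq ?_)
    by_cases hx : x ∈ Set.Icc 0 T' <;> simp [hx]
  have hle : fracInner H f f ≤ fracInner H (fun x => f x ^ 2) I := by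
    have h3 : fracInner H (fun x => f x ^ 2) I =
        (fracInner H (fun x => f x ^ 2) I + fracInner H I (fun x => f x ^ 2)) / 2 := by
      rw [fracInner_comm I]; ring
    rw [h3]
    unfold fracInner
    rw [← mul_add, ← integral_add (hsq.integrable_kernel hIb h1) (hIb.integrable_kernel hsq h1),
      mul_div_assoc, ← integral_div]
    refine mul_le_mul_of_nonneg_left ?_ hc.le
    refine integral_mono (hf.integrable_kernel hf h1)
      (((hsq.integrable_kernel hIb h1).add (hIb.integrable_kernel hsq h1)).div_const 2)
      fun p => ?_
    simp only
    rw [← add_mul, mul_div_right_comm]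
    refine mul_le_mul_of_nonneg_right ?_ (by positivity)
    by_cases hp1 : p.1 ∈ Set.Icc 0 T
    · by_cases hp2 : p.2 ∈ Set.Icc 0 T
      · simp only [hI, Set.indicator_of_mem hp1, Set.indicator_of_mem hp2]
        nlinarith [sq_nonneg (f p.1 - f p.2)]
      · simp [hI, hfT _ hp2, Set.indicator_of_mem hp1, Set.indicator_of_notMem hp2]
    · by_cases hp2 : p.2 ∈ Set.Icc 0 T
      · simp [hI, hfT _ hp1, Set.indicator_of_mem hp2, Set.indicator_of_notMem hp1]
      · simp [hI, hfT _ hp1, Set.indicator_of_notMem hp2, Set.indicator_of_notMem hp1]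
  refine hle.trans ?_
  rw [hI, fracInner_Icc_right h1 hsq le_rfl hT, ← integral_const_mul]
  refine integral_mono (hsq.integrable_mul fun T =>
    (continuous_cellKernel h1 0 _).integrableOn_Icc) (hsq.integrable.const_mul _) fun x => ?_
  have := cellKernel_le h1 h2 hT x
  rw [sub_zero] at this
  simp only
  rw [mul_comm]
  exact mul_le_mul_of_nonneg_right this (sq_nonneg _)

end Inner

end

/-! ### The operator `M` is an isometry -/

section

section Isometry
variable {H : ℝ} {f g : ℝ → ℝ}

lemma opM_eq (f : ℝ → ℝ) (x : ℝ) :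
    opM H f x = constC H * ∫ t : ℝ, f t * |t - x| ^ (-(3 / 2 - H)) := by
  unfold opM
  congr 2
  funext t
  rw [Real.rpow_neg (abs_nonneg _), div_eq_mul_inv]

lemma ae_fst_ne_snd : ∀ᵐ p : ℝ × ℝ, p.1 ≠ p.2 := by
  rw [Measure.volume_eq_prod]
  rw [Measure.ae_prod_iff_ae_ae (by
    simpa [Set.compl_ofPred] using (measurableSet_eq_fun measurable_fst measurable_snd).compl)]
  exact ae_of_all _ fun u => by
    filter_upwards [compl_mem_ae_iff.2 (measure_singleton u)] with v hv
    exact fun h => hv h.symm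

/-- The triple kernel whose two iterated integrals give the isometry property of `M`. -/
lemma integrable_tripleKernel (h1 : 1 / 2 < H) (h2 : H < 1) (hf : BddSupp f) (hg : BddSupp g) :
    Integrable (fun q : ℝ × ℝ × ℝ => (f q.2.1 * |q.2.1 - q.1| ^ (-(3 / 2 - H))) *
      (g q.2.2 * |q.2.2 - q.1| ^ (-(3 / 2 - H)))) := by
  rw [Measure.volume_eq_prod, integrable_prod_iff']
  · have key : ∀ᵐ y : ℝ × ℝ, Integrable (fun x : ℝ =>
        (f y.1 * |y.1 - x| ^ (-(3 / 2 - H))) * (g y.2 * |y.2 - x| ^ (-(3 / 2 - H)))) ∧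
        ∫ x : ℝ, ‖(f y.1 * |y.1 - x| ^ (-(3 / 2 - H))) * (g y.2 * |y.2 - x| ^ (-(3 / 2 - H)))‖ =
        (2 * beta (2 * (3 / 2 - H) - 1) (1 - (3 / 2 - H)) + beta (1 - (3 / 2 - H))
          (1 - (3 / 2 - H))) * ‖f y.1 * g y.2 * |y.1 - y.2| ^ (2 * H - 2)‖ := by
      filter_upwards [ae_fst_ne_snd] with y hy
      obtain ⟨i, e⟩ := integrable_rieszKernel (a := 3 / 2 - H) (by linarith) (by linarith) hy
      constructor
      · refine (i.const_mul (f y.1 * g y.2)).congr (ae_of_all _ fun x => ?_)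
        simp only; ring
      · have : ∀ x : ℝ, ‖(f y.1 * |y.1 - x| ^ (-(3 / 2 - H))) *
            (g y.2 * |y.2 - x| ^ (-(3 / 2 - H)))‖ = ‖f y.1 * g y.2‖ *
            (|y.1 - x| ^ (-(3 / 2 - H)) * |y.2 - x| ^ (-(3 / 2 - H))) := by
          intro x
          rw [show (f y.1 * |y.1 - x| ^ (-(3 / 2 - H))) * (g y.2 * |y.2 - x| ^ (-(3 / 2 - H))) =
            (f y.1 * g y.2) * (|y.1 - x| ^ (-(3 / 2 - H)) * |y.2 - x| ^ (-(3 / 2 - H))) by ring,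
            norm_mul, Real.norm_of_nonneg (by positivity :
              0 ≤ |y.1 - x| ^ (-(3 / 2 - H)) * |y.2 - x| ^ (-(3 / 2 - H)))]
        simp_rw [this]
        rw [integral_const_mul, e, norm_mul (f y.1 * g y.2), Real.norm_of_nonneg
          (by positivity : 0 ≤ |y.1 - y.2| ^ (2 * H - 2)),
          show 1 - 2 * (3 / 2 - H) = 2 * H - 2 by ring]
        ring
    refine ⟨key.mono fun y hy => hy.1, ?_⟩
    refine ((hf.integrable_kernel hg h1).norm.const_mul (2 * beta (2 * (3 / 2 - H) - 1)
      (1 - (3 / 2 - H)) + beta (1 - (3 / 2 - H)) (1 - (3 / 2 - H)))).congr ?_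
    exact key.mono fun y hy => hy.2.symm
  · refine AEMeasurable.aestronglyMeasurable (.mul (.mul ?_ ?_) (.mul ?_ ?_))
    · exact (hf.aemeasurable.comp_fst (ν := (volume : Measure ℝ))).comp_snd
    · exact Measurable.aemeasurable (by fun_prop)
    · exact (hg.aemeasurable.comp_snd (μ := (volume : Measure ℝ))).comp_snd
    · exact Measurable.aemeasurable (by fun_prop)

lemma integral_tripleKernel_right (f g : ℝ → ℝ) (x : ℝ) :
    constC H ^ 2 * ∫ y : ℝ × ℝ, (f y.1 * |y.1 - x| ^ (-(3 / 2 - H))) *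
      (g y.2 * |y.2 - x| ^ (-(3 / 2 - H))) = opM H f x * opM H g x := by
  rw [Measure.volume_eq_prod, integral_prod_mul (fun u => f u * |u - x| ^ (-(3 / 2 - H)))
    (fun v => g v * |v - x| ^ (-(3 / 2 - H))), opM_eq, opM_eq]
  ring

lemma integrable_opM_mul (h1 : 1 / 2 < H) (h2 : H < 1) (hf : BddSupp f) (hg : BddSupp g) :
    Integrable (fun x => opM H f x * opM H g x) := by
  have h := integrable_tripleKernel h1 h2 hf hg
  rw [Measure.volume_eq_prod] at h
  refine (h.integral_prod_left.const_mul (constC H ^ 2)).congr (ae_of_all _ fun x => ?_)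
  exact integral_tripleKernel_right f g x

/-- `M` is an isometry from `L²_H` to `L²(ℝ)`. -/
lemma integral_opM_mul (h1 : 1 / 2 < H) (h2 : H < 1) (hf : BddSupp f) (hg : BddSupp g) :
    ∫ x, opM H f x * opM H g x = fracInner H f g := by
  have h := integrable_tripleKernel h1 h2 hf hg
  rw [Measure.volume_eq_prod] at h
  simp_rw [← integral_tripleKernel_right f g]
  rw [integral_const_mul, integral_integral_swap (f := fun (x : ℝ) (y : ℝ × ℝ) =>
    (f y.1 * |y.1 - x| ^ (-(3 / 2 - H))) * (g y.2 * |y.2 - x| ^ (-(3 / 2 - H)))) h]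
  unfold fracInner
  rw [← constC_sq_mul_beta h1 h2, mul_assoc]
  congr 1
  rw [← integral_const_mul]
  refine integral_congr_ae ?_
  filter_upwards [ae_fst_ne_snd] with y hy
  obtain ⟨i, e⟩ := integrable_rieszKernel (a := 3 / 2 - H) (by linarith) (by linarith) hy
  have : ∀ x : ℝ, (f y.1 * |y.1 - x| ^ (-(3 / 2 - H))) * (g y.2 * |y.2 - x| ^ (-(3 / 2 - H))) =
      (f y.1 * g y.2) * (|y.1 - x| ^ (-(3 / 2 - H)) * |y.2 - x| ^ (-(3 / 2 - H))) := by
    intro x; ring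
  simp_rw [this]
  rw [integral_const_mul, e, show 1 - 2 * (3 / 2 - H) = 2 * H - 2 by ring]
  ring

lemma memLp_opM (h1 : 1 / 2 < H) (h2 : H < 1) (hf : BddSupp f) : MemLp (opM H f) 2 := by
  rw [memLp_two_iff_integrable_sq]
  · simpa [sq] using integrable_opM_mul h1 h2 hf hf
  · have : opM H f = fun x => constC H * ∫ t : ℝ, f t * |t - x| ^ (-(3 / 2 - H)) := by
      funext x; exact opM_eq f x
    rw [this]
    refine AEStronglyMeasurable.const_mul ?_ _
    have hm : AEStronglyMeasurable (fun q : ℝ × ℝ => f q.2 * |q.2 - q.1| ^ (-(3 / 2 - H)))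
        (volume.prod volume) :=
      (hf.aemeasurable.comp_snd.mul (Measurable.aemeasurable (by fun_prop))).aestronglyMeasurable
    exact hm.integral_prod_right'

lemma memL2H_of_bddSupp (h1 : 1 / 2 < H) (h2 : H < 1) (hf : BddSupp f) : MemL2H H f :=
  ⟨ae_of_all _ fun x => hf.integrable_div h1 x, memLp_opM h1 h2 hf⟩

lemma fracInner_self_nonneg (h1 : 1 / 2 < H) (h2 : H < 1) (hf : BddSupp f) :
    0 ≤ fracInner H f f := by
  rw [← integral_opM_mul h1 h2 hf hf]
  exact integral_nonneg fun x => mul_self_nonneg _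

lemma eLpNorm_two_eq {α : Type*} [MeasurableSpace α] {μ : Measure α} {F : α → ℝ}
    (hF : MemLp F 2 μ) : eLpNorm F 2 μ = ENNReal.ofReal √(∫ x, F x ^ 2 ∂μ) := by
  rw [MemLp.eLpNorm_eq_integral_rpow_norm (by norm_num) (by norm_num) hF]
  congr 1
  rw [Real.sqrt_eq_rpow]
  norm_num

lemma eLpNorm_opM (h1 : 1 / 2 < H) (h2 : H < 1) (hf : BddSupp f) :
    eLpNorm (opM H f) 2 volume = ENNReal.ofReal √(fracInner H f f) := by
  rw [eLpNorm_two_eq (memLp_opM h1 h2 hf), ← integral_opM_mul h1 h2 hf hf]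
  simp_rw [sq]

end Isometry

end

/-! ### Cells of the grid `ℤ / N` -/

section

/-- The cell `[m / N, (m + 1) / N]`. -/
def cell (N : ℕ) (m : ℤ) : Set ℝ := Set.Icc ((m : ℝ) / N) (((m : ℝ) + 1) / N)

lemma measurableSet_cell (N : ℕ) (m : ℤ) : MeasurableSet (cell N m) := measurableSet_Icc

lemma cell_eq_closedBall {N : ℕ} (m : ℤ) :
    cell N m = Metric.closedBall (((m : ℝ) + 1 / 2) / N) (1 / (2 * N)) := by
  rw [Real.closedBall_eq_Icc, cell]
  congr 1 <;> (ring)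

/-- Lebesgue's differentiation theorem along the cells at bounded distance from the cell of `t`. -/
lemma ae_tendsto_integral_cell {f : ℝ → ℝ} (hf : LocallyIntegrable f) :
    ∀ᵐ t : ℝ, ∀ j : ℤ, Tendsto (fun N : ℕ =>
        (N : ℝ) * ∫ u in cell N (⌊(N : ℝ) * t⌋ + j), |f u - f t|)
      atTop (𝓝 0) := by
  have h : ∀ᵐ t : ℝ, ∀ K : ℕ, ∀ (w : ℕ → ℝ) (δ : ℕ → ℝ), Tendsto δ atTop (𝓝[>] 0) →
      (∀ᶠ j in atTop, t ∈ Metric.closedBall (w j) ((K : ℝ) * δ j)) →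
      Tendsto (fun j => ⨍ y in Metric.closedBall (w j) (δ j), ‖f y - f t‖) atTop (𝓝 0) := by
    rw [ae_all_iff]
    intro K
    filter_upwards [IsUnifLocDoublingMeasure.ae_tendsto_average_norm_sub (μ := volume) hf (K : ℝ)]
      with t ht w δ h1 h2
    exact ht w δ h1 h2
  filter_upwards [h] with t ht j
  have hδ : Tendsto (fun N : ℕ => 1 / (2 * (N : ℝ))) atTop (𝓝[>] 0) := by
    rw [tendsto_nhdsWithin_iff]
    constructor
    · have := tendsto_one_div_atTop_nhds_zero_nat (𝕜 := ℝ)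
      have := this.const_mul (1 / 2)
      simp only [mul_zero] at this
      refine this.congr fun N => ?_
      rw [one_div_mul_one_div]
    · filter_upwards [eventually_gt_atTop 0] with N hN
      have : (0 : ℝ) < N := by exact_mod_cast hN
      simp only [Set.mem_Ioi]; positivity
  have := ht (2 * (j.natAbs + 1)) (fun N => (((⌊(N : ℝ) * t⌋ + j : ℤ) : ℝ) + 1 / 2) / N)
    (fun N => 1 / (2 * (N : ℝ))) hδ ?_
  · refine (this.congr' ?_)
    filter_upwards [eventually_gt_atTop 0] with N hN
    have hN : (0 : ℝ) < N := by exact_mod_cast hN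
    rw [← cell_eq_closedBall, setAverage_eq, cell, Real.volume_real_Icc_of_le
      (by gcongr; linarith)]
    simp only [Real.norm_eq_abs, smul_eq_mul]
    congr 1
    field_simp
    ring
  · filter_upwards [eventually_gt_atTop 0] with N hN
    have hN : (0 : ℝ) < N := by exact_mod_cast hN
    rw [Metric.mem_closedBall, Real.dist_eq]
    have h1 := Int.floor_le ((N : ℝ) * t)
    have h2 := Int.lt_floor_add_one ((N : ℝ) * t)
    have h3 : t - (((⌊(N : ℝ) * t⌋ + j : ℤ) : ℝ) + 1 / 2) / N =
        ((N : ℝ) * t - ⌊(N : ℝ) * t⌋ - 1 / 2 - j) / N := by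
      push_cast; field_simp; ring
    have h4 : ((j.natAbs : ℕ) : ℝ) = |(j : ℝ)| := by
      rw [Nat.cast_natAbs]; push_cast; rfl
    rw [h3, abs_div, abs_of_pos hN]
    push_cast
    rw [h4, div_le_iff₀ hN]
    have h5 : |(N : ℝ) * t - ⌊(N : ℝ) * t⌋ - 1 / 2 - j| ≤ 1 + |(j : ℝ)| := by
      refine (abs_sub _ _).trans (add_le_add ?_ le_rfl)
      rw [abs_le]; constructor <;> linarith
    refine h5.trans (le_of_eq ?_)
    field_simp
    ring

/-! ### Covariances of fractional Gaussian noise -/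

/-- The autocovariance of fractional Gaussian noise. -/
noncomputable def fgnCov (H : ℝ) (j : ℤ) : ℝ :=
  (|(j : ℝ) + 1| ^ (2 * H) - 2 * |(j : ℝ)| ^ (2 * H) + |(j : ℝ) - 1| ^ (2 * H)) / 2

/-- The indicator function of a cell. -/
noncomputable def cellOne (N : ℕ) (m : ℤ) : ℝ → ℝ := (cell N m).indicator fun _ => 1

variable {H : ℝ}

lemma bddSupp_cellOne (N : ℕ) {m : ℤ} (hm : 0 ≤ m) : BddSupp (cellOne N m) :=
  bddSupp_Icc (div_nonneg (by exact_mod_cast hm) (by positivity)) 1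

lemma cellOne_ae_eq {N : ℕ} {m : ℤ} (hm : 0 ≤ m) :
    cellOne N m =ᵐ[volume] fun x =>
      (Set.Icc 0 (((m : ℝ) + 1) / N)).indicator (fun _ => 1) x -
        (Set.Icc 0 ((m : ℝ) / N)).indicator (fun _ => 1) x := by
  have hm' : (0 : ℝ) ≤ m := by exact_mod_cast hm
  have h0 : 0 ≤ (m : ℝ) / N := by positivity
  have h1 : (m : ℝ) / N ≤ ((m : ℝ) + 1) / N := by gcongr; linarith
  filter_upwards [compl_mem_ae_iff.2 (measure_singleton ((m : ℝ) / N))] with x hx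
  have hx : x ≠ (m : ℝ) / N := hx
  simp only [cellOne, cell, Set.indicator_apply, Set.mem_Icc]
  rcases lt_or_gt_of_ne hx with h | h
  · have a1 : ¬ (m : ℝ) / N ≤ x := not_le.2 h
    have a2 : x ≤ (m : ℝ) / N := h.le
    have a3 : x ≤ ((m : ℝ) + 1) / N := h.le.trans h1
    simp [a1, a2, a3]
  · have a1 : (m : ℝ) / N ≤ x := h.le
    have a2 : ¬ x ≤ (m : ℝ) / N := not_le.2 h
    have a3 : 0 ≤ x := h0.trans a1
    simp [a1, a2, a3]

lemma fracInner_sub_sub (h1 : 1 / 2 < H) {a b c d : ℝ → ℝ} (ha : BddSupp a) (hb : BddSupp b)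
    (hc : BddSupp c) (hd : BddSupp d) :
    fracInner H (fun x => a x - b x) (fun x => c x - d x) =
      fracInner H a c - fracInner H a d - fracInner H b c + fracInner H b d := by
  have e : ∀ p q : ℝ → ℝ, (fun x => p x - q x) = fun x => p x + (-1) * q x := fun p q => by
    funext x; ring
  rw [e a b, e c d, fracInner_add_left h1 ha (hb.const_mul _) (hc.add (hd.const_mul _)),
    fracInner_const_mul_left, fracInner_add_right h1 hc (hd.const_mul _) ha,
    fracInner_add_right h1 hc (hd.const_mul _) hb, fracInner_const_mul_right,
    fracInner_const_mul_right]
  ring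

lemma fracInner_cellOne (h1 : 1 / 2 < H) {N : ℕ} (hN : 0 < N) {m n : ℤ} (hm : 0 ≤ m) (hn : 0 ≤ n) :
    fracInner H (cellOne N m) (cellOne N n) = (N : ℝ) ^ (-(2 * H)) * fgnCov H (n - m) := by
  have hN' : (0 : ℝ) < N := by exact_mod_cast hN
  have hm' : (0 : ℝ) ≤ m := by exact_mod_cast hm
  have hn' : (0 : ℝ) ≤ n := by exact_mod_cast hn
  have sc : ∀ x : ℝ, |x / N| ^ (2 * H) = (N : ℝ) ^ (-(2 * H)) * |x| ^ (2 * H) := by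
    intro x
    rw [abs_div, abs_of_pos hN', Real.div_rpow (abs_nonneg _) hN'.le, Real.rpow_neg hN'.le]
    field_simp
  have a1 : (0 : ℝ) ≤ (m : ℝ) / N := by positivity
  have a2 : (0 : ℝ) ≤ ((m : ℝ) + 1) / N := by positivity
  have a3 : (0 : ℝ) ≤ (n : ℝ) / N := by positivity
  have a4 : (0 : ℝ) ≤ ((n : ℝ) + 1) / N := by positivity
  rw [fracInner_congr_ae (cellOne_ae_eq hm) (cellOne_ae_eq hn),
    fracInner_sub_sub h1 (bddSupp_Icc le_rfl 1) (bddSupp_Icc le_rfl 1) (bddSupp_Icc le_rfl 1)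
      (bddSupp_Icc le_rfl 1), fracInner_Icc_Icc h1 a2 a4, fracInner_Icc_Icc h1 a2 a3,
    fracInner_Icc_Icc h1 a1 a4, fracInner_Icc_Icc h1 a1 a3]
  simp only [← sub_div, sc, fgnCov]
  push_cast
  rw [show (n : ℝ) + 1 - (m + 1) = n - m by ring, show (n : ℝ) - (m + 1) = n - m - 1 by ring,
    show (n : ℝ) + 1 - m = n - m + 1 by ring]
  ring

lemma fracInner_nonneg (h1 : 1 / 2 < H) {f g : ℝ → ℝ} (hf : ∀ x, 0 ≤ f x) (hg : ∀ x, 0 ≤ g x) :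
    0 ≤ fracInner H f g := by
  have h3 : 0 < 2 * H - 1 := by linarith
  have : 0 ≤ ∫ p : ℝ × ℝ, f p.1 * g p.2 * |p.1 - p.2| ^ (2 * H - 2) :=
    integral_nonneg fun p => mul_nonneg (mul_nonneg (hf _) (hg _)) (by positivity)
  unfold fracInner
  positivity

lemma cellOne_nonneg (N : ℕ) (m : ℤ) (x : ℝ) : 0 ≤ cellOne N m x :=
  Set.indicator_nonneg (fun _ _ => zero_le_one) x

lemma fgnCov_neg (j : ℤ) : fgnCov H (-j) = fgnCov H j := by
  unfold fgnCov
  push_cast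
  rw [abs_neg, show -(j : ℝ) + 1 = -(j - 1) by ring, show -(j : ℝ) - 1 = -(j + 1) by ring,
    abs_neg, abs_neg]
  ring

lemma fgnCov_eq_fracInner (h1 : 1 / 2 < H) {j : ℤ} (hj : 0 ≤ j) :
    fgnCov H j = fracInner H (cellOne 1 0) (cellOne 1 j) := by
  rw [fracInner_cellOne h1 one_pos le_rfl hj]; simp

lemma fgnCov_nonneg (h1 : 1 / 2 < H) (j : ℤ) : 0 ≤ fgnCov H j := by
  have : ∀ j : ℤ, 0 ≤ j → 0 ≤ fgnCov H j := fun j hj => by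
    rw [fgnCov_eq_fracInner h1 hj]
    exact fracInner_nonneg h1 (cellOne_nonneg _ _) (cellOne_nonneg _ _)
  rcases le_total 0 j with h | h
  · exact this j h
  · rw [← fgnCov_neg]; exact this (-j) (by linarith)

/-- The decay `ρ(j) = O(|j|^{2H-2})` of the covariance of fractional Gaussian noise. -/
lemma fgnCov_le (h1 : 1 / 2 < H) (h2 : H < 1) (i : ℕ) :
    fgnCov H ((i : ℤ) + 2) ≤ ((i : ℝ) + 1) ^ (2 * H - 2) := by
  have h3 : 0 < 2 * H - 1 := by linarith
  have hcell : cellOne 1 ((i : ℤ) + 2) =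
      (Set.Icc ((i : ℝ) + 2) ((i : ℝ) + 3)).indicator fun _ => 1 := by
    unfold cellOne cell
    push_cast
    rw [div_one, div_one]
    congr 2
    ring
  rw [fgnCov_eq_fracInner h1 (by positivity), hcell,
    fracInner_Icc_right h1 (bddSupp_cellOne 1 le_rfl) (by positivity) (by linarith)]
  have hk : ∀ u ∈ Set.Icc (0 : ℝ) 1, cellKernel H ((i : ℝ) + 2) ((i : ℝ) + 3) u ≤
      ((i : ℝ) + 1) ^ (2 * H - 2) := by
    intro u hu
    rw [← integral_kernel_Icc h1 (by linarith)]
    have hb := norm_setIntegral_le_of_norm_le_const (μ := volume)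
      (s := Set.Icc ((i : ℝ) + 2) ((i : ℝ) + 3)) (f := fun v => |u - v| ^ (2 * H - 2))
      (C := ((i : ℝ) + 1) ^ (2 * H - 2)) (by simp) (fun v hv => by
        rw [Real.norm_of_nonneg (by positivity)]
        refine Real.rpow_le_rpow_of_nonpos (by positivity) ?_ (by linarith)
        rw [abs_sub_comm]
        exact le_trans (by linarith [hv.1, hu.2]) (le_abs_self _))
    have hv : volume.real (Set.Icc ((i : ℝ) + 2) ((i : ℝ) + 3)) = 1 := by
      rw [Real.volume_real_Icc_of_le (by linarith)]; ring
    rw [hv, mul_one] at hb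
    have hp : 0 ≤ ((i : ℝ) + 1) ^ (2 * H - 2) := by positivity
    have h4 : H * (2 * H - 1) ≤ 1 := by nlinarith
    calc _ ≤ H * (2 * H - 1) * ((i : ℝ) + 1) ^ (2 * H - 2) := by
          refine mul_le_mul_of_nonneg_left ((le_abs_self _).trans hb) (by positivity)
      _ ≤ _ := mul_le_of_le_one_left hp h4
  have e : (fun u => cellOne 1 0 u * cellKernel H ((i : ℝ) + 2) ((i : ℝ) + 3) u) =
      (Set.Icc (0 : ℝ) 1).indicator (cellKernel H ((i : ℝ) + 2) ((i : ℝ) + 3)) := by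
    funext u
    by_cases hu : u ∈ Set.Icc (0 : ℝ) 1
    · simp [cellOne, cell, Set.indicator_of_mem hu]
    · simp [cellOne, cell, hu]
  rw [e, integral_indicator measurableSet_Icc]
  calc _ ≤ ∫ u in Set.Icc (0 : ℝ) 1, ((i : ℝ) + 1) ^ (2 * H - 2) :=
        setIntegral_mono_on (continuous_cellKernel h1 _ _).integrableOn_Icc (by simp)
          measurableSet_Icc hk
    _ = _ := by simp

/-- The squares `ρ(j)²` are of order `|j|^{4H-4}`, which is summable exactly when `H < 3/4`. -/
lemma summable_fgnCov_sq (h1 : 1 / 2 < H) (h2 : H < 3 / 4) :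
    Summable fun j : ℤ => fgnCov H j ^ 2 := by
  have hn : Summable fun i : ℕ => fgnCov H (i : ℤ) ^ 2 := by
    rw [← summable_nat_add_iff 2]
    have hs : Summable fun i : ℕ => (((i + 1 : ℕ) : ℝ)) ^ (4 * H - 4) :=
      (summable_nat_add_iff 1).2 (Real.summable_nat_rpow.2 (by linarith))
    refine hs.of_nonneg_of_le (fun i => sq_nonneg _) fun i => ?_
    have := fgnCov_le h1 (by linarith) i
    have h0 := fgnCov_nonneg h1 ((i : ℤ) + 2)
    push_cast
    calc _ ≤ (((i : ℝ) + 1) ^ (2 * H - 2)) ^ 2 := pow_le_pow_left₀ h0 this 2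
      _ = _ := by
        rw [← Real.rpow_natCast, ← Real.rpow_mul (by positivity)]
        congr 1; push_cast; ring
  refine Summable.of_nat_of_neg hn ?_
  simpa only [fgnCov_neg] using hn

/-! ### Covariances of the pieces of a bounded function -/

lemma cell_length {N : ℕ} (m : ℤ) : ((m : ℝ) + 1) / N - (m : ℝ) / N = 1 / N := by ring

section Pieces
variable {f : ℝ → ℝ} {C : ℝ}

lemma abs_indicator_cell_le (hC : ∀ x, |f x| ≤ C) (N : ℕ) (m : ℤ) (x : ℝ) :
    |(cell N m).indicator f x| ≤ C * cellOne N m x := by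
  by_cases hx : x ∈ cell N m <;> simp [cellOne, hx, hC x]

lemma abs_fracInner_pieces_le (h1 : 1 / 2 < H) (hC : ∀ x, |f x| ≤ C) {N : ℕ} (hN : 0 < N)
    {m n : ℤ} (hm : 0 ≤ m) (hn : 0 ≤ n) :
    |fracInner H ((cell N m).indicator f) ((cell N n).indicator f)| ≤
      C ^ 2 * ((N : ℝ) ^ (-(2 * H)) * fgnCov H (n - m)) := by
  have := abs_fracInner_le h1 (bddSupp_cellOne N hm) (bddSupp_cellOne N hn)
    (abs_indicator_cell_le hC N m) (abs_indicator_cell_le hC N n)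
  rwa [fracInner_cellOne h1 hN hm hn, ← sq] at this

/-- The error of replacing `f` on a cell by a constant `s`, in terms of the mean oscillation of `f`
around `s` there. -/
lemma abs_fracInner_sub_const_le (h1 : 1 / 2 < H) (h2 : H < 1) (hf : BddSupp f) {N : ℕ}
    {m n : ℤ} (hm : 0 ≤ m) (hn : 0 ≤ n) (s : ℝ) {g : ℝ → ℝ} {D : ℝ} (hD : 0 ≤ D)
    (hg : ∀ x, |g x| ≤ D * cellOne N n x) :
    |fracInner H (fun x => (cell N m).indicator f x - s * cellOne N m x) g| ≤
      D * (2 * H * (1 / (N : ℝ)) ^ (2 * H - 1)) * ∫ u in cell N m, |f u - s| := by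
  set F : ℝ → ℝ := fun x => |(cell N m).indicator f x - s * cellOne N m x| with hF
  have hB : BddSupp (fun x => (cell N m).indicator f x - s * cellOne N m x) :=
    (bddSupp_indicator hf (measurableSet_cell N m)).sub ((bddSupp_cellOne N hm).const_mul s)
  have hFB : BddSupp F := by
    refine ⟨hB.aemeasurable.abs, ?_⟩
    obtain ⟨C, T, hC, hT, h⟩ := hB.bound
    exact ⟨C, T, hC, hT, fun x => by simpa [hF] using h x⟩
  have h := abs_fracInner_le (f := fun x => (cell N m).indicator f x - s * cellOne N m x)
    (C := 1) h1 hFB (bddSupp_cellOne N hn)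
    (fun x => by simp [hF]) hg
  rw [one_mul] at h
  refine h.trans ?_
  rw [mul_assoc D]
  refine mul_le_mul_of_nonneg_left ?_ hD
  have hn' : (0 : ℝ) ≤ n := by exact_mod_cast hn
  have hle : (n : ℝ) / N ≤ ((n : ℝ) + 1) / N := by gcongr; linarith
  rw [cellOne, cell, fracInner_Icc_right h1 hFB (by positivity) hle]
  have hFi : (∫ u in cell N m, |f u - s|) = ∫ u, F u := by
    rw [← integral_indicator (measurableSet_cell N m)]
    congr 1
    funext u
    by_cases hu : u ∈ cell N m <;> simp [hF, cellOne, hu]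
  rw [hFi, ← integral_const_mul]
  refine integral_mono (hFB.integrable_mul fun T => (continuous_cellKernel h1 _ _).integrableOn_Icc)
    (hFB.integrable.const_mul _) fun u => ?_
  have := cellKernel_le h1 h2 hle u
  rw [cell_length] at this
  simp only
  rw [mul_comm]
  exact mul_le_mul_of_nonneg_right this (abs_nonneg _)

/-- On cells where `f` is close to the constant `s` in mean, the covariance of the pieces of `f` is
close to `s²` times that of fractional Gaussian noise. -/
lemma abs_fracInner_pieces_sub_le (h1 : 1 / 2 < H) (h2 : H < 1) (hf : BddSupp f)
    (hC : ∀ x, |f x| ≤ C) {N : ℕ} (hN : 0 < N) {m n : ℤ} (hm : 0 ≤ m) (hn : 0 ≤ n) {s : ℝ}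
    (hs : |s| ≤ C) :
    |(N : ℝ) ^ (2 * H) * fracInner H ((cell N m).indicator f) ((cell N n).indicator f) -
        s ^ 2 * fgnCov H (n - m)| ≤
      C * (2 * H) * ((N : ℝ) * (∫ u in cell N m, |f u - s|) +
        (N : ℝ) * ∫ u in cell N n, |f u - s|) := by
  have hN' : (0 : ℝ) < N := by exact_mod_cast hN
  have hC0 : 0 ≤ C := (abs_nonneg s).trans hs
  set p := (cell N m).indicator f with hp
  set q := (cell N n).indicator f with hq
  have pB : BddSupp p := bddSupp_indicator hf (measurableSet_cell N m)
  have qB : BddSupp q := bddSupp_indicator hf (measurableSet_cell N n)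
  have mB := bddSupp_cellOne N hm
  have nB := bddSupp_cellOne N hn
  have e : (N : ℝ) ^ (2 * H) * fracInner H p q - s ^ 2 * fgnCov H (n - m) =
      (N : ℝ) ^ (2 * H) * (fracInner H (fun x => p x - s * cellOne N m x) q +
        fracInner H (fun x => q x - s * cellOne N n x) (fun x => s * cellOne N m x)) := by
    have e1 : fracInner H (fun x => p x - s * cellOne N m x) q =
        fracInner H p q - s * fracInner H (cellOne N m) q := by
      have : (fun x => p x - s * cellOne N m x) = fun x => p x + (-s) * cellOne N m x := by
        funext x; ring
      rw [this, fracInner_add_left h1 pB (mB.const_mul _) qB, fracInner_const_mul_left]; ring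
    have e2 : fracInner H (fun x => q x - s * cellOne N n x) (fun x => s * cellOne N m x) =
        s * fracInner H (cellOne N m) q - s ^ 2 * fracInner H (cellOne N m) (cellOne N n) := by
      have : (fun x => q x - s * cellOne N n x) = fun x => q x + (-s) * cellOne N n x := by
        funext x; ring
      rw [this, fracInner_const_mul_right, fracInner_add_left h1 qB (nB.const_mul _) mB,
        fracInner_const_mul_left, fracInner_comm q, fracInner_comm (cellOne N n)]; ring
    rw [e1, e2, fracInner_cellOne h1 hN hm hn, Real.rpow_neg hN'.le]
    have : (N : ℝ) ^ (2 * H) ≠ 0 := (Real.rpow_pos_of_pos hN' _).ne'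
    field_simp
    ring
  rw [e, abs_mul, abs_of_pos (Real.rpow_pos_of_pos hN' _)]
  have b1 := abs_fracInner_sub_const_le h1 h2 hf hm hn s hC0 (abs_indicator_cell_le hC N n)
  have b2 := abs_fracInner_sub_const_le h1 h2 hf hn hm s hC0
    (g := fun x => s * cellOne N m x) (fun x => by
      rw [abs_mul, abs_of_nonneg (cellOne_nonneg N m x)]
      exact mul_le_mul_of_nonneg_right hs (cellOne_nonneg N m x))
  have sc : (N : ℝ) ^ (2 * H) * (1 / (N : ℝ)) ^ (2 * H - 1) = N := by
    rw [one_div, Real.inv_rpow hN'.le, ← Real.rpow_neg hN'.le, ← Real.rpow_add hN',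
      show 2 * H + -(2 * H - 1) = 1 by ring, Real.rpow_one]
  calc _ ≤ (N : ℝ) ^ (2 * H) * (C * (2 * H * (1 / (N : ℝ)) ^ (2 * H - 1)) *
          (∫ u in cell N m, |f u - s|) + C * (2 * H * (1 / (N : ℝ)) ^ (2 * H - 1)) *
          ∫ u in cell N n, |f u - s|) := by
        refine mul_le_mul_of_nonneg_left ?_ (by positivity)
        exact (abs_add_le _ _).trans (add_le_add b1 b2)
    _ = C * (2 * H) * (((N : ℝ) ^ (2 * H) * (1 / (N : ℝ)) ^ (2 * H - 1)) *
          (∫ u in cell N m, |f u - s|) + ((N : ℝ) ^ (2 * H) * (1 / (N : ℝ)) ^ (2 * H - 1)) *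
          ∫ u in cell N n, |f u - s|) := by ring
    _ = _ := by rw [sc]

end Pieces

end

/-! ### The limit of the asymptotic variances -/

section

section Limit
variable {H : ℝ} {f : ℝ → ℝ} {C : ℝ}

/-- The squared rescaled covariance of the pieces of `f` on two cells. -/
noncomputable def pieceCovSq (H : ℝ) (f : ℝ → ℝ) (N : ℕ) (m n : ℤ) : ℝ :=
  ((N : ℝ) ^ (2 * H) * fracInner H ((cell N m).indicator f) ((cell N n).indicator f)) ^ 2

/-- The squared rescaled covariances of the piece on the cell `m` with all pieces on `[0, 1]`,
as a sum over the distance between the cells. -/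
lemma sum_pieceCovSq_eq_tsum (N : ℕ) (m : ℤ) :
    ∑ k ∈ Finset.range N, pieceCovSq H f N m k =
      ∑' j : ℤ, if 0 ≤ m + j ∧ m + j < N then pieceCovSq H f N m (m + j) else 0 := by
  rw [tsum_eq_sum (s := (Finset.range N).image fun k : ℕ => (k : ℤ) - m)]
  · rw [Finset.sum_image (fun a _ b _ h => by simpa using h)]
    refine Finset.sum_congr rfl fun k hk => ?_
    have := Finset.mem_range.1 hk
    rw [if_pos (by constructor <;> omega)]
    congr 1; ring
  · intro j hj
    refine if_neg fun h => hj ?_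
    refine Finset.mem_image.2 ⟨(m + j).toNat, ?_, ?_⟩
    · rw [Finset.mem_range]; omega
    · omega

lemma pieceCovSq_le (h1 : 1 / 2 < H) (hC : ∀ x, |f x| ≤ C) {N : ℕ} (hN : 0 < N)
    {m n : ℤ} (hm : 0 ≤ m) (hn : 0 ≤ n) :
    pieceCovSq H f N m n ≤ C ^ 4 * fgnCov H (n - m) ^ 2 := by
  have hN' : (0 : ℝ) < N := by exact_mod_cast hN
  have h := abs_fracInner_pieces_le h1 hC hN hm hn
  have hpos : 0 < (N : ℝ) ^ (2 * H) := Real.rpow_pos_of_pos hN' _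
  rw [Real.rpow_neg hN'.le] at h
  have h' : |(N : ℝ) ^ (2 * H) * fracInner H ((cell N m).indicator f) ((cell N n).indicator f)| ≤
      C ^ 2 * fgnCov H (n - m) := by
    rw [abs_mul, abs_of_pos hpos]
    refine (mul_le_mul_of_nonneg_left h hpos.le).trans (le_of_eq ?_)
    field_simp
  unfold pieceCovSq
  rw [← sq_abs]
  refine (pow_le_pow_left₀ (abs_nonneg _) h' 2).trans (le_of_eq ?_)
  ring

lemma norm_ite_pieceCovSq_le (h1 : 1 / 2 < H) (hC : ∀ x, |f x| ≤ C) {N : ℕ} (hN : 0 < N)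
    {m : ℤ} (hm : 0 ≤ m) (j : ℤ) :
    ‖if 0 ≤ m + j ∧ m + j < N then pieceCovSq H f N m (m + j) else 0‖ ≤
      C ^ 4 * fgnCov H j ^ 2 := by
  split_ifs with h
  · rw [Real.norm_of_nonneg (by unfold pieceCovSq; positivity)]
    simpa using pieceCovSq_le h1 hC hN hm h.1
  · simp only [norm_zero]; positivity

/-- The row sums of the squared rescaled covariances at a Lebesgue point `t`: each shift `j`
contributes `(f(t)² ρ(j))²` in the limit, and `C⁴ ρ(j)²` dominates the contributions. -/
lemma tendsto_sum_pieceCovSq (h1 : 1 / 2 < H) (h2 : H < 3 / 4) (hf : BddSupp f)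
    (hC : ∀ x, |f x| ≤ C) {t : ℝ} (ht0 : 0 < t) (ht1 : t < 1)
    (ht : ∀ j : ℤ, Tendsto (fun N : ℕ => (N : ℝ) *
      ∫ u in cell N (⌊(N : ℝ) * t⌋ + j), |f u - f t|) atTop (𝓝 0)) :
    Tendsto (fun N : ℕ => ∑ k ∈ Finset.range N, pieceCovSq H f N ⌊(N : ℝ) * t⌋ k) atTop
      (𝓝 (∑' j : ℤ, (f t ^ 2 * fgnCov H j) ^ 2)) := by
  simp_rw [sum_pieceCovSq_eq_tsum]
  refine tendsto_tsum_of_dominated_convergence (bound := fun j => C ^ 4 * fgnCov H j ^ 2)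
    ((summable_fgnCov_sq h1 h2).mul_left _) ?_ ?_
  · intro j
    have hl : ∀ c : ℝ, 0 < c → Tendsto (fun N : ℕ => (N : ℝ) * c) atTop atTop := fun c hc =>
      tendsto_natCast_atTop_atTop.atTop_mul_const hc
    have hin : ∀ᶠ N : ℕ in atTop, 0 ≤ ⌊(N : ℝ) * t⌋ + j ∧ ⌊(N : ℝ) * t⌋ + j < N := by
      filter_upwards [(hl t ht0).eventually_ge_atTop (|(j : ℝ)| + 1),
        (hl (1 - t) (by linarith)).eventually_ge_atTop (|(j : ℝ)| + 1)] with N a b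
      have f1 := Int.floor_le ((N : ℝ) * t)
      have f2 := Int.lt_floor_add_one ((N : ℝ) * t)
      have c1 := neg_abs_le (j : ℝ)
      have c2 := le_abs_self (j : ℝ)
      constructor
      · have : (0 : ℝ) ≤ ((⌊(N : ℝ) * t⌋ + j : ℤ) : ℝ) := by push_cast; linarith
        exact_mod_cast this
      · have : ((⌊(N : ℝ) * t⌋ + j : ℤ) : ℝ) < (N : ℝ) := by push_cast; linarith
        exact_mod_cast this
    have hlim : Tendsto (fun N : ℕ => (N : ℝ) ^ (2 * H) * fracInner H
        ((cell N ⌊(N : ℝ) * t⌋).indicator f) ((cell N (⌊(N : ℝ) * t⌋ + j)).indicator f))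
        atTop (𝓝 (f t ^ 2 * fgnCov H j)) := by
      rw [tendsto_iff_norm_sub_tendsto_zero]
      have hz : Tendsto (fun N : ℕ => C * (2 * H) * ((N : ℝ) *
          (∫ u in cell N ⌊(N : ℝ) * t⌋, |f u - f t|) +
          (N : ℝ) * ∫ u in cell N (⌊(N : ℝ) * t⌋ + j), |f u - f t|)) atTop (𝓝 0) := by
        have h0 := ht 0
        simp only [add_zero] at h0
        simpa using (h0.add (ht j)).const_mul (C * (2 * H))
      refine squeeze_zero' (Eventually.of_forall fun _ => norm_nonneg _) ?_ hz
      filter_upwards [hin, eventually_gt_atTop 0] with N hN hN0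
      have hm : 0 ≤ ⌊(N : ℝ) * t⌋ := Int.floor_nonneg.2 (by positivity)
      have := abs_fracInner_pieces_sub_le h1 (by linarith) hf hC hN0 hm hN.1 (hC t)
      rw [add_sub_cancel_left] at this
      exact this
    refine (hlim.pow 2).congr' ?_
    filter_upwards [hin] with N hN
    rw [if_pos hN]
    rfl
  · filter_upwards [eventually_gt_atTop 0] with N hN j
    exact norm_ite_pieceCovSq_le h1 hC hN (Int.floor_nonneg.2 (by positivity)) j

/-- A Riemann sum as the integral of a function of `⌊N t⌋`. -/
lemma integral_comp_floor {N : ℕ} (hN : 0 < N) (G : ℤ → ℝ) :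
    ∫ t in (0 : ℝ)..1, G ⌊(N : ℝ) * t⌋ = 1 / N * ∑ k ∈ Finset.range N, G k := by
  have hN' : (0 : ℝ) < N := by exact_mod_cast hN
  have hcell : ∀ k : ℕ, Set.EqOn (fun t : ℝ => G ⌊(N : ℝ) * t⌋) (fun _ => G k)
      (Set.Ioo ((k : ℝ) / N) (((k + 1 : ℕ) : ℝ) / N)) := by
    intro k t ht
    have h1 := (div_lt_iff₀ hN').1 ht.1
    have h2 := (lt_div_iff₀ hN').1 ht.2
    have : ⌊(N : ℝ) * t⌋ = (k : ℤ) := by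
      rw [Int.floor_eq_iff]
      push_cast at h2 ⊢
      constructor <;> linarith
    simp only [this]
  have hle : ∀ k : ℕ, (k : ℝ) / N ≤ ((k + 1 : ℕ) : ℝ) / N := fun k => by
    gcongr; linarith
  have hint : ∀ k : ℕ, IntervalIntegrable (fun t : ℝ => G ⌊(N : ℝ) * t⌋) volume
      ((k : ℝ) / N) (((k + 1 : ℕ) : ℝ) / N) := by
    intro k
    rw [intervalIntegrable_iff_integrableOn_Ioo_of_le (hle k)]
    exact (integrableOn_const (by simp)).congr_fun (hcell k).symm measurableSet_Ioo
  have hval : ∀ k : ℕ, ∫ t in ((k : ℝ) / N)..(((k + 1 : ℕ) : ℝ) / N), G ⌊(N : ℝ) * t⌋ =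
      1 / N * G k := by
    intro k
    rw [intervalIntegral.integral_of_le (hle k), integral_Ioc_eq_integral_Ioo,
      setIntegral_congr_fun measurableSet_Ioo (hcell k), setIntegral_const,
      Real.volume_real_Ioo_of_le (hle k), smul_eq_mul]
    congr 1
    push_cast
    ring
  have := intervalIntegral.sum_integral_adjacent_intervals (a := fun k : ℕ => (k : ℝ) / N)
    (n := N) (f := fun t : ℝ => G ⌊(N : ℝ) * t⌋) (μ := volume) fun k _ => hint k
  rw [Nat.cast_zero, zero_div, div_self hN'.ne'] at this
  rw [← this, Finset.mul_sum]
  exact Finset.sum_congr rfl fun k _ => hval k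

lemma tendsto_average_pieceCovSq (h1 : 1 / 2 < H) (h2 : H < 3 / 4) (hf : BddSupp f)
    (hC : ∀ x, |f x| ≤ C) :
    Tendsto (fun N : ℕ => 1 / (N : ℝ) * ∑ k ∈ Finset.range N, ∑ k' ∈ Finset.range N,
      pieceCovSq H f N k k') atTop
      (𝓝 (∫ t in (0 : ℝ)..1, ∑' j : ℤ, (f t ^ 2 * fgnCov H j) ^ 2)) := by
  have hlim : Tendsto (fun N : ℕ => ∫ t in (0 : ℝ)..1,
      ∑ k ∈ Finset.range N, pieceCovSq H f N ⌊(N : ℝ) * t⌋ k) atTop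
      (𝓝 (∫ t in (0 : ℝ)..1, ∑' j : ℤ, (f t ^ 2 * fgnCov H j) ^ 2)) := by
    refine intervalIntegral.tendsto_integral_filter_of_dominated_convergence
      (fun _ => ∑' j : ℤ, C ^ 4 * fgnCov H j ^ 2) ?_ ?_ (by simp) ?_
    · refine Eventually.of_forall fun N => Measurable.aestronglyMeasurable ?_
      exact (measurable_from_top (f := fun m : ℤ =>
        ∑ k ∈ Finset.range N, pieceCovSq H f N m k)).comp
        (Int.measurable_floor.comp (measurable_const_mul _))
    · filter_upwards [eventually_gt_atTop 0] with N hN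
      refine ae_of_all _ fun t ht => ?_
      rw [Set.uIoc_of_le zero_le_one] at ht
      have hm : 0 ≤ ⌊(N : ℝ) * t⌋ := Int.floor_nonneg.2 (mul_nonneg (by positivity) ht.1.le)
      rw [sum_pieceCovSq_eq_tsum]
      exact tsum_of_norm_bounded ((summable_fgnCov_sq h1 h2).mul_left _).hasSum
        (norm_ite_pieceCovSq_le h1 hC hN hm)
    · have h1' : ∀ᵐ t : ℝ, t ≠ 1 := by
        filter_upwards [compl_mem_ae_iff.2 (measure_singleton (1 : ℝ))] with x hx using hx
      filter_upwards [ae_tendsto_integral_cell hf.integrable.locallyIntegrable, h1']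
        with t ht ht' hmem
      rw [Set.uIoc_of_le zero_le_one] at hmem
      exact tendsto_sum_pieceCovSq h1 h2 hf hC hmem.1 (lt_of_le_of_ne hmem.2 ht') ht
  refine hlim.congr' ?_
  filter_upwards [eventually_gt_atTop 0] with N hN
  exact integral_comp_floor hN (fun m => ∑ k ∈ Finset.range N, pieceCovSq H f N m k)

/-- `σ` restricted to `[0, 1]`. -/
noncomputable def unitPart (σ : ℝ → ℝ) : ℝ → ℝ := (Set.Icc 0 1).indicator σ

lemma volPiece_eq_indicator (σ : ℝ → ℝ) {N k : ℕ} (hk : k < N) :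
    volPiece σ N k = (cell N k).indicator (unitPart σ) := by
  have hN : (0 : ℝ) < N := by exact_mod_cast (Nat.zero_le k).trans_lt hk
  have hk' : (k : ℝ) + 1 ≤ N := by exact_mod_cast hk
  have hsub : cell N k ⊆ Set.Icc 0 1 := by
    refine Set.Icc_subset_Icc (by positivity) ?_
    rw [div_le_one hN]; exact_mod_cast hk
  unfold volPiece unitPart
  rw [Set.indicator_indicator, Set.inter_eq_left.2 hsub]
  rfl

lemma approxVariance_eq (h1 : 1 / 2 < H) (h2 : H < 1) {σ : ℝ → ℝ} (hf : BddSupp (unitPart σ))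
    {N : ℕ} (hN : 0 < N) :
    approxVariance H σ N = 2 * (1 / (N : ℝ) * ∑ k ∈ Finset.range N, ∑ k' ∈ Finset.range N,
      pieceCovSq H (unitPart σ) N k k') := by
  have hN' : (0 : ℝ) < N := by exact_mod_cast hN
  have e : (N : ℝ) ^ (4 * H - 1) = 1 / N * ((N : ℝ) ^ (2 * H)) ^ 2 := by
    rw [Real.rpow_sub_one hN'.ne', ← Real.rpow_natCast, ← Real.rpow_mul hN'.le]
    rw [show 2 * H * ((2 : ℕ) : ℝ) = 4 * H by push_cast; ring]; ring
  unfold approxVariance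
  rw [e]
  simp only [pieceCovSq, mul_pow, ← Finset.mul_sum]
  rw [mul_left_comm, mul_assoc (1 / (N : ℝ))]
  congr 3
  refine Finset.sum_congr rfl fun k hk => Finset.sum_congr rfl fun k' hk' => ?_
  rw [volPiece_eq_indicator σ (Finset.mem_range.1 hk),
    volPiece_eq_indicator σ (Finset.mem_range.1 hk'),
    integral_opM_mul h1 h2 (bddSupp_indicator hf (measurableSet_cell _ _))
      (bddSupp_indicator hf (measurableSet_cell _ _))]

lemma bddSupp_unitPart {σ : ℝ → ℝ}
    (hσ_meas : AEMeasurable σ (volume.restrict (Set.Icc (0 : ℝ) 1)))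
    (hC : ∀ t ∈ Set.Icc (0 : ℝ) 1, |σ t| ≤ C) : BddSupp (unitPart σ) := by
  have hC0 : 0 ≤ C := (abs_nonneg _).trans (hC 0 (by simp))
  refine ⟨(aemeasurable_indicator_iff measurableSet_Icc).2 hσ_meas, C, 1, hC0, zero_le_one,
    fun x => ?_⟩
  by_cases hx : x ∈ Set.Icc (0 : ℝ) 1
  · simpa [unitPart, hx] using hC x hx
  · simp [unitPart, hx]

lemma abs_unitPart_le {σ : ℝ → ℝ} (hC : ∀ t ∈ Set.Icc (0 : ℝ) 1, |σ t| ≤ C) (x : ℝ) :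
    |unitPart σ x| ≤ C := by
  have hC0 : 0 ≤ C := (abs_nonneg _).trans (hC 0 (by simp))
  by_cases hx : x ∈ Set.Icc (0 : ℝ) 1
  · simpa [unitPart, hx] using hC x hx
  · simpa [unitPart, hx] using hC0

/-- The asymptotic variance `2 ∑_j ρ(j)² ∫₀¹ σ⁴`. -/
lemma exists_tendsto_approxVariance (h1 : 1 / 2 < H) (h2 : H < 3 / 4) {σ : ℝ → ℝ}
    (hf : BddSupp (unitPart σ)) (hC : ∀ t ∈ Set.Icc (0 : ℝ) 1, |σ t| ≤ C) :
    ∃ v : ℝ≥0, Tendsto (approxVariance H σ) atTop (𝓝 (v : ℝ)) := by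
  have h := (tendsto_average_pieceCovSq h1 h2 hf (abs_unitPart_le hC)).const_mul 2
  have h' : Tendsto (approxVariance H σ) atTop
      (𝓝 (2 * ∫ t in (0 : ℝ)..1, ∑' j : ℤ, (unitPart σ t ^ 2 * fgnCov H j) ^ 2)) := by
    refine h.congr' ?_
    filter_upwards [eventually_gt_atTop 0] with N hN
    exact (approxVariance_eq h1 (by linarith) hf hN).symm
  refine ⟨⟨_, ?_⟩, h'⟩
  refine mul_nonneg zero_le_two (intervalIntegral.integral_nonneg zero_le_one fun t _ => ?_)
  exact tsum_nonneg fun j => sq_nonneg _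

end Limit

end

/-! ### Wiener integrals -/

section

section Step
variable {Ω : Type*} {B : ℝ → Ω → ℝ}

lemma StepFn.eval_add (φ ψ : StepFn) (s : ℝ) : StepFn.eval (φ + ψ) s = φ.eval s + ψ.eval s := by
  unfold StepFn.eval
  refine Finsupp.sum_add_index' (fun t => ?_) (fun t a b => ?_)
  · by_cases hs : s ∈ Set.Icc (0 : ℝ) t <;> simp [hs]
  · by_cases hs : s ∈ Set.Icc (0 : ℝ) t <;> simp [hs]

lemma StepFn.eval_smul (c : ℝ) (φ : StepFn) (s : ℝ) : StepFn.eval (c • φ) s = c * φ.eval s := by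
  unfold StepFn.eval
  rw [Finsupp.sum_smul_index' (fun t => ?_), Finsupp.mul_sum]
  · refine Finsupp.sum_congr fun t _ => ?_
    by_cases hs : s ∈ Set.Icc (0 : ℝ) t <;> simp [hs]
  · by_cases hs : s ∈ Set.Icc (0 : ℝ) t <;> simp [hs]

lemma StepFn.eval_single (t : ℝ≥0) (a : ℝ) (s : ℝ) :
    StepFn.eval (Finsupp.single t a) s = (Set.Icc (0 : ℝ) t).indicator (fun _ => a) s := by
  unfold StepFn.eval
  rw [Finsupp.sum_single_index]
  by_cases hs : s ∈ Set.Icc (0 : ℝ) t <;> simp [hs]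

lemma StepFn.eval_zero (s : ℝ) : StepFn.eval 0 s = 0 := by simp [StepFn.eval]

lemma StepFn.eval_sum {ι : Type*} (I : Finset ι) (φ : ι → StepFn) (s : ℝ) :
    StepFn.eval (∑ i ∈ I, φ i) s = ∑ i ∈ I, (φ i).eval s := by
  classical
  induction I using Finset.induction_on with
  | empty => simp [StepFn.eval_zero]
  | insert i I hi ih => rw [Finset.sum_insert hi, Finset.sum_insert hi, StepFn.eval_add, ih]

lemma StepFn.integral_add (φ ψ : StepFn) (ω : Ω) :
    StepFn.integral B (φ + ψ) ω = φ.integral B ω + ψ.integral B ω := by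
  unfold StepFn.integral
  exact Finsupp.sum_add_index' (fun t => by simp) (fun t a b => by ring)

lemma StepFn.integral_smul (c : ℝ) (φ : StepFn) (ω : Ω) :
    StepFn.integral B (c • φ) ω = c * φ.integral B ω := by
  unfold StepFn.integral
  rw [Finsupp.sum_smul_index' (fun t => by simp), Finsupp.mul_sum]
  exact Finsupp.sum_congr fun t _ => by simp [mul_assoc]

lemma StepFn.integral_single (t : ℝ≥0) (a : ℝ) (ω : Ω) :
    StepFn.integral B (Finsupp.single t a) ω = a * B t ω := by
  unfold StepFn.integral
  rw [Finsupp.sum_single_index (by simp)]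

end Step

section Wiener
variable {Ω : Type*} [MeasurableSpace Ω] {P : Measure Ω} {H : ℝ} {B : ℝ → Ω → ℝ}

lemma StepFn.measurable_integral (hB : IsFBM H B P) (φ : StepFn) : Measurable (φ.integral B) := by
  have : φ.integral B = fun ω => ∑ t ∈ φ.support, φ t * B t ω := by funext ω; rfl
  rw [this]
  exact Finset.measurable_sum _ fun t _ => (hB.measurable t t.2).const_mul _

lemma hasGaussianLaw_stepIntegral (hB : IsFBM H B P) (φ : StepFn) :
    HasGaussianLaw (φ.integral B) P := by
  have h := (hB.gaussian.hasGaussianLaw φ.support).map_fun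
    (∑ t : φ.support, (φ t) • ContinuousLinearMap.proj (R := ℝ) (φ := fun _ : φ.support => ℝ) t)
  refine h.congr (ae_of_all _ fun ω => ?_)
  simp only [sum_apply, smul_apply,
    ContinuousLinearMap.proj_apply, Finset.restrict, smul_eq_mul, StepFn.integral, Finsupp.sum]
  exact Finset.sum_coe_sort φ.support fun t => φ t * B t ω

lemma memLp_fbm (hB : IsFBM H B P) (t : ℝ≥0) : MemLp (B t) 2 P :=
  (hB.gaussian.hasGaussianLaw_eval t).memLp_two

lemma memLp_stepIntegral (hB : IsFBM H B P) (φ : StepFn) : MemLp (φ.integral B) 2 P :=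
  (hasGaussianLaw_stepIntegral hB φ).memLp_two

lemma integral_stepIntegral (hB : IsFBM H B P) [IsProbabilityMeasure P] (φ : StepFn) :
    ∫ ω, φ.integral B ω ∂P = 0 := by
  simp only [StepFn.integral, Finsupp.sum]
  rw [integral_finsetSum _ fun t _ =>
    ((memLp_fbm hB t).integrable (by norm_num)).const_mul _]
  refine Finset.sum_eq_zero fun t _ => ?_
  rw [integral_const_mul, hB.mean t t.2, mul_zero]

/-- The Itô isometry for step functions. -/
lemma integral_stepIntegral_mul (hB : IsFBM H B P) (h1 : 1 / 2 < H) (φ ψ : StepFn) :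
    ∫ ω, φ.integral B ω * ψ.integral B ω ∂P = fracInner H φ.eval ψ.eval := by
  have hm : ∀ s t : ℝ≥0, Integrable (fun ω => B s ω * B t ω) P := fun s t =>
    (memLp_fbm hB s).integrable_mul (memLp_fbm hB t)
  have e1 : ∀ ω, φ.integral B ω * ψ.integral B ω =
      ∑ s ∈ φ.support, ∑ t ∈ ψ.support, φ s * ψ t * (B s ω * B t ω) := by
    intro ω
    simp only [StepFn.integral, Finsupp.sum, Finset.sum_mul_sum]
    exact Finset.sum_congr rfl fun s _ => Finset.sum_congr rfl fun t _ => by ring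
  have ev : ∀ φ : StepFn, φ.eval = fun x => ∑ t ∈ φ.support,
      φ t * (Set.Icc (0 : ℝ) (t : ℝ)).indicator (fun _ => 1) x := by
    intro φ
    funext x
    simp only [StepFn.eval, Finsupp.sum]
    refine Finset.sum_congr rfl fun t _ => ?_
    by_cases hx : x ∈ Set.Icc (0 : ℝ) t <;> simp [hx]
  simp_rw [e1]
  rw [integral_finsetSum _ fun s _ => integrable_finsetSum _ fun t _ => (hm s t).const_mul _,
    ev φ, ev ψ, fracInner_sum_left h1 _ (fun t _ => (bddSupp_Icc le_rfl 1).const_mul _)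
      (BddSupp.sum _ fun t _ => (bddSupp_Icc le_rfl 1).const_mul _)]
  refine Finset.sum_congr rfl fun s _ => ?_
  rw [integral_finsetSum _ fun t _ => (hm s t).const_mul _, fracInner_const_mul_left,
    fracInner_sum_right h1 _ (fun t _ => (bddSupp_Icc le_rfl 1).const_mul _)
      (bddSupp_Icc le_rfl 1), Finset.mul_sum]
  refine Finset.sum_congr rfl fun t _ => ?_
  rw [integral_const_mul, hB.covariance s t s.2 t.2, fracInner_const_mul_right,
    fracInner_Icc_Icc h1 s.coe_nonneg t.coe_nonneg]
  ring

lemma map_stepIntegral (hB : IsFBM H B P) (h1 : 1 / 2 < H) [IsProbabilityMeasure P] (φ : StepFn) :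
    P.map (φ.integral B) = gaussianReal 0 (fracInner H φ.eval φ.eval).toNNReal := by
  rw [(hasGaussianLaw_stepIntegral hB φ).map_eq_gaussianReal, integral_stepIntegral hB,
    variance_of_integral_eq_zero (StepFn.measurable_integral hB φ).aemeasurable
      (integral_stepIntegral hB φ), ← integral_stepIntegral_mul hB h1]
  simp_rw [sq]

section Linear
variable {f g : ℝ → ℝ} {I J : Ω → ℝ}

/-- For bounded functions the integrability requirement in the definition of the Wiener integral
holds automatically. -/
lemma isWienerIntegral_iff (h1 : 1 / 2 < H) (h2 : H < 1) (hf : BddSupp f) :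
    IsWienerIntegral H B P f I ↔ MemLp I 2 P ∧ ∃ φ : ℕ → StepFn,
      Tendsto (fun n => eLpNorm (opM H (fun s => f s - (φ n).eval s)) 2 volume) atTop (𝓝 0) ∧
      Tendsto (fun n => eLpNorm (fun ω => I ω - (φ n).integral B ω) 2 P) atTop (𝓝 0) := by
  constructor
  · rintro ⟨h, φ, -, h3, h4⟩
    exact ⟨h, φ, h3, h4⟩
  · rintro ⟨h, φ, h3, h4⟩
    exact ⟨h, φ, fun n => memL2H_of_bddSupp h1 h2 (hf.sub (bddSupp_stepFn _)), h3, h4⟩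

lemma opM_add (h1 : 1 / 2 < H) (hf : BddSupp f) (hg : BddSupp g) :
    opM H (fun x => f x + g x) = opM H f + opM H g := by
  funext x
  simp only [opM, Pi.add_apply, add_div]
  rw [integral_add (hf.integrable_div h1 x) (hg.integrable_div h1 x), mul_add]

lemma opM_const_mul (c : ℝ) (f : ℝ → ℝ) : opM H (fun x => c * f x) = c • opM H f := by
  funext x
  simp only [opM, Pi.smul_apply, smul_eq_mul, mul_div_assoc]
  rw [integral_const_mul]
  ring

lemma IsWienerIntegral.add (hB : IsFBM H B P) (h1 : 1 / 2 < H) (h2 : H < 1) (hf : BddSupp f)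
    (hg : BddSupp g) (hI : IsWienerIntegral H B P f I) (hJ : IsWienerIntegral H B P g J) :
    IsWienerIntegral H B P (fun x => f x + g x) (fun ω => I ω + J ω) := by
  obtain ⟨mI, φ, -, h3, h4⟩ := hI
  obtain ⟨mJ, ψ, -, h5, h6⟩ := hJ
  rw [isWienerIntegral_iff h1 h2 (hf.add hg)]
  refine ⟨mI.add mJ, fun n => φ n + ψ n, ?_, ?_⟩
  · have := h3.add h5
    rw [add_zero] at this
    refine tendsto_of_tendsto_of_tendsto_of_le_of_le tendsto_const_nhds this
      (fun _ => zero_le) fun n => ?_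
    have b1 := hf.sub (bddSupp_stepFn (φ n))
    have b2 := hg.sub (bddSupp_stepFn (ψ n))
    have e : (fun s => f s + g s - StepFn.eval (φ n + ψ n) s) =
        fun s => (f s - (φ n).eval s) + (g s - (ψ n).eval s) := by
      funext s; rw [StepFn.eval_add]; ring
    simp only
    rw [e, opM_add h1 b1 b2]
    exact eLpNorm_add_le (memLp_opM h1 h2 b1).1 (memLp_opM h1 h2 b2).1 (by norm_num)
  · have := h4.add h6
    rw [add_zero] at this
    refine tendsto_of_tendsto_of_tendsto_of_le_of_le tendsto_const_nhds this
      (fun _ => zero_le) fun n => ?_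
    have e : (fun ω => I ω + J ω - StepFn.integral B (φ n + ψ n) ω) =
        (fun ω => I ω - (φ n).integral B ω) + (fun ω => J ω - (ψ n).integral B ω) := by
      funext ω; simp only [StepFn.integral_add, Pi.add_apply]; ring
    simp only
    rw [e]
    exact eLpNorm_add_le (mI.sub (memLp_stepIntegral hB _)).1 (mJ.sub (memLp_stepIntegral hB _)).1
      (by norm_num)

lemma IsWienerIntegral.const_mul (h1 : 1 / 2 < H) (h2 : H < 1) (hf : BddSupp f)
    (hI : IsWienerIntegral H B P f I) (c : ℝ) :
    IsWienerIntegral H B P (fun x => c * f x) (fun ω => c * I ω) := by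
  obtain ⟨mI, φ, -, h3, h4⟩ := hI
  rw [isWienerIntegral_iff h1 h2 (hf.const_mul c)]
  refine ⟨mI.const_mul c, fun n => c • φ n, ?_, ?_⟩
  · have := ENNReal.Tendsto.const_mul h3 (a := ‖c‖ₑ) (Or.inr (by simp))
    rw [mul_zero] at this
    refine this.congr fun n => ?_
    have e : (fun s => c * f s - StepFn.eval (c • φ n) s) =
        fun s => c * (f s - (φ n).eval s) := by
      funext s; rw [StepFn.eval_smul]; ring
    rw [e, opM_const_mul, eLpNorm_const_smul]
  · have := ENNReal.Tendsto.const_mul h4 (a := ‖c‖ₑ) (Or.inr (by simp))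
    rw [mul_zero] at this
    refine this.congr fun n => ?_
    have e : (fun ω => c * I ω - StepFn.integral B (c • φ n) ω) =
        c • (fun ω => I ω - (φ n).integral B ω) := by
      funext ω; simp only [StepFn.integral_smul, Pi.smul_apply, smul_eq_mul]; ring
    rw [e, eLpNorm_const_smul]

lemma isWienerIntegral_stepFn (hB : IsFBM H B P) (h1 : 1 / 2 < H) (h2 : H < 1) (φ : StepFn) :
    IsWienerIntegral H B P φ.eval (φ.integral B) := by
  rw [isWienerIntegral_iff h1 h2 (bddSupp_stepFn φ)]
  refine ⟨memLp_stepIntegral hB φ, fun _ => φ, ?_, ?_⟩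
  · have : opM H (fun _ => 0) = 0 := by funext x; simp [opM]
    simp [this]
  · simp

lemma IsWienerIntegral.sum (hB : IsFBM H B P) (h1 : 1 / 2 < H) (h2 : H < 1) {ι : Type*}
    (s : Finset ι) {f : ι → ℝ → ℝ} {I : ι → Ω → ℝ} (hf : ∀ i ∈ s, BddSupp (f i))
    (hI : ∀ i ∈ s, IsWienerIntegral H B P (f i) (I i)) :
    IsWienerIntegral H B P (fun x => ∑ i ∈ s, f i x) (fun ω => ∑ i ∈ s, I i ω) := by
  classical
  induction s using Finset.induction_on with
  | empty =>
    have := isWienerIntegral_stepFn hB h1 h2 0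
    convert this using 2 <;> simp [StepFn.eval, StepFn.integral]
  | insert i s hi ih =>
    simp only [Finset.sum_insert hi]
    exact (hI i (by simp)).add hB h1 h2 (hf i (by simp))
      (BddSupp.sum s fun j hj => hf j (by simp [hj]))
      (ih (fun j hj => hf j (by simp [hj])) fun j hj => hI j (by simp [hj]))

/-- Convergence in `L²` implies convergence of the `L²` norms; here for the variances of the
approximating step integrals. -/
lemma tendsto_fracInner_stepFn (h1 : 1 / 2 < H) (h2 : H < 1) (hf : BddSupp f)
    {φ : ℕ → StepFn}
    (h : Tendsto (fun n => eLpNorm (opM H (fun s => f s - (φ n).eval s)) 2 volume) atTop (𝓝 0)) :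
    Tendsto (fun n => fracInner H (φ n).eval (φ n).eval) atTop (𝓝 (fracInner H f f)) := by
  have hN : ∀ k : ℝ → ℝ, BddSupp k →
      √(fracInner H k k) = (eLpNorm (opM H k) 2 volume).toReal := fun k hk => by
    rw [eLpNorm_opM h1 h2 hk, ENNReal.toReal_ofReal (Real.sqrt_nonneg _)]
  have ht : ∀ k l : ℝ → ℝ, BddSupp k → BddSupp l →
      √(fracInner H k k) ≤ √(fracInner H l l) +
        (eLpNorm (opM H (fun s => k s - l s)) 2 volume).toReal := by
    intro k l hk hl
    rw [hN k hk, hN l hl, ← ENNReal.toReal_add (memLp_opM h1 h2 hl).2.ne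
      (memLp_opM h1 h2 (hk.sub hl)).2.ne]
    refine ENNReal.toReal_mono (ENNReal.add_ne_top.2 ⟨(memLp_opM h1 h2 hl).2.ne,
      (memLp_opM h1 h2 (hk.sub hl)).2.ne⟩) ?_
    have e : opM H k = opM H l + opM H (fun s => k s - l s) := by
      rw [← opM_add h1 hl (hk.sub hl)]
      congr 1; funext s; ring
    conv_lhs => rw [e]
    exact eLpNorm_add_le (memLp_opM h1 h2 hl).1 (memLp_opM h1 h2 (hk.sub hl)).1 (by norm_num)
  have hz : Tendsto (fun n => (eLpNorm (opM H (fun s => f s - (φ n).eval s)) 2 volume).toReal)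
      atTop (𝓝 0) := by
    simpa [Function.comp_def] using (ENNReal.tendsto_toReal ENNReal.zero_ne_top).comp h
  have hsq : Tendsto (fun n => √(fracInner H (φ n).eval (φ n).eval)) atTop
      (𝓝 √(fracInner H f f)) := by
    rw [tendsto_iff_norm_sub_tendsto_zero]
    refine squeeze_zero (fun _ => norm_nonneg _) (fun n => ?_) hz
    have b := bddSupp_stepFn (φ n)
    have t1 := ht f _ hf b
    have t2 := ht _ f b hf
    have e : (eLpNorm (opM H (fun s => (φ n).eval s - f s)) 2 volume) =
        eLpNorm (opM H (fun s => f s - (φ n).eval s)) 2 volume := by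
      have : (fun s => (φ n).eval s - f s) = fun s => (-1) * (f s - (φ n).eval s) := by
        funext s; ring
      rw [this, opM_const_mul, eLpNorm_const_smul]; simp
    rw [e] at t2
    rw [Real.norm_eq_abs, abs_le]
    constructor <;> linarith
  have := hsq.pow 2
  rw [Real.sq_sqrt (fracInner_self_nonneg h1 h2 hf)] at this
  exact this.congr fun n => Real.sq_sqrt (fracInner_self_nonneg h1 h2 (bddSupp_stepFn _))

/-- A Wiener integral is a centered Gaussian variable whose variance is the norm of the
integrand. -/
lemma IsWienerIntegral.map_eq (hB : IsFBM H B P) [IsProbabilityMeasure P] (h1 : 1 / 2 < H)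
    (h2 : H < 1) (hf : BddSupp f) (hI : IsWienerIntegral H B P f I) :
    P.map I = gaussianReal 0 (fracInner H f f).toNNReal := by
  obtain ⟨mI, φ, -, h3, h4⟩ := hI
  have hd : TendstoInDistribution (fun n => (φ n).integral B) atTop I (fun _ => P) P := by
    refine TendstoInMeasure.tendstoInDistribution_of_aemeasurable ?_
      (fun n => (StepFn.measurable_integral hB _).aemeasurable) mI.1.aemeasurable
    refine tendstoInMeasure_of_tendsto_eLpNorm (p := 2) (by norm_num)
      (fun n => (memLp_stepIntegral hB _).1) mI.1 ?_
    refine h4.congr fun n => ?_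
    rw [← eLpNorm_neg]
    congr 1
    funext ω; simp
  have hp := ProbabilityMeasure.tendsto_iff_tendsto_charFun.1 hd.tendsto
  have : IsProbabilityMeasure (P.map I) := Measure.isProbabilityMeasure_map mI.1.aemeasurable
  refine Measure.ext_of_charFun (funext fun t => ?_)
  refine tendsto_nhds_unique (hp t) ?_
  simp only [ProbabilityMeasure.coe_mk, map_stepIntegral hB h1, charFun_gaussianReal]
  have hc := tendsto_fracInner_stepFn h1 h2 hf h3
  have : Tendsto (fun n => ((fracInner H (φ n).eval (φ n).eval).toNNReal : ℝ)) atTop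
      (𝓝 ((fracInner H f f).toNNReal : ℝ)) :=
    (NNReal.continuous_coe.comp continuous_real_toNNReal).continuousAt.tendsto.comp hc
  have h5 : Tendsto (fun n => (((fracInner H (φ n).eval (φ n).eval).toNNReal : ℝ) : ℂ)) atTop
      (𝓝 (((fracInner H f f).toNNReal : ℝ) : ℂ)) :=
    (Complex.continuous_ofReal.tendsto _).comp this
  exact (Complex.continuous_exp.tendsto _).comp
    (tendsto_const_nhds.sub ((h5.mul tendsto_const_nhds).div_const 2))

end Linear
end Wiener

end

/-! ### Existence of Wiener integrals -/

section

lemma measurable_noise_stepIntegral {Ω : Type*} {B : ℝ → Ω → ℝ} (φ : StepFn) :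
    Measurable[noiseAlgebra B] (φ.integral B) := by
  have : φ.integral B = fun ω => ∑ t ∈ φ.support, φ t * B t ω := by funext ω; rfl
  rw [this]
  refine Finset.measurable_sum _ fun t _ => Measurable.const_mul ?_ _
  exact (comap_measurable (B (t : ℝ))).mono
    (le_iSup (fun t : ℝ≥0 => MeasurableSpace.comap (B (t : ℝ)) inferInstance) t) le_rfl

section Existence
variable {Ω : Type*} [MeasurableSpace Ω] {P : Measure Ω} {H : ℝ} {B : ℝ → Ω → ℝ} {f : ℝ → ℝ}

/-- The step function with the averages of `f` as its values on the cells of `[0, 1]`,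
each cell being a difference of two intervals that start at `0`. -/
noncomputable def averageStep (f : ℝ → ℝ) (n : ℕ) : StepFn :=
  ∑ k ∈ Finset.range n,
    (Finsupp.single ((((k : ℝ≥0) + 1) / n : ℝ≥0)) ((n : ℝ) * ∫ u in cell n k, f u) +
      Finsupp.single (((k : ℝ≥0) / n : ℝ≥0)) (-((n : ℝ) * ∫ u in cell n k, f u)))

lemma averageStep_eval_of_notMem (n : ℕ) {t : ℝ} (ht : t ∉ Set.Icc (0 : ℝ) 1) :
    (averageStep f n).eval t = 0 := by
  unfold averageStep
  rw [StepFn.eval_sum]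
  refine Finset.sum_eq_zero fun k hk => ?_
  have hk := Finset.mem_range.1 hk
  have hn : (0 : ℝ) < n := by exact_mod_cast (Nat.zero_le k).trans_lt hk
  have hk1 : (k : ℝ) + 1 ≤ n := by exact_mod_cast hk
  rw [StepFn.eval_add, StepFn.eval_single, StepFn.eval_single, Set.indicator_of_notMem,
    Set.indicator_of_notMem, add_zero]
  · push_cast
    exact fun h => ht ⟨h.1, h.2.trans (by rw [div_le_one hn]; linarith)⟩
  · push_cast
    exact fun h => ht ⟨h.1, h.2.trans (by rw [div_le_one hn]; linarith)⟩

lemma averageStep_eval {n : ℕ} (hn : 0 < n) {t : ℝ} (ht0 : 0 < t) (ht1 : t < 1)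
    (ht : Irrational t) :
    (averageStep f n).eval t = (n : ℝ) * ∫ u in cell n ⌊(n : ℝ) * t⌋, f u := by
  have hn' : (0 : ℝ) < n := by exact_mod_cast hn
  have h0 : 0 ≤ ⌊(n : ℝ) * t⌋ := Int.floor_nonneg.2 (by positivity)
  obtain ⟨m, hm⟩ := Int.eq_ofNat_of_zero_le h0
  have f1 := Int.floor_le ((n : ℝ) * t)
  have f2 := Int.lt_floor_add_one ((n : ℝ) * t)
  rw [hm] at f1 f2 ⊢
  push_cast at f1 f2
  have hne : ∀ k : ℕ, t ≠ (k : ℝ) / n := fun k h => by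
    refine ht ⟨(k : ℚ) / n, ?_⟩
    rw [h]; push_cast; rfl
  have hmn : m < n := by
    have : (m : ℝ) < n := lt_of_le_of_lt f1 (by nlinarith)
    exact_mod_cast this
  unfold averageStep
  rw [StepFn.eval_sum, Finset.sum_eq_single_of_mem m (Finset.mem_range.2 hmn)]
  · have b1 : t ∈ Set.Icc (0 : ℝ) (((m : ℝ) + 1) / n) := ⟨ht0.le, by
      rw [le_div_iff₀ hn']; linarith⟩
    have b2 : t ∉ Set.Icc (0 : ℝ) ((m : ℝ) / n) := fun h => by
      have : t < (m : ℝ) / n := lt_of_le_of_ne h.2 (hne m)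
      rw [lt_div_iff₀ hn'] at this
      linarith
    rw [StepFn.eval_add, StepFn.eval_single, StepFn.eval_single]
    push_cast
    rw [Set.indicator_of_mem b1, Set.indicator_of_notMem b2, add_zero]
  · intro k _ hkm
    rw [StepFn.eval_add, StepFn.eval_single, StepFn.eval_single]
    push_cast
    rcases lt_or_gt_of_ne hkm with h | h
    · have h' : (k : ℝ) + 1 ≤ m := by exact_mod_cast h
      have b1 : t ∉ Set.Icc (0 : ℝ) (((k : ℝ) + 1) / n) := fun hh => by
        have : t < ((k + 1 : ℕ) : ℝ) / n := lt_of_le_of_ne (by push_cast; exact hh.2) (hne (k + 1))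
        rw [lt_div_iff₀ hn'] at this
        push_cast at this
        linarith
      have b2 : t ∉ Set.Icc (0 : ℝ) ((k : ℝ) / n) := fun hh => by
        have := hh.2
        rw [le_div_iff₀ hn'] at this
        linarith
      rw [Set.indicator_of_notMem b1, Set.indicator_of_notMem b2, add_zero]
    · have h' : (m : ℝ) + 1 ≤ k := by exact_mod_cast h
      have b1 : t ∈ Set.Icc (0 : ℝ) (((k : ℝ) + 1) / n) := ⟨ht0.le, by
        rw [le_div_iff₀ hn']; linarith⟩
      have b2 : t ∈ Set.Icc (0 : ℝ) ((k : ℝ) / n) := ⟨ht0.le, by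
        rw [le_div_iff₀ hn']; linarith⟩
      rw [Set.indicator_of_mem b1, Set.indicator_of_mem b2, add_neg_cancel]

lemma abs_average_sub_le (hf : BddSupp f) {n : ℕ} (hn : 0 < n) (m : ℤ) (s : ℝ) :
    |(n : ℝ) * (∫ u in cell n m, f u) - s| ≤ n * ∫ u in cell n m, |f u - s| := by
  have hn' : (0 : ℝ) < n := by exact_mod_cast hn
  have hv : volume.real (cell n m) = 1 / n := by
    rw [cell, Real.volume_real_Icc_of_le (by gcongr; linarith), cell_length]
  have hfin : volume (cell n m) ≠ ⊤ := by simp [cell]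
  have e : (n : ℝ) * (∫ u in cell n m, f u) - s = n * ∫ u in cell n m, (f u - s) := by
    rw [integral_sub hf.integrable.integrableOn (integrableOn_const hfin), setIntegral_const, hv,
      smul_eq_mul]
    field_simp
  rw [e, abs_mul, abs_of_pos hn']
  exact mul_le_mul_of_nonneg_left (abs_integral_le_integral_abs) hn'.le

lemma tendsto_integral_averageStep (hf : BddSupp f)
    (hf1 : ∀ x, x ∉ Set.Icc (0 : ℝ) 1 → f x = 0) :
    Tendsto (fun n => ∫ t, (f t - (averageStep f n).eval t) ^ 2) atTop (𝓝 0) := by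
  obtain ⟨C, T, hC, hT, hb⟩ := hf.bound
  have hfC : ∀ x, |f x| ≤ C := fun x => (hb x).trans (Set.indicator_le_self' (fun _ _ => hC) x)
  have hae : ∀ᵐ t : ℝ, t ≠ 0 ∧ t ≠ 1 ∧ Irrational t := by
    have hirr : ∀ᵐ t : ℝ, Irrational t := by
      rw [ae_iff]
      refine (Set.Countable.mono ?_ (Set.countable_range ((↑) : ℚ → ℝ))).measure_zero _
      intro x hx
      exact by_contra fun h => hx h
    filter_upwards [hirr] with t ht
    exact ⟨ht.ne_zero, ht.ne_one, ht⟩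
  have h0 : (0 : ℝ) = ∫ t : ℝ, (0 : ℝ) := by simp
  rw [h0]
  refine tendsto_integral_of_dominated_convergence
    ((Set.Icc (0 : ℝ) 1).indicator fun _ => (2 * C) ^ 2) ?_ ?_ ?_ ?_
  · exact fun n => ((hf.sub (bddSupp_stepFn _)).aemeasurable.pow_const 2).aestronglyMeasurable
  · exact (integrable_indicator_iff measurableSet_Icc).2 (integrableOn_const (by simp))
  · intro n
    filter_upwards [hae] with t ⟨ht0, ht1, hirr⟩
    by_cases ht : t ∈ Set.Icc (0 : ℝ) 1
    · rw [Set.indicator_of_mem ht, norm_pow, Real.norm_eq_abs]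
      refine pow_le_pow_left₀ (abs_nonneg _) ?_ 2
      have key : |(averageStep f n).eval t| ≤ C := by
        rcases Nat.eq_zero_or_pos n with rfl | hn
        · simpa [averageStep, StepFn.eval_zero] using hC
        · rw [averageStep_eval hn (lt_of_le_of_ne ht.1 ht0.symm) (lt_of_le_of_ne ht.2 ht1) hirr]
          have hn' : (0 : ℝ) < n := by exact_mod_cast hn
          have hv : volume.real (cell n ⌊(n : ℝ) * t⌋) = 1 / n := by
            rw [cell, Real.volume_real_Icc_of_le (by gcongr; linarith), cell_length]
          have := norm_setIntegral_le_of_norm_le_const (μ := volume) (f := f)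
            (s := cell n ⌊(n : ℝ) * t⌋) (C := C) (by simp [cell]) (fun x _ => hfC x)
          rw [hv, Real.norm_eq_abs] at this
          rw [abs_mul, abs_of_pos hn']
          calc _ ≤ (n : ℝ) * (C * (1 / n)) := mul_le_mul_of_nonneg_left this hn'.le
            _ = C := by field_simp
      calc _ ≤ |f t| + |(averageStep f n).eval t| := abs_sub _ _
        _ ≤ 2 * C := by linarith [hfC t]
    · simp [ht, hf1 t ht, averageStep_eval_of_notMem n ht]
  · filter_upwards [hae, ae_tendsto_integral_cell hf.integrable.locallyIntegrable] with t
      ⟨ht0, ht1, hirr⟩ hlim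
    by_cases ht : t ∈ Set.Icc (0 : ℝ) 1
    · have h1 : Tendsto (fun n => f t - (averageStep f n).eval t) atTop (𝓝 0) := by
        rw [tendsto_zero_iff_norm_tendsto_zero]
        have hl := hlim 0
        simp only [add_zero] at hl
        refine squeeze_zero' (Eventually.of_forall fun _ => norm_nonneg _) ?_ hl
        filter_upwards [eventually_gt_atTop 0] with n hn
        rw [averageStep_eval hn (lt_of_le_of_ne ht.1 ht0.symm) (lt_of_le_of_ne ht.2 ht1) hirr,
          Real.norm_eq_abs, abs_sub_comm]
        exact abs_average_sub_le hf hn _ _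
      simpa using h1.pow 2
    · simp [hf1 t ht, averageStep_eval_of_notMem _ ht]

lemma tendsto_eLpNorm_opM_averageStep (h1 : 1 / 2 < H) (h2 : H < 1) (hf : BddSupp f)
    (hf1 : ∀ x, x ∉ Set.Icc (0 : ℝ) 1 → f x = 0) :
    Tendsto (fun n => eLpNorm (opM H (fun s => f s - (averageStep f n).eval s)) 2 volume)
      atTop (𝓝 0) := by
  have hb : ∀ n, BddSupp (fun s => f s - (averageStep f n).eval s) := fun n =>
    hf.sub (bddSupp_stepFn _)
  have hz : Tendsto (fun n => √(fracInner H (fun s => f s - (averageStep f n).eval s)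
      (fun s => f s - (averageStep f n).eval s))) atTop (𝓝 0) := by
    have hl := (tendsto_integral_averageStep hf hf1).const_mul (2 * H * 1 ^ (2 * H - 1))
    rw [mul_zero] at hl
    have := squeeze_zero (fun n => fracInner_self_nonneg h1 h2 (hb n)) (fun n =>
      fracInner_self_le h1 h2 (hb n) zero_le_one fun x hx => by
        rw [hf1 x hx, averageStep_eval_of_notMem n hx, sub_zero]) hl
    simpa [Function.comp_def] using (Real.continuous_sqrt.tendsto 0).comp this
  have := ENNReal.tendsto_ofReal hz
  rw [ENNReal.ofReal_zero] at this
  exact this.congr fun n => (eLpNorm_opM h1 h2 (hb n)).symm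

lemma eLpNorm_stepIntegral_sub (hB : IsFBM H B P) (h1 : 1 / 2 < H) (h2 : H < 1) (φ ψ : StepFn) :
    eLpNorm (φ.integral B - ψ.integral B) 2 P = eLpNorm (opM H φ.eval - opM H ψ.eval) 2 volume := by
  have e1 : φ.integral B - ψ.integral B = StepFn.integral B (φ + (-1 : ℝ) • ψ) := by
    funext ω; simp only [Pi.sub_apply, StepFn.integral_add, StepFn.integral_smul]; ring
  have e2 : opM H φ.eval - opM H ψ.eval = opM H (StepFn.eval (φ + (-1 : ℝ) • ψ)) := by
    have : StepFn.eval (φ + (-1 : ℝ) • ψ) = fun x => φ.eval x + (-1) * ψ.eval x := by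
      funext x; rw [StepFn.eval_add, StepFn.eval_smul]
    rw [this, opM_add h1 (bddSupp_stepFn φ) ((bddSupp_stepFn ψ).const_mul _), opM_const_mul]
    funext x; simp [sub_eq_add_neg]
  rw [e1, e2, eLpNorm_opM h1 h2 (bddSupp_stepFn _), eLpNorm_two_eq (memLp_stepIntegral hB _),
    ← integral_stepIntegral_mul hB h1]
  simp_rw [sq]

/-- The step functions of cell averages converge to `f` in `L²_H`; by the isometry their integrals
form a Cauchy sequence in `L²(P)`. -/
lemma exists_isWienerIntegral (hB : IsFBM H B P) (h1 : 1 / 2 < H) (h2 : H < 1) (hf : BddSupp f)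
    (hf1 : ∀ x, x ∉ Set.Icc (0 : ℝ) 1 → f x = 0) : ∃ I, IsWienerIntegral H B P f I := by
  have hM := tendsto_eLpNorm_opM_averageStep h1 h2 hf hf1
  set φ : ℕ → StepFn := averageStep f with hφ
  have hb : ∀ n, BddSupp (φ n).eval := fun n => bddSupp_stepFn _
  set u : ℕ → Lp ℝ 2 (volume : Measure ℝ) := fun n => (memLp_opM h1 h2 (hb n)).toLp with hu
  set w : ℕ → Lp ℝ 2 P := fun n => (memLp_stepIntegral hB (φ n)).toLp with hw
  have hlim : Tendsto u atTop (𝓝 (memLp_opM h1 h2 hf).toLp) := by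
    rw [Lp.tendsto_Lp_iff_tendsto_eLpNorm'']
    refine hM.congr fun n => ?_
    rw [← eLpNorm_neg]
    congr 1
    have : (fun s => f s - (φ n).eval s) = fun s => f s + (-1) * (φ n).eval s := by
      funext s; ring
    rw [this, opM_add h1 hf ((hb n).const_mul _), opM_const_mul]
    funext x; simp [sub_eq_add_neg]
  have hdist : ∀ m n, dist (w m) (w n) = dist (u m) (u n) := by
    intro m n
    rw [dist_edist, dist_edist, Lp.edist_toLp_toLp, Lp.edist_toLp_toLp,
      eLpNorm_stepIntegral_sub hB h1 h2]
  have hcau : CauchySeq w := by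
    have := hlim.cauchySeq
    rw [Metric.cauchySeq_iff] at this ⊢
    simpa only [hdist] using this
  obtain ⟨I, hI⟩ := cauchySeq_tendsto_of_complete hcau
  refine ⟨I, (isWienerIntegral_iff h1 h2 hf).2 ⟨Lp.memLp I, φ, hM, ?_⟩⟩
  rw [Lp.tendsto_Lp_iff_tendsto_eLpNorm'] at hI
  refine hI.congr fun n => ?_
  rw [← eLpNorm_neg]
  refine eLpNorm_congr_ae ?_
  filter_upwards [(memLp_stepIntegral hB (φ n)).coeFn_toLp] with ω hω
  simp [hw, hω]

lemma wienerIntegral_spec (hB : IsFBM H B P) (h1 : 1 / 2 < H) (h2 : H < 1) (hf : BddSupp f)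
    (hf1 : ∀ x, x ∉ Set.Icc (0 : ℝ) 1 → f x = 0) :
    IsWienerIntegral H B P f (wienerIntegral H B P f) := by
  have h := exists_isWienerIntegral hB h1 h2 hf hf1
  rw [wienerIntegral, dif_pos h]
  exact h.choose_spec

lemma noiseAlgebra_le (hB : IsFBM H B P) : noiseAlgebra B ≤ (inferInstance : MeasurableSpace Ω) :=
  iSup_le fun t => (hB.measurable t t.coe_nonneg).comap_le

lemma IsWienerIntegral.aemeasurable {I : Ω → ℝ} (hI : IsWienerIntegral H B P f I) :
    AEMeasurable I P :=
  hI.1.1.aemeasurable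

/-- Wiener integrals are functionals of the noise. -/
lemma IsWienerIntegral.memL2Noise (hB : IsFBM H B P) {I : Ω → ℝ}
    (hI : IsWienerIntegral H B P f I) : MemL2Noise B P I := by
  obtain ⟨mI, φ, -, -, h4⟩ := hI
  refine ⟨mI, ?_⟩
  have hcl := isClosed_aestronglyMeasurable (F := ℝ) (p := 2) (μ := P) (noiseAlgebra_le hB)
  have hlim : Tendsto (fun n => (memLp_stepIntegral hB (φ n)).toLp) atTop (𝓝 mI.toLp) := by
    rw [Lp.tendsto_Lp_iff_tendsto_eLpNorm'']
    refine h4.congr fun n => ?_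
    rw [← eLpNorm_neg]
    congr 1
    funext ω; simp
  have := hcl.mem_of_tendsto hlim (Eventually.of_forall fun n => by
    refine AEStronglyMeasurable.congr ?_ (memLp_stepIntegral hB (φ n)).coeFn_toLp.symm
    exact (measurable_noise_stepIntegral (φ n)).stronglyMeasurable.aestronglyMeasurable)
  exact AEStronglyMeasurable.congr this mI.coeFn_toLp

end Existence

/-! ### Gaussian families of Wiener integrals -/

section Joint
variable {Ω : Type*} [MeasurableSpace Ω] {P : Measure Ω} [IsProbabilityMeasure P] {H : ℝ}
  {B : ℝ → Ω → ℝ} {f g : ℝ → ℝ} {I J : Ω → ℝ}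

lemma IsWienerIntegral.hasGaussianLaw (hB : IsFBM H B P) (h1 : 1 / 2 < H) (h2 : H < 1)
    (hf : BddSupp f) (hI : IsWienerIntegral H B P f I) : HasGaussianLaw I P :=
  ⟨by rw [hI.map_eq hB h1 h2 hf]; infer_instance⟩

lemma IsWienerIntegral.integral_eq_zero (hB : IsFBM H B P) (h1 : 1 / 2 < H) (h2 : H < 1)
    (hf : BddSupp f) (hI : IsWienerIntegral H B P f I) : ∫ ω, I ω ∂P = 0 := by
  have := integral_map (μ := P) hI.aemeasurable (f := fun x : ℝ => x) (by fun_prop)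
  rw [← this, hI.map_eq hB h1 h2 hf, integral_id_gaussianReal]

lemma IsWienerIntegral.integral_sq (hB : IsFBM H B P) (h1 : 1 / 2 < H) (h2 : H < 1)
    (hf : BddSupp f) (hI : IsWienerIntegral H B P f I) :
    ∫ ω, I ω ^ 2 ∂P = fracInner H f f := by
  have h := variance_fun_id_gaussianReal (μ := 0) (v := (fracInner H f f).toNNReal)
  rw [← hI.map_eq hB h1 h2 hf, variance_map (by fun_prop) hI.aemeasurable,
    variance_of_integral_eq_zero (by simpa [Function.comp_def] using hI.aemeasurable)
      (by simpa [Function.comp_def] using hI.integral_eq_zero hB h1 h2 hf),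
    Real.coe_toNNReal _ (fracInner_self_nonneg h1 h2 hf)] at h
  simpa [Function.comp_def] using h

/-- The Itô isometry, polarized. -/
lemma IsWienerIntegral.integral_mul (hB : IsFBM H B P) (h1 : 1 / 2 < H) (h2 : H < 1)
    (hf : BddSupp f) (hg : BddSupp g) (hI : IsWienerIntegral H B P f I)
    (hJ : IsWienerIntegral H B P g J) : ∫ ω, I ω * J ω ∂P = fracInner H f g := by
  have h := (hI.add hB h1 h2 hf hg hJ).integral_sq hB h1 h2 (hf.add hg)
  rw [fracInner_add_left h1 hf hg (hf.add hg), fracInner_add_right h1 hf hg hf,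
    fracInner_add_right h1 hf hg hg, fracInner_comm g f, ← hI.integral_sq hB h1 h2 hf,
    ← hJ.integral_sq hB h1 h2 hg] at h
  have i1 := hI.1.integrable_sq
  have i2 := hJ.1.integrable_sq
  have i3 : Integrable (fun ω => I ω * J ω) P := hI.1.integrable_mul hJ.1
  have e : ∫ ω, (I ω + J ω) ^ 2 ∂P = ∫ ω, I ω ^ 2 ∂P + 2 * ∫ ω, I ω * J ω ∂P + ∫ ω, J ω ^ 2 ∂P := by
    have i4 : Integrable (fun ω => I ω ^ 2 + 2 * (I ω * J ω)) P := i1.add (i3.const_mul 2)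
    rw [← integral_const_mul, ← integral_add i1 (i3.const_mul 2), ← integral_add i4 i2]
    congr 1; funext ω; ring
  rw [e] at h
  linarith

lemma hasGaussianLaw_wienerIntegral_pi (hB : IsFBM H B P) (h1 : 1 / 2 < H) (h2 : H < 1)
    {ι : Type*} [Fintype ι] {f : ι → ℝ → ℝ} {I : ι → Ω → ℝ} (hf : ∀ i, BddSupp (f i))
    (hI : ∀ i, IsWienerIntegral H B P (f i) (I i)) :
    HasGaussianLaw (fun ω i => I i ω) P := by
  classical
  have hm : AEMeasurable (fun ω i => I i ω) P :=
    aemeasurable_pi_lambda _ fun i => (hI i).aemeasurable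
  refine ⟨isGaussian_of_isGaussian_map fun L => ?_⟩
  rw [AEMeasurable.map_map_of_aemeasurable (by fun_prop) hm]
  have e : (L ∘ fun ω i => I i ω) = fun ω => ∑ i, L (Pi.single i 1) * I i ω := by
    funext ω
    simp only [Function.comp_apply]
    conv_lhs => rw [← Finset.univ_sum_single (fun i => I i ω), map_sum]
    refine Finset.sum_congr rfl fun i _ => ?_
    have : (Pi.single i (I i ω) : ι → ℝ) = I i ω • Pi.single i 1 := by
      rw [← Pi.single_smul]; simp
    rw [this, map_smul, smul_eq_mul, mul_comm]
  rw [e]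
  have hW := IsWienerIntegral.sum hB h1 h2 Finset.univ
    (fun i _ => (hf i).const_mul (L (Pi.single i 1)))
    (fun i _ => (hI i).const_mul h1 h2 (hf i) (L (Pi.single i 1)))
  exact (hW.hasGaussianLaw hB h1 h2
    (BddSupp.sum _ fun i _ => (hf i).const_mul _)).isGaussian_map

end Joint

end

/-! ### Fourth moment of the normal law -/

section

/-- The moments come from differentiating `E[exp(tZ)] = exp(t²/2)` four times at `0`. -/
lemma integral_pow_gaussianReal_two_four :
    ∫ z, z ^ 2 ∂gaussianReal 0 1 = 1 ∧ ∫ z, z ^ 4 ∂gaussianReal 0 1 = 3 := by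
  have hd (n : ℕ) (t : ℝ) := hasDerivAt_integral_pow_mul_exp_real (X := fun z : ℝ => z)
    (μ := gaussianReal 0 1) (t := t) (by simp) n
  have hE (t : ℝ) : HasDerivAt (fun t : ℝ => Real.exp (t ^ 2 / 2))
      (t * Real.exp (t ^ 2 / 2)) t := by
    have := ((hasDerivAt_pow 2 t).div_const 2).exp
    convert! this using 1
    ring
  have step (n : ℕ) (p p' : ℝ → ℝ) (hp : ∀ t, HasDerivAt p (p' t) t)
      (h : ∀ t : ℝ, ∫ z, z ^ n * Real.exp (t * z) ∂gaussianReal 0 1 = p t * Real.exp (t ^ 2 / 2))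
      (t : ℝ) : ∫ z, z ^ (n + 1) * Real.exp (t * z) ∂gaussianReal 0 1
        = (p' t + t * p t) * Real.exp (t ^ 2 / 2) := by
    have h1 := hd n t
    have h2 : (fun t : ℝ => ∫ z, z ^ n * Real.exp (t * z) ∂gaussianReal 0 1)
      = fun t => p t * Real.exp (t ^ 2 / 2) := funext h
    rw [h2] at h1
    rw [h1.unique ((hp t).mul (hE t))]
    ring
  have m0 (t : ℝ) : ∫ z, z ^ 0 * Real.exp (t * z) ∂gaussianReal 0 1
      = (fun _ => 1) t * Real.exp (t ^ 2 / 2) := by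
    have := congrFun (mgf_fun_id_gaussianReal (μ := 0) (v := 1)) t
    simpa [mgf] using this
  have m1 := step 0 (fun _ => 1) (fun _ => 0) (fun t => hasDerivAt_const t 1) m0
  have m2 := step 1 (fun t => 0 + t * 1) (fun _ => 1)
    (fun t => by simpa using hasDerivAt_id' t) m1
  have m3 := step 2 (fun t => 1 + t * (0 + t * 1)) (fun t => 2 * t)
    (fun t => by
      have := (hasDerivAt_pow 2 t).const_add 1
      convert! this using 1 <;> [(ext; ring); (simp)]) m2
  have m4 := step 3 (fun t => 2 * t + t * (1 + t * (0 + t * 1))) (fun t => 3 + 3 * t ^ 2)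
    (fun t => by
      have := ((hasDerivAt_id t).const_mul 3).add (hasDerivAt_pow 3 t)
      convert! this using 1 <;> [(ext; simp; ring); (simp)]) m3
  exact ⟨by simpa using m2 0, by simpa using m4 0⟩

/-- The law of `(Z² - 1) / √2` for a standard normal `Z`: the square of a standard normal variable,
centred and normalized to variance `1`. -/
noncomputable def chiSqLaw : Measure ℝ := (gaussianReal 0 1).map fun z => (z ^ 2 - 1) / √2

instance : IsProbabilityMeasure chiSqLaw :=
  Measure.isProbabilityMeasure_map (by fun_prop)

lemma integrable_pow_gaussianReal (n : ℕ) : Integrable (fun z : ℝ => z ^ n) (gaussianReal 0 1) := by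
  have := (memLp_id_gaussianReal (μ := 0) (v := 1) (n : ℝ≥0)).integrable_norm_pow'
  refine this.mono (by fun_prop) (ae_of_all _ fun z => by simp)

lemma taylor_charFun_chiSqLaw :
    (fun t : ℝ => charFun chiSqLaw t - (1 - t ^ 2 / 2)) =o[𝓝 0] fun t : ℝ => t ^ 2 := by
  obtain ⟨h2, h4⟩ := integral_pow_gaussianReal_two_four
  refine taylor_charFun_two (by fun_prop) ?_ ?_
  · rw [integral_div, integral_sub (integrable_pow_gaussianReal 2) (integrable_const 1), h2]
    simp
  · have : ((fun z : ℝ => (z ^ 2 - 1) / √2) ^ 2) = fun z => (z ^ 4 - 2 * z ^ 2 + 1) / 2 := by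
      ext z
      simp only [Pi.pow_apply, div_pow, Real.sq_sqrt (zero_le_two)]
      ring
    rw [this, integral_div, integral_add, integral_sub, integral_const_mul, h2, h4]
    · norm_num
    · exact integrable_pow_gaussianReal 4
    · exact (integrable_pow_gaussianReal 2).const_mul 2
    · exact (integrable_pow_gaussianReal 4).sub ((integrable_pow_gaussianReal 2).const_mul 2)
    · exact integrable_const 1

/-! ### Quadratic forms in Gaussian vectors -/

variable {Ω : Type*} [MeasurableSpace Ω] {P : Measure Ω}

lemma charFun_sq_sub {ζ : Ω → ℝ} {d : ℝ} (hd : 0 ≤ d)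
    (hζ : P.map ζ = gaussianReal 0 d.toNNReal) (a t : ℝ) :
    charFun (P.map fun ω => a * (ζ ω ^ 2 - d)) t = charFun chiSqLaw (√2 * a * d * t) := by
  have hm : AEMeasurable ζ P := by
    apply AEMeasurable.of_map_ne_zero
    rw [hζ]
    exact IsProbabilityMeasure.ne_zero _
  have h1 : gaussianReal 0 d.toNNReal = (gaussianReal 0 1).map (√d * ·) := by
    rw [gaussianReal_map_const_mul]
    congr 1
    · simp
    · ext
      simp [Real.sq_sqrt hd, hd]
  have h2 : P.map (fun ω => a * (ζ ω ^ 2 - d)) = (P.map ζ).map fun x => a * (x ^ 2 - d) := by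
    rw [AEMeasurable.map_map_of_aemeasurable (by fun_prop) hm]
    rfl
  rw [h2, hζ, h1, Measure.map_map (by fun_prop) (by fun_prop)]
  have h3 : ((fun x => a * (x ^ 2 - d)) ∘ fun x => √d * x)
      = fun z => (√2 * a * d) * ((z ^ 2 - 1) / √2) := by
    ext z
    have : √(2 : ℝ) ≠ 0 := by positivity
    simp only [Function.comp, mul_pow, Real.sq_sqrt hd]
    field_simp
  rw [h3, charFun_map_mul_comp (by fun_prop)]
  rfl

variable [IsProbabilityMeasure P]

/-- A centred Gaussian vector `ξ` is, after an orthogonal change of coordinates, a vector `ζ` of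
independent normal variables; their variances `d` are the eigenvalues of the covariance matrix of
`ξ`, so that they are controlled by the row sums of this matrix, by Gershgorin's theorem. -/
lemma exists_diagonalization {ι : Type*} [Fintype ι] {ξ : ι → Ω → ℝ}
    (hξ : HasGaussianLaw (fun ω i => ξ i ω) P) (h0 : ∀ i, ∫ ω, ξ i ω ∂P = 0) :
    ∃ (d : ι → ℝ) (ζ : ι → Ω → ℝ), (∀ i, 0 ≤ d i) ∧ iIndepFun ζ P ∧
      (∀ i, P.map (ζ i) = gaussianReal 0 (d i).toNNReal) ∧
      (∀ ω, ∑ i, ζ i ω ^ 2 = ∑ i, ξ i ω ^ 2) ∧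
      ∑ i, d i = ∑ i, ∫ ω, ξ i ω ^ 2 ∂P ∧
      ∑ i, d i ^ 2 = ∑ i, ∑ j, (∫ ω, ξ i ω * ξ j ω ∂P) ^ 2 ∧
      ∀ i, ∃ k, d i ≤ ∑ j, |∫ ω, ξ k ω * ξ j ω ∂P| := by
  classical
  set A : Matrix ι ι ℝ := Matrix.of fun i j => ∫ ω, ξ i ω * ξ j ω ∂P with hAdef
  have hAij (i j : ι) : A i j = ∫ ω, ξ i ω * ξ j ω ∂P := rfl
  have hA : A.IsHermitian := by
    ext i j
    simp [hAij, mul_comm]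
  have hL2 (i : ι) : MemLp (ξ i) 2 P := (hξ.eval i).memLp_two
  have hint (i j : ι) : Integrable (fun ω => ξ i ω * ξ j ω) P := (hL2 i).integrable_mul (hL2 j)
  set U : Matrix ι ι ℝ := (hA.eigenvectorUnitary : Matrix ι ι ℝ) with hU
  have hUU : U * U.transpose = 1 := by
    have := Unitary.coe_mul_star_self hA.eigenvectorUnitary
    simpa [Matrix.star_eq_conjTranspose] using this
  have hUU' : U.transpose * U = 1 := by
    have := Unitary.coe_star_mul_self hA.eigenvectorUnitary
    simpa [Matrix.star_eq_conjTranspose] using this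
  set d := hA.eigenvalues
  have hdiag : U.transpose * A * U = Matrix.diagonal d := by
    have := hA.conjStarAlgAut_star_eigenvectorUnitary
    rw [Unitary.conjStarAlgAut_star_apply] at this
    simpa [Matrix.star_eq_conjTranspose, Function.comp_def] using this
  set ζ : ι → Ω → ℝ := fun i ω => ∑ j, U j i * ξ j ω with hζdef
  have hζ : HasGaussianLaw (fun ω i => ζ i ω) P := by
    have := hξ.map_fun (LinearMap.toContinuousLinearMap (Matrix.toLin' U.transpose))
    convert! this using 2 with ω
  have hζ0 (i : ι) : ∫ ω, ζ i ω ∂P = 0 := by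
    simp only [hζdef]
    rw [integral_finsetSum _ fun j _ => ((hL2 j).integrable (by norm_num)).const_mul _]
    simp [integral_const_mul, h0]
  have hcov (i j : ι) : ∫ ω, ζ i ω * ζ j ω ∂P = Matrix.diagonal d i j := by
    rw [← hdiag]
    have h1 (ω : Ω) : ζ i ω * ζ j ω = ∑ l, ∑ k, U k i * U l j * (ξ k ω * ξ l ω) := by
      simp only [hζdef, Finset.sum_mul_sum]
      rw [Finset.sum_comm]
      exact Finset.sum_congr rfl fun _ _ => Finset.sum_congr rfl fun _ _ => by ring
    simp_rw [h1]
    rw [integral_finsetSum _ fun l _ => integrable_finsetSum _ fun k _ => (hint k l).const_mul _]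
    simp_rw [Matrix.mul_apply, Finset.sum_mul]
    refine Finset.sum_congr rfl fun l _ => ?_
    rw [integral_finsetSum _ fun k _ => (hint k l).const_mul _]
    refine Finset.sum_congr rfl fun k _ => ?_
    rw [integral_const_mul, hAij, Matrix.transpose_apply]
    ring
  have hcov' (i j : ι) : cov[ζ i, ζ j; P] = Matrix.diagonal d i j := by
    rw [covariance_eq_sub (hζ.eval i).memLp_two (hζ.eval j).memLp_two, hζ0, hζ0, ← hcov]
    simp
  have hvar (i : ι) : Var[ζ i; P] = d i := by
    rw [← covariance_self (hζ.eval i).aemeasurable, hcov']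
    simp
  refine ⟨d, ζ, fun i => hvar i ▸ variance_nonneg _ _,
    hζ.iIndepFun_of_covariance_eq_zero fun i j hij => ?_, fun i => ?_, fun ω => ?_, ?_, ?_,
    fun i => ?_⟩
  · rw [hcov', Matrix.diagonal_apply_ne _ hij]
  · rw [(hζ.eval i).map_eq_gaussianReal, hvar, hζ0]
  · have h1 : (fun i => ζ i ω) = Matrix.mulVec U.transpose (fun i => ξ i ω) := by
      ext i
      simp [hζdef, Matrix.mulVec, dotProduct]
    have h2 : dotProduct (fun i => ζ i ω) (fun i => ζ i ω)
        = dotProduct (fun i => ξ i ω) (fun i => ξ i ω) := by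
      rw [h1, Matrix.dotProduct_mulVec, Matrix.vecMul_mulVec, Matrix.transpose_transpose,
        ← Matrix.dotProduct_mulVec, hUU, Matrix.one_mulVec]
    simpa [dotProduct, sq] using h2
  · have h1 : A.trace = ∑ i, d i := by
      have := congrArg Matrix.trace hdiag
      rw [Matrix.trace_mul_cycle, hUU, Matrix.one_mul, Matrix.trace_diagonal] at this
      exact this
    rw [← h1]
    simp [Matrix.trace, hAij, sq]
  · have h1 : (A * A).trace = ∑ i, d i ^ 2 := by
      have h2 : U.transpose * (A * A) * U = Matrix.diagonal d * Matrix.diagonal d := by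
        rw [← hdiag]
        calc U.transpose * (A * A) * U = U.transpose * A * 1 * A * U := by
              simp only [Matrix.mul_assoc, Matrix.one_mul]
          _ = _ := by rw [← hUU]; simp only [Matrix.mul_assoc]
      have := congrArg Matrix.trace h2
      rw [Matrix.trace_mul_cycle, hUU, Matrix.one_mul, Matrix.diagonal_mul_diagonal,
        Matrix.trace_diagonal] at this
      simpa [sq] using this
    rw [← h1]
    simp only [Matrix.trace, Matrix.diag, Matrix.mul_apply]
    refine Finset.sum_congr rfl fun i _ => Finset.sum_congr rfl fun j _ => ?_
    rw [hAij, hAij, sq]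
    simp_rw [mul_comm (ξ j _)]
  · have hev : Module.End.HasEigenvalue (Matrix.toLin' A) (d i) := by
      refine Module.End.hasEigenvalue_of_hasEigenvector (x := ⇑(hA.eigenvectorBasis i)) ?_
      refine ⟨?_, ?_⟩
      · rw [Module.End.mem_eigenspace_iff, Matrix.toLin'_apply]
        exact hA.mulVec_eigenvectorBasis i
      · intro h
        refine hA.eigenvectorBasis.toBasis.ne_zero i ?_
        ext j
        simpa using congrFun h j
    obtain ⟨k, hk⟩ := eigenvalue_mem_ball hev
    refine ⟨k, ?_⟩
    rw [Metric.mem_closedBall, Real.dist_eq] at hk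
    have h2 := Finset.add_sum_erase Finset.univ (fun j => |A k j|) (Finset.mem_univ k)
    have h3 := le_abs_self (d i - A k k)
    have h4 := le_abs_self (A k k)
    simp only [Real.norm_eq_abs] at hk
    change d i ≤ ∑ j, |A k j|
    linarith

/-- A centred quadratic form in a Gaussian vector has the law of a combination of independent
variables `Z² - 1`. The weights `d` are the eigenvalues of the covariance matrix, bounded by its row
sums. -/
lemma charFun_quadraticForm {ι : Type*} [Fintype ι] {ξ : ι → Ω → ℝ}
    (hξ : HasGaussianLaw (fun ω i => ξ i ω) P) (h0 : ∀ i, ∫ ω, ξ i ω ∂P = 0) :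
    ∃ d : ι → ℝ, (∀ i, 0 ≤ d i) ∧
      ∑ i, d i ^ 2 = ∑ i, ∑ j, (∫ ω, ξ i ω * ξ j ω ∂P) ^ 2 ∧
      (∀ i, ∃ k, d i ≤ ∑ j, |∫ ω, ξ k ω * ξ j ω ∂P|) ∧
      ∀ a t : ℝ, charFun (P.map fun ω => a * ∑ i, (ξ i ω ^ 2 - ∫ ω, ξ i ω ^ 2 ∂P)) t
        = ∏ i, charFun chiSqLaw (√2 * a * d i * t) := by
  obtain ⟨d, ζ, hd, hind, hmap, hsq, htr, hfro, hger⟩ := exists_diagonalization hξ h0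
  refine ⟨d, hd, hfro, hger, fun a t => ?_⟩
  have hm (i : ι) : AEMeasurable (ζ i) P := by
    apply AEMeasurable.of_map_ne_zero
    rw [hmap]
    exact IsProbabilityMeasure.ne_zero _
  have h1 : (fun ω => a * ∑ i, (ξ i ω ^ 2 - ∫ ω, ξ i ω ^ 2 ∂P))
      = fun ω => ∑ i, a * (ζ i ω ^ 2 - d i) := by
    ext ω
    rw [← Finset.mul_sum, Finset.sum_sub_distrib, Finset.sum_sub_distrib, hsq, htr]
  have h2 := (hind.comp (fun i x => a * (x ^ 2 - d i)) fun i => by fun_prop)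
  have h3 := h2.charFun_map_fun_sum_eq_prod (fun i => by
    simp only [Function.comp_def]; have := hm i; fun_prop)
  simp only [Function.comp_def] at h3
  rw [h1, h3, Finset.prod_apply]
  exact Finset.prod_congr rfl fun i _ => charFun_sq_sub (hd i) (hmap i) a t

lemma norm_prod_sub_prod_le {ι : Type*} (s : Finset ι) {a b : ι → ℂ} (ha : ∀ i ∈ s, ‖a i‖ ≤ 1)
    (hb : ∀ i ∈ s, ‖b i‖ ≤ 1) : ‖∏ i ∈ s, a i - ∏ i ∈ s, b i‖ ≤ ∑ i ∈ s, ‖a i - b i‖ := by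
  classical
  induction s using Finset.induction_on with
  | empty => simp
  | insert i s hi ih =>
    rw [Finset.prod_insert hi, Finset.prod_insert hi, Finset.sum_insert hi]
    have h1 := ih (fun j hj => ha j (Finset.mem_insert_of_mem hj))
      (fun j hj => hb j (Finset.mem_insert_of_mem hj))
    have h2 : ‖∏ j ∈ s, a j‖ ≤ 1 := by
      rw [norm_prod]
      exact Finset.prod_le_one (fun _ _ => norm_nonneg _)
        fun j hj => ha j (Finset.mem_insert_of_mem hj)
    have h3 := hb i (Finset.mem_insert_self i s)
    calc ‖a i * ∏ j ∈ s, a j - b i * ∏ j ∈ s, b j‖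
        = ‖(a i - b i) * ∏ j ∈ s, a j + b i * (∏ j ∈ s, a j - ∏ j ∈ s, b j)‖ := by congr 1; ring
      _ ≤ ‖a i - b i‖ * ‖∏ j ∈ s, a j‖ + ‖b i‖ * ‖∏ j ∈ s, a j - ∏ j ∈ s, b j‖ := by
          rw [← norm_mul, ← norm_mul]
          exact norm_add_le _ _
      _ ≤ ‖a i - b i‖ * 1 + 1 * ∑ j ∈ s, ‖a j - b j‖ := by gcongr
      _ = _ := by ring

lemma charFun_chiSqLaw_sub_exp_isLittleO :
    (fun t : ℝ => charFun chiSqLaw t - Complex.exp (-(t ^ 2 / 2))) =o[𝓝 0]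
      fun t : ℝ => t ^ 2 := by
  have h1 : (fun t : ℝ => Complex.exp (-(t ^ 2 / 2)) - (1 - t ^ 2 / 2)) =O[𝓝 0]
      fun t : ℝ => t ^ 4 := by
    refine Asymptotics.IsBigO.of_bound 1 ?_
    filter_upwards [Metric.ball_mem_nhds (0 : ℝ) one_pos] with t ht
    rw [Metric.mem_ball, dist_zero_right] at ht
    have h2 : ‖(-(t ^ 2 / 2) : ℂ)‖ = t ^ 2 / 2 := by
      rw [norm_neg, show ((t : ℂ) ^ 2 / 2) = ((t ^ 2 / 2 : ℝ) : ℂ) by push_cast; rfl,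
        Complex.norm_real, Real.norm_of_nonneg (by positivity)]
    have h3 : t ^ 2 ≤ 1 := by
      rw [Real.norm_eq_abs] at ht
      rw [← sq_abs]
      exact pow_le_one₀ (abs_nonneg t) ht.le
    have h4 := Complex.norm_exp_sub_one_sub_id_le (x := (-(t ^ 2 / 2) : ℂ)) (by rw [h2]; linarith)
    rw [h2] at h4
    rw [Real.norm_of_nonneg (by positivity)]
    calc _ = ‖Complex.exp (-(t ^ 2 / 2)) - 1 - (-(t ^ 2 / 2))‖ := by congr 1; ring
      _ ≤ (t ^ 2 / 2) ^ 2 := h4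
      _ ≤ 1 * t ^ 4 := by nlinarith [sq_nonneg (t ^ 2)]
  have h2 : (fun t : ℝ => t ^ 4) =o[𝓝 0] fun t : ℝ => t ^ 2 :=
    Asymptotics.isLittleO_pow_pow (by norm_num)
  refine (taylor_charFun_chiSqLaw.sub (h1.trans_isLittleO h2)).congr_left fun t => ?_
  ring

/-- Products of the characteristic function of `chiSqLaw` over a row of a triangular array behave
like those of the standard normal law, as soon as the array is asymptotically negligible. -/
lemma tendsto_prod_charFun_chiSqLaw {ι : ℕ → Type*} [∀ N, Fintype (ι N)]
    {x : ∀ N, ι N → ℝ} {w : ℝ} (hw : Tendsto (fun N => ∑ i, x N i ^ 2) atTop (𝓝 w))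
    {r : ℕ → ℝ} (hr : ∀ N i, |x N i| ≤ r N) (hr0 : Tendsto r atTop (𝓝 0)) :
    Tendsto (fun N => ∏ i, charFun chiSqLaw (x N i)) atTop (𝓝 (Complex.exp (-(w / 2)))) := by
  have h1 : Tendsto (fun N => Complex.exp (-((∑ i, x N i ^ 2 : ℝ) / 2))) atTop
      (𝓝 (Complex.exp (-(w / 2)))) := by
    have : Continuous fun y : ℝ => Complex.exp (-((y : ℂ) / 2)) := by fun_prop
    exact (this.tendsto w).comp hw
  suffices h : Tendsto (fun N => (∏ i, charFun chiSqLaw (x N i))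
      - Complex.exp (-((∑ i, x N i ^ 2 : ℝ) / 2))) atTop (𝓝 0) by
    simpa using h.add h1
  rw [Metric.tendsto_atTop']
  intro ε hε
  have hK : 0 < |w| + 1 := by positivity
  have h2 := charFun_chiSqLaw_sub_exp_isLittleO.def (c := ε / (|w| + 1)) (by positivity)
  obtain ⟨δ, hδ, h3⟩ := Metric.eventually_nhds_iff.1 h2
  obtain ⟨N₁, hN₁⟩ := (Filter.eventually_atTop).1 (hr0.eventually (gt_mem_nhds hδ))
  obtain ⟨N₂, hN₂⟩ := (Filter.eventually_atTop).1
    (hw.eventually (gt_mem_nhds (show w < |w| + 1 by linarith [le_abs_self w])))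
  refine ⟨max N₁ N₂, fun N hN => ?_⟩
  have hN1 := hN₁ N ((le_max_left _ _).trans hN.le)
  have hN2 := hN₂ N ((le_max_right _ _).trans hN.le)
  have h4 : Complex.exp (-((∑ i, x N i ^ 2 : ℝ) / 2)) = ∏ i, Complex.exp (-(x N i ^ 2 / 2)) := by
    rw [← Complex.exp_sum]
    congr 1
    push_cast
    rw [Finset.sum_neg_distrib, Finset.sum_div]
  rw [dist_zero_right, h4]
  have h5 (y : ℝ) : ‖Complex.exp (-((y : ℂ) ^ 2 / 2))‖ ≤ 1 := by
    rw [Complex.norm_exp, Real.exp_le_one_iff]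
    have : (-((y : ℂ) ^ 2 / 2)) = ((-(y ^ 2 / 2) : ℝ) : ℂ) := by push_cast; rfl
    rw [this, Complex.ofReal_re]
    have := sq_nonneg y
    linarith
  calc _ ≤ ∑ i, ‖charFun chiSqLaw (x N i) - Complex.exp (-(x N i ^ 2 / 2))‖ :=
        norm_prod_sub_prod_le _ (fun i _ => norm_charFun_le_one _) fun i _ => h5 _
    _ ≤ ∑ i, ε / (|w| + 1) * x N i ^ 2 := by
        refine Finset.sum_le_sum fun i _ => ?_
        have := h3 (y := x N i) (by
          rw [dist_zero_right]
          exact (hr N i).trans_lt hN1)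
        rwa [Real.norm_of_nonneg (sq_nonneg (x N i))] at this
    _ = ε / (|w| + 1) * ∑ i, x N i ^ 2 := by rw [Finset.mul_sum]
    _ < ε / (|w| + 1) * (|w| + 1) := by gcongr
    _ = ε := by field_simp

/-- **Central limit theorem for quadratic forms**: the centred squared norms of Gaussian vectors
converge in distribution as soon as their variances do and the row sums of the covariance matrices
become negligible. -/
theorem tendstoInDistribution_quadraticForm {ι : ℕ → Type*} [∀ N, Fintype (ι N)]
    {ξ : ∀ N, ι N → Ω → ℝ} (hξ : ∀ N, HasGaussianLaw (fun ω i => ξ N i ω) P)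
    (h0 : ∀ N i, ∫ ω, ξ N i ω ∂P = 0) {a : ℕ → ℝ} {v : ℝ≥0}
    (hv : Tendsto (fun N => 2 * a N ^ 2 * ∑ i, ∑ j, (∫ ω, ξ N i ω * ξ N j ω ∂P) ^ 2) atTop
      (𝓝 (v : ℝ)))
    {r : ℕ → ℝ} (hr : ∀ N i, |a N| * ∑ j, |∫ ω, ξ N i ω * ξ N j ω ∂P| ≤ r N)
    (hr0 : Tendsto r atTop (𝓝 0)) :
    TendstoInDistribution (fun N ω => a N * ∑ i, (ξ N i ω ^ 2 - ∫ ω, ξ N i ω ^ 2 ∂P)) atTop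
      (id : ℝ → ℝ) (fun _ => P) (gaussianReal 0 v) where
  forall_aemeasurable N := by
    have (i : ι N) : AEMeasurable (ξ N i) P := ((hξ N).eval i).aemeasurable
    fun_prop
  tendsto := by
    choose d hd hfro hger hchar using fun N => charFun_quadraticForm (hξ N) (h0 N)
    refine ProbabilityMeasure.tendsto_iff_tendsto_charFun.2 fun t => ?_
    simp only [ProbabilityMeasure.coe_mk, Measure.map_id, hchar, charFun_gaussianReal]
    have h1 := tendsto_prod_charFun_chiSqLaw (x := fun N i => √2 * a N * d N i * t)
      (w := v * t ^ 2) (r := fun N => √2 * r N * |t|) ?_ (fun N i => ?_) ?_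
    · convert! h1 using 2
      congr 1
      push_cast
      ring
    · have := hv.mul_const (t ^ 2)
      refine this.congr fun N => ?_
      rw [← hfro, Finset.mul_sum, Finset.sum_mul]
      refine Finset.sum_congr rfl fun i _ => ?_
      rw [mul_pow, mul_pow, mul_pow, Real.sq_sqrt zero_le_two]
    · obtain ⟨k, hk⟩ := hger N i
      rw [abs_mul, abs_mul, abs_mul, abs_of_nonneg (hd N i), abs_of_nonneg (Real.sqrt_nonneg 2),
        mul_assoc √2]
      have : |a N| * d N i ≤ r N :=
        (mul_le_mul_of_nonneg_left hk (abs_nonneg _)).trans (hr N k)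
      gcongr
    · simpa using (hr0.const_mul √2).mul_const |t|

end

/-! ### Linear integral equations -/

section

/-- The only solution of `g(t) = c + ∫₀ᵗ q g` with a bounded coefficient `q` is
`c exp (∫₀ᵗ q)`. -/
lemma eq_mul_exp_of_integral_eq {q g : ℝ → ℝ} {c K : ℝ} (hK : ∀ u ∈ Set.Icc (0 : ℝ) 1, |q u| ≤ K)
    (hq : IntervalIntegrable q volume 0 1)
    (hqg : IntervalIntegrable (fun u => q u * g u) volume 0 1)
    (hg : ∀ t ∈ Set.Icc (0 : ℝ) 1, g t = c + ∫ u in (0 : ℝ)..t, q u * g u) :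
    ∀ t ∈ Set.Icc (0 : ℝ) 1, g t = c * Real.exp (∫ u in (0 : ℝ)..t, q u) := by
  set A : ℝ → ℝ := fun t => ∫ u in (0 : ℝ)..t, q u with hA
  have hK0 : 0 ≤ K := (abs_nonneg _).trans (hK 0 (by simp))
  have sub (s t : ℝ) (hs : 0 ≤ s) (hst : s ≤ t) (ht : t ≤ 1) :
      Set.uIcc s t ⊆ Set.uIcc 0 1 := by
    rw [Set.uIcc_of_le hst, Set.uIcc_of_le zero_le_one]
    exact Set.Icc_subset_Icc hs ht
  have hAc : ContinuousOn A (Set.Icc 0 1) := by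
    have := intervalIntegral.continuousOn_primitive_interval' hq (a := 0) (by simp)
    rwa [Set.uIcc_of_le zero_le_one] at this
  have hgc : ContinuousOn g (Set.Icc 0 1) := by
    have := intervalIntegral.continuousOn_primitive_interval' hqg (a := 0) (by simp)
    rw [Set.uIcc_of_le zero_le_one] at this
    exact (this.const_add c).congr fun t ht => hg t ht
  obtain ⟨G, hG⟩ := isCompact_Icc.exists_bound_of_continuousOn hgc
  simp only [Real.norm_eq_abs] at hG
  have hG0 : 0 ≤ G := (abs_nonneg _).trans (hG 0 (by simp))
  have hAsub (s t : ℝ) (hs : 0 ≤ s) (hst : s ≤ t) (ht : t ≤ 1) :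
      A t - A s = ∫ u in s..t, q u :=
    intervalIntegral.integral_interval_sub_left (hq.mono_set (sub 0 t le_rfl (hs.trans hst) ht))
      (hq.mono_set (sub 0 s le_rfl hs (hst.trans ht)))
  have hgsub (s t : ℝ) (hs : 0 ≤ s) (hst : s ≤ t) (ht : t ≤ 1) :
      g t - g s = ∫ u in s..t, q u * g u := by
    rw [hg t ⟨hs.trans hst, ht⟩, hg s ⟨hs, hst.trans ht⟩, add_sub_add_left_eq_sub]
    exact intervalIntegral.integral_interval_sub_left
      (hqg.mono_set (sub 0 t le_rfl (hs.trans hst) ht))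
      (hqg.mono_set (sub 0 s le_rfl hs (hst.trans ht)))
  have hAle (s t : ℝ) (hs : 0 ≤ s) (hst : s ≤ t) (ht : t ≤ 1) : |A t - A s| ≤ K * (t - s) := by
    rw [hAsub s t hs hst ht]
    rw [← Real.norm_eq_abs]
    refine (intervalIntegral.norm_integral_le_of_norm_le_const (C := K) fun u hu => ?_).trans_eq
      (by rw [abs_of_nonneg (sub_nonneg.2 hst)])
    rw [Set.uIoc_of_le hst] at hu
    exact hK u ⟨hs.trans hu.1.le, hu.2.trans ht⟩
  have hgle (s t : ℝ) (hs : 0 ≤ s) (hst : s ≤ t) (ht : t ≤ 1) :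
      |g t - g s| ≤ K * G * (t - s) := by
    rw [hgsub s t hs hst ht]
    rw [← Real.norm_eq_abs]
    refine (intervalIntegral.norm_integral_le_of_norm_le_const (C := K * G)
      fun u hu => ?_).trans_eq (by rw [abs_of_nonneg (sub_nonneg.2 hst)])
    rw [Set.uIoc_of_le hst] at hu
    have hu' : u ∈ Set.Icc (0 : ℝ) 1 := ⟨hs.trans hu.1.le, hu.2.trans ht⟩
    rw [norm_mul]
    exact mul_le_mul (hK u hu') (hG u hu') (norm_nonneg _) hK0
  have hlin (s t : ℝ) (hs : 0 ≤ s) (hst : s ≤ t) (ht : t ≤ 1) :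
      |g t - g s - g s * (A t - A s)| ≤ K * (K * G * (t - s)) * (t - s) := by
    have e : g t - g s - g s * (A t - A s) = ∫ u in s..t, q u * (g u - g s) := by
      rw [hgsub s t hs hst ht, hAsub s t hs hst ht, ← intervalIntegral.integral_const_mul,
        ← intervalIntegral.integral_sub (hqg.mono_set (sub s t hs hst ht))
          ((hq.mono_set (sub s t hs hst ht)).const_mul _)]
      congr 1
      ext u
      ring
    rw [e]
    rw [← Real.norm_eq_abs]
    refine (intervalIntegral.norm_integral_le_of_norm_le_const fun u hu => ?_).trans_eq
      (by rw [abs_of_nonneg (sub_nonneg.2 hst)])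
    rw [Set.uIoc_of_le hst] at hu
    rw [norm_mul]
    refine mul_le_mul (hK u ⟨hs.trans hu.1.le, hu.2.trans ht⟩) ?_ (norm_nonneg _) hK0
    refine (hgle s u hs hu.1.le (hu.2.trans ht)).trans ?_
    gcongr
    exact hu.2
  -- `F` has zero derivative from the right: its increments are quadratic in the step.
  set F : ℝ → ℝ := fun t => g t * Real.exp (-A t) with hF
  have hFle (s t : ℝ) (hs : 0 ≤ s) (hst : s ≤ t) (ht : t ≤ 1) (hδ : K * (t - s) ≤ 1) :
      |F t - F s| ≤ Real.exp K * (2 * K ^ 2 * G) * (t - s) ^ 2 := by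
    have e : F t - F s = Real.exp (-A t) * ((g t - g s - g s * (A t - A s))
        - g s * (Real.exp (A t - A s) - 1 - (A t - A s))) := by
      have : Real.exp (-A s) = Real.exp (-A t) * Real.exp (A t - A s) := by
        rw [← Real.exp_add]; congr 1; ring
      simp only [hF, this]
      ring
    have h1 := hAle s t hs hst ht
    have h2 : |Real.exp (A t - A s) - 1 - (A t - A s)| ≤ (K * (t - s)) ^ 2 := by
      refine (Real.norm_exp_sub_one_sub_id_le (h1.trans hδ)).trans ?_
      rw [Real.norm_eq_abs]
      gcongr
    have h3 : -A t ≤ K := by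
      have h4 := hAle 0 t le_rfl (hs.trans hst) ht
      have h5 : A 0 = 0 := by simp [hA]
      rw [h5, sub_zero, sub_zero] at h4
      have h6 := neg_abs_le (A t)
      have h7 : K * t ≤ K * 1 := by gcongr
      linarith
    rw [e, abs_mul, Real.abs_exp, mul_assoc]
    refine mul_le_mul (Real.exp_le_exp.2 h3) ?_ (abs_nonneg _) (Real.exp_nonneg _)
    refine (abs_sub _ _).trans ?_
    rw [abs_mul (g s)]
    have h8 := mul_le_mul (hG s ⟨hs, hst.trans ht⟩) h2 (abs_nonneg _) hG0
    have h9 := hlin s t hs hst ht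
    nlinarith
  have hFc : ContinuousOn F (Set.Icc 0 1) := hgc.mul (Real.continuous_exp.comp_continuousOn hAc.neg)
  have hFconst := constant_of_has_deriv_right_zero hFc fun s hs => by
    rw [hasDerivWithinAt_iff_isLittleO]
    have hev : ∀ᶠ t in 𝓝[Set.Ici s] s,
        ‖F t - F s‖ ≤ Real.exp K * (2 * K ^ 2 * G) * ‖(t - s) ^ 2‖ := by
      have hc : ContinuousAt (fun t : ℝ => K * (t - s)) s := by fun_prop
      have h1 : ∀ᶠ t in 𝓝 s, K * (t - s) < 1 :=
        hc.eventually_lt continuousAt_const (by simp)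
      filter_upwards [self_mem_nhdsWithin, nhdsWithin_le_nhds h1,
        nhdsWithin_le_nhds (gt_mem_nhds hs.2)] with t ht1 ht2 ht3
      rw [Real.norm_of_nonneg (sq_nonneg _)]
      exact hFle s t hs.1 ht1 (le_of_lt ht3) ht2.le
    have h2 : (fun t : ℝ => (t - s) ^ 2) =o[𝓝 s] fun t => t - s := by
      have h3 : (fun y : ℝ => y ^ 2) =o[𝓝 0] fun y : ℝ => y := by
        simpa using Asymptotics.isLittleO_pow_pow (𝕜 := ℝ) (m := 1) (n := 2) (by norm_num)
      have h4 : Tendsto (fun t : ℝ => t - s) (𝓝 s) (𝓝 0) := by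
        have : ContinuousAt (fun t : ℝ => t - s) s := by fun_prop
        simpa [ContinuousAt] using this
      exact h3.comp_tendsto h4
    simpa using (Asymptotics.IsBigO.of_bound _ hev).trans_isLittleO (h2.mono nhdsWithin_le_nhds)
  intro t ht
  have h1 := hFconst t ht
  have h0 : g 0 = c := by rw [hg 0 (by simp)]; simp
  simp only [hF, h0] at h1
  have h5 : A 0 = 0 := by simp [hA]
  rw [h5, neg_zero, Real.exp_zero, mul_one] at h1
  change g t = c * Real.exp (A t)
  rw [← h1, mul_assoc, ← Real.exp_add, neg_add_cancel, Real.exp_zero, mul_one]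

end

/-! ### The `S`-transform -/

section

section Mgf

variable {Ω Ω' : Type*} [MeasurableSpace Ω] [MeasurableSpace Ω'] {μ : Measure Ω} {μ' : Measure Ω'}
  [IsFiniteMeasure μ] [IsFiniteMeasure μ'] {X : Ω → ℝ} {Y : Ω' → ℝ}

/-- A moment generating function that is finite everywhere determines the law. -/
lemma map_eq_of_mgf_eq (hX : AEMeasurable X μ) (hY : AEMeasurable Y μ')
    (h : mgf X μ = mgf Y μ') (hint : ∀ t, Integrable (fun ω => Real.exp (t * X ω)) μ) :
    μ.map X = μ'.map Y := by
  refine Measure.ext_of_complexMGF_eq hX hY (funext fun z => ?_)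
  refine eqOn_complexMGF_of_mgf' h ?_ (?_ : z.re ∈ interior (integrableExpSet X μ))
  · have h0 := congrFun h 0
    rw [mgf_zero', mgf_zero'] at h0
    rw [← Measure.measure_univ_eq_zero, ← Measure.measure_univ_eq_zero (μ := μ'),
      ← measureReal_eq_zero_iff, ← measureReal_eq_zero_iff, h0]
  · have : integrableExpSet X μ = Set.univ := Set.eq_univ_of_forall hint
    simp [this]

end Mgf

variable {Ω : Type*} [MeasurableSpace Ω] {P : Measure Ω} {H : ℝ} {B : ℝ → Ω → ℝ}
  {f : ℝ → ℝ} {I : Ω → ℝ}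

lemma sTransform_const_mul (c : ℝ) (F : Ω → ℝ) (φ : StepFn) :
    sTransform B P (fun ω => c * F ω) φ = c * sTransform B P F φ := by
  simp only [sTransform, mul_assoc]
  exact integral_const_mul _ _

variable [IsProbabilityMeasure P]

lemma IsWienerIntegral.mgf_eq (hB : IsFBM H B P) (h1 : 1 / 2 < H) (h2 : H < 1)
    (hf : BddSupp f) (hI : IsWienerIntegral H B P f I) (t : ℝ) :
    mgf I P t = Real.exp (fracInner H f f * t ^ 2 / 2) := by
  rw [mgf_gaussianReal (hI.map_eq hB h1 h2 hf),
    Real.coe_toNNReal _ (fracInner_self_nonneg h1 h2 hf), zero_mul, zero_add]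

lemma IsWienerIntegral.integrable_exp (hB : IsFBM H B P) (h1 : 1 / 2 < H) (h2 : H < 1)
    (hf : BddSupp f) (hI : IsWienerIntegral H B P f I) (t : ℝ) :
    Integrable (fun ω => Real.exp (t * I ω)) P := by
  have h := hI.mgf_eq hB h1 h2 hf t
  exact Integrable.of_integral_ne_zero (ne_of_eq_of_ne h (Real.exp_pos _).ne')

lemma integrable_exp_stepIntegral (hB : IsFBM H B P) (h1 : 1 / 2 < H) (h2 : H < 1) (φ : StepFn) :
    Integrable (fun ω => Real.exp (φ.integral B ω)) P := by
  simpa using (isWienerIntegral_stepFn hB h1 h2 φ).integrable_exp hB h1 h2 (bddSupp_stepFn φ) 1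

lemma integral_exp_stepIntegral (hB : IsFBM H B P) (h1 : 1 / 2 < H) (h2 : H < 1) (φ : StepFn) :
    ∫ ω, Real.exp (φ.integral B ω) ∂P = Real.exp (fracInner H φ.eval φ.eval / 2) := by
  simpa [mgf] using (isWienerIntegral_stepFn hB h1 h2 φ).mgf_eq hB h1 h2 (bddSupp_stepFn φ) 1

lemma wickExp_eq (hB : IsFBM H B P) (h1 : 1 / 2 < H) (h2 : H < 1) (φ : StepFn) (ω : Ω) :
    wickExp B P φ ω = Real.exp (φ.integral B ω) / ∫ ω', Real.exp (φ.integral B ω') ∂P := by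
  rw [integral_exp_stepIntegral hB h1 h2, ← Real.exp_sub, wickExp]
  simp_rw [sq]
  rw [integral_stepIntegral_mul hB h1]

/-- The `S`-transform is the expectation after an exponential change of measure. -/
lemma sTransform_eq_integral_tilted (hB : IsFBM H B P) (h1 : 1 / 2 < H) (h2 : H < 1) (F : Ω → ℝ)
    (φ : StepFn) : sTransform B P F φ = ∫ ω, F ω ∂P.tilted (φ.integral B) := by
  rw [integral_tilted, sTransform]
  simp_rw [wickExp_eq hB h1 h2, smul_eq_mul, mul_comm (F _)]

/-- A Cameron-Martin formula: the change of measure with density `wickExp B P φ` shifts the Wiener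
integral of `f` by the inner product of `f` and `φ`. -/
lemma IsWienerIntegral.map_tilted (hB : IsFBM H B P) (h1 : 1 / 2 < H) (h2 : H < 1)
    (hf : BddSupp f) (hI : IsWienerIntegral H B P f I) (φ : StepFn) :
    (P.tilted (φ.integral B)).map I
      = gaussianReal (fracInner H f φ.eval) (fracInner H f f).toNNReal := by
  have hexp := integrable_exp_stepIntegral hB h1 h2 φ
  have := isProbabilityMeasure_tilted hexp
  have hφ := bddSupp_stepFn φ
  have hsum (t : ℝ) := (isWienerIntegral_stepFn hB h1 h2 φ).add hB h1 h2 hφ (hf.const_mul t)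
    (hI.const_mul h1 h2 hf t)
  have hmgf : mgf I (P.tilted (φ.integral B))
      = mgf id (gaussianReal (fracInner H f φ.eval) (fracInner H f f).toNNReal) := by
    rw [mgf_id_gaussianReal]
    ext t
    have h := (hsum t).mgf_eq hB h1 h2 (hφ.add (hf.const_mul t)) 1
    simp only [mgf, one_mul, one_pow, mul_one] at h
    rw [mgf, integral_exp_tilted, integral_exp_stepIntegral hB h1 h2,
      Real.coe_toNNReal _ (fracInner_self_nonneg h1 h2 hf)]
    simp only [Pi.add_apply]
    rw [h, ← Real.exp_sub, fracInner_add_left h1 hφ (hf.const_mul t) (hφ.add (hf.const_mul t)),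
      fracInner_add_right h1 hφ (hf.const_mul t) hφ,
      fracInner_add_right h1 hφ (hf.const_mul t) (hf.const_mul t), fracInner_const_mul_left,
      fracInner_const_mul_right, fracInner_const_mul_right, fracInner_const_mul_left,
      fracInner_comm φ.eval f]
    congr 1
    ring
  have hm : AEMeasurable I (P.tilted (φ.integral B)) :=
    hI.aemeasurable.mono_ac (tilted_absolutelyContinuous _ _)
  rw [map_eq_of_mgf_eq hm (by fun_prop) hmgf fun t => ?_, Measure.map_id]
  rw [integrable_tilted_iff hexp]
  have := (hsum t).integrable_exp hB h1 h2 (hφ.add (hf.const_mul t)) 1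
  simpa [Real.exp_add] using this

lemma IsWienerIntegral.sTransform_eq (hB : IsFBM H B P) (h1 : 1 / 2 < H) (h2 : H < 1)
    (hf : BddSupp f) (hI : IsWienerIntegral H B P f I) (φ : StepFn) :
    sTransform B P I φ = fracInner H f φ.eval := by
  have hm : AEMeasurable I (P.tilted (φ.integral B)) :=
    hI.aemeasurable.mono_ac (tilted_absolutelyContinuous _ _)
  rw [sTransform_eq_integral_tilted hB h1 h2]
  have := integral_map hm (f := fun x : ℝ => x) (by fun_prop)
  rw [← this, hI.map_tilted hB h1 h2 hf, integral_id_gaussianReal]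

lemma IsWienerIntegral.sTransform_exp (hB : IsFBM H B P) (h1 : 1 / 2 < H) (h2 : H < 1)
    (hf : BddSupp f) (hI : IsWienerIntegral H B P f I) (φ : StepFn) :
    sTransform B P (fun ω => Real.exp (I ω - fracInner H f f / 2)) φ
      = Real.exp (fracInner H f φ.eval) := by
  have h := mgf_gaussianReal (hI.map_tilted hB h1 h2 hf φ) 1
  rw [Real.coe_toNNReal _ (fracInner_self_nonneg h1 h2 hf), mgf] at h
  rw [sTransform_eq_integral_tilted hB h1 h2]
  simp only [one_mul, mul_one, one_pow] at h
  simp_rw [Real.exp_sub]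
  rw [integral_div, h, Real.exp_add, mul_div_assoc, div_self (Real.exp_pos _).ne', mul_one]

lemma sTransform_const (hB : IsFBM H B P) (h1 : 1 / 2 < H) (h2 : H < 1) (c : ℝ) (φ : StepFn) :
    sTransform B P (fun _ => c) φ = c := by
  have := isProbabilityMeasure_tilted (integrable_exp_stepIntegral hB h1 h2 φ)
  rw [sTransform_eq_integral_tilted hB h1 h2]
  simp

lemma integrable_mul_exp_stepIntegral (hB : IsFBM H B P) (h1 : 1 / 2 < H) (h2 : H < 1) {F : Ω → ℝ}
    (hF : MemLp F 2 P) (φ : StepFn) :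
    Integrable (fun ω => F ω * Real.exp (φ.integral B ω)) P := by
  refine hF.integrable_mul ((memLp_two_iff_integrable_sq ?_).2 ?_)
  · exact (Real.measurable_exp.comp (StepFn.measurable_integral hB φ)).aestronglyMeasurable
  · have := (isWienerIntegral_stepFn hB h1 h2 φ).integrable_exp hB h1 h2 (bddSupp_stepFn φ) 2
    refine this.congr (ae_of_all _ fun ω => ?_)
    simp only
    rw [two_mul, Real.exp_add, sq]

lemma sTransform_add (hB : IsFBM H B P) (h1 : 1 / 2 < H) (h2 : H < 1) {F G : Ω → ℝ}
    (hF : MemLp F 2 P) (hG : MemLp G 2 P) (φ : StepFn) :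
    sTransform B P (fun ω => F ω + G ω) φ = sTransform B P F φ + sTransform B P G φ := by
  have hint {F : Ω → ℝ} (hF : MemLp F 2 P) : Integrable F (P.tilted (φ.integral B)) := by
    rw [integrable_tilted_iff (integrable_exp_stepIntegral hB h1 h2 φ)]
    simpa [mul_comm] using integrable_mul_exp_stepIntegral hB h1 h2 hF φ
  simp_rw [sTransform_eq_integral_tilted hB h1 h2]
  exact integral_add (hint hF) (hint hG)

/-- The Riesz representative `u ↦ H(2H - 1) ∫ φ(v) |u - v|^{2H - 2} dv` of the functional
`f ↦ fracInner H f φ` for a step function `φ`. -/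
noncomputable def stepKernel (H : ℝ) (φ : StepFn) (u : ℝ) : ℝ :=
  φ.sum fun t a => a * cellKernel H 0 t u

lemma continuous_stepKernel (h1 : 1 / 2 < H) (φ : StepFn) : Continuous (stepKernel H φ) := by
  unfold stepKernel Finsupp.sum
  have := fun t : ℝ≥0 => continuous_cellKernel h1 0 (t : ℝ)
  fun_prop

lemma fracInner_stepFn (h1 : 1 / 2 < H) (hf : BddSupp f) (φ : StepFn) :
    fracInner H f φ.eval = ∫ u, f u * stepKernel H φ u := by
  have e : φ.eval = fun s => ∑ t ∈ φ.support, φ t * (Set.Icc (0 : ℝ) (t : ℝ)).indicator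
      (fun _ => 1) s := by
    funext s
    refine Finset.sum_congr rfl fun t _ => ?_
    by_cases hs : s ∈ Set.Icc (0 : ℝ) t <;> simp [hs]
  have hi (t : ℝ≥0) : Integrable (fun u => f u * cellKernel H 0 t u) := by
    obtain ⟨C, T, hC, hT, hb⟩ := hf.bound
    have hc := continuous_cellKernel h1 0 (t : ℝ)
    obtain ⟨D, hD⟩ := isCompact_Icc.exists_bound_of_continuousOn (s := Set.Icc 0 T) hc.continuousOn
    have : (fun u => f u * cellKernel H 0 t u)
        = fun u => f u * (Set.Icc 0 T).indicator (cellKernel H 0 t) u := by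
      ext u
      by_cases hu : u ∈ Set.Icc 0 T
      · simp [hu]
      · have := hb u
        rw [Set.indicator_of_notMem hu] at this
        simp [abs_nonpos_iff.1 this]
    rw [this]
    refine hf.integrable.mul_bdd (c := max D 0)
      (hc.measurable.indicator measurableSet_Icc).aestronglyMeasurable
      (ae_of_all _ fun u => ?_)
    by_cases hu : u ∈ Set.Icc 0 T
    · rw [Set.indicator_of_mem hu]; exact (hD u hu).trans (le_max_left _ _)
    · rw [Set.indicator_of_notMem hu, norm_zero]; exact le_max_right _ _
  rw [e, fracInner_sum_right h1 _ (fun t _ => (bddSupp_Icc le_rfl 1).const_mul _) hf]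
  simp only [stepKernel, Finsupp.sum, Finset.mul_sum]
  rw [integral_finsetSum _ fun t _ => by
    have := (hi t).const_mul (φ t)
    refine this.congr (ae_of_all _ fun u => by ring)]
  refine Finset.sum_congr rfl fun t _ => ?_
  rw [fracInner_const_mul_right, fracInner_Icc_right h1 hf le_rfl t.coe_nonneg,
    ← integral_const_mul]
  congr 1
  ext u
  ring

lemma fracInner_indicator_stepFn (h1 : 1 / 2 < H) {t : ℝ} (ht : 0 ≤ t)
    (hf : BddSupp ((Set.Icc 0 t).indicator f)) (φ : StepFn) :
    fracInner H ((Set.Icc 0 t).indicator f) φ.eval = ∫ u in (0 : ℝ)..t, f u * stepKernel H φ u := by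
  rw [fracInner_stepFn h1 hf, intervalIntegral.integral_of_le ht, ← integral_Icc_eq_integral_Ioc,
    ← integral_indicator measurableSet_Icc]
  congr 1
  ext u
  by_cases hu : u ∈ Set.Icc 0 t <;> simp [hu]

/-- The `S`-transform of the white noise at a time `s > 0` is the derivative of `⟨1_{[0,t]}, φ⟩` at
`t = s`. Time `0` is excluded because nothing is known of `B` at negative times. -/
lemma whiteNoise_eq (hB : IsFBM H B P) (h1 : 1 / 2 < H) (h2 : H < 1) {s : ℝ} (hs : 0 < s)
    (φ : StepFn) : whiteNoise B P s φ = stepKernel H φ s := by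
  have h : ∀ r : ℝ, 0 ≤ r → sTransform B P (B r) φ = ∫ u in (0 : ℝ)..r, stepKernel H φ u := by
    intro r hr
    lift r to ℝ≥0 using hr
    have hw := isWienerIntegral_stepFn hB h1 h2 (Finsupp.single r 1)
    have e1 : StepFn.integral B (Finsupp.single r 1) = B r := by
      ext ω; rw [StepFn.integral_single, one_mul]
    have e2 : StepFn.eval (Finsupp.single r 1) = (Set.Icc 0 (r : ℝ)).indicator fun _ => 1 := by
      ext x; rw [StepFn.eval_single]
    have h3 := hw.sTransform_eq hB h1 h2 (bddSupp_stepFn _) φ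
    rw [e1, e2, fracInner_indicator_stepFn h1 r.coe_nonneg (bddSupp_Icc le_rfl 1)] at h3
    simpa using h3
  have hd : HasDerivAt (fun r => ∫ u in (0 : ℝ)..r, stepKernel H φ u) (stepKernel H φ s) s := by
    have hc := continuous_stepKernel h1 φ
    exact intervalIntegral.integral_hasDerivAt_right (hc.intervalIntegrable _ _)
      hc.aestronglyMeasurable.stronglyMeasurableAtFilter hc.continuousAt
  refine (hd.congr_of_eventuallyEq ?_).deriv
  filter_upwards [lt_mem_nhds hs] with r hr using h r hr.le

end

/-! ### Functionals of the noise are determined by their `S`-transform -/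

section

section Law

variable {Ω : Type*} {B : ℝ → Ω → ℝ}

lemma StepFn.integral_sum {ι : Type*} (I : Finset ι) (φ : ι → StepFn) (ω : Ω) :
    StepFn.integral B (∑ i ∈ I, φ i) ω = ∑ i ∈ I, (φ i).integral B ω := by
  classical
  induction I using Finset.induction_on with
  | empty => simp [StepFn.integral]
  | insert i I hi ih => rw [Finset.sum_insert hi, Finset.sum_insert hi, StepFn.integral_add, ih]

lemma noiseAlgebra_eq_comap :
    noiseAlgebra B = MeasurableSpace.comap (fun ω (t : ℝ≥0) => B t ω) MeasurableSpace.pi := by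
  simp only [noiseAlgebra, MeasurableSpace.pi, MeasurableSpace.comap_iSup,
    MeasurableSpace.comap_comp]
  rfl

/-- By the Cramér-Wold device, the laws of the linear combinations `B(φ)` determine the law of the
process `(B_t)_{t ≥ 0}`. -/
lemma map_process_eq [MeasurableSpace Ω] {μ μ' : Measure Ω} [IsFiniteMeasure μ] [IsFiniteMeasure μ']
    (hB : ∀ t : ℝ≥0, Measurable (B t))
    (h : ∀ φ : StepFn, μ.map (φ.integral B) = μ'.map (φ.integral B)) :
    μ.map (fun ω (t : ℝ≥0) => B t ω) = μ'.map (fun ω (t : ℝ≥0) => B t ω) := by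
  classical
  have hm : Measurable fun ω (t : ℝ≥0) => B t ω := measurable_pi_lambda _ hB
  have hr (J : Finset ℝ≥0) : Measurable (J.restrict (π := fun _ : ℝ≥0 => ℝ)) :=
    Finset.measurable_restrict J
  refine IsProjectiveLimit.unique
    (P := fun J : Finset ℝ≥0 => (μ.map fun ω (t : ℝ≥0) => B t ω).map J.restrict)
    (fun _ => rfl) fun J => ?_
  simp only [Measure.map_map (hr J) hm]
  refine Measure.ext_of_charFunDual (funext fun L => ?_)
  rw [charFunDual_eq_charFun_map_one, charFunDual_eq_charFun_map_one,
    Measure.map_map (by fun_prop) ((hr J).comp hm), Measure.map_map (by fun_prop) ((hr J).comp hm)]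
  have e : L ∘ J.restrict (π := fun _ : ℝ≥0 => ℝ) ∘ (fun ω (t : ℝ≥0) => B t ω)
      = StepFn.integral B (∑ t : J, Finsupp.single (t : ℝ≥0) (L (Pi.single t 1))) := by
    ext ω
    rw [StepFn.integral_sum]
    simp only [StepFn.integral_single, Function.comp_apply]
    have := L.toLinearMap.pi_apply_eq_sum_univ (J.restrict fun t : ℝ≥0 => B t ω)
    simp only [ContinuousLinearMap.coe_coe, Finset.restrict, smul_eq_mul] at this ⊢
    rw [this]
    refine Finset.sum_congr rfl fun t _ => ?_
    rw [mul_comm]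
    congr 2
    ext s
    simp [Pi.single_apply, eq_comm]
  rw [e, h]

end Law

variable {Ω : Type*} [MeasurableSpace Ω] {P : Measure Ω} [IsProbabilityMeasure P] {H : ℝ}
  {B : ℝ → Ω → ℝ} {F : Ω → ℝ}

lemma integral_mul_exp_stepIntegral_eq_zero (hB : IsFBM H B P) (h1 : 1 / 2 < H) (h2 : H < 1)
    (h : ∀ φ, sTransform B P F φ = 0) (φ : StepFn) :
    ∫ ω, F ω * Real.exp (φ.integral B ω) ∂P = 0 := by
  have h3 := h φ
  simp only [sTransform, wickExp_eq hB h1 h2, ← mul_div_assoc] at h3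
  rw [integral_div, integral_exp_stepIntegral hB h1 h2] at h3
  exact (div_eq_zero_iff.1 h3).resolve_right (Real.exp_pos _).ne'

/-- If the `S`-transform of `F` vanishes, then so does the signed measure of density `F` on
functionals of the noise: its positive and negative parts give the same moment generating function,
hence the same law, to every linear combination `B(φ)`. -/
lemma ae_eq_zero_of_sTransform_eq_zero_of_measurable (hB : IsFBM H B P) (h1 : 1 / 2 < H)
    (h2 : H < 1) (hF : MemLp F 2 P) (hFm : StronglyMeasurable[noiseAlgebra B] F)
    (h : ∀ φ, sTransform B P F φ = 0) : F =ᵐ[P] 0 := by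
  have hle := noiseAlgebra_le hB
  have hFm' : Measurable F := (hFm.mono hle).measurable
  have hFi : Integrable F P := hF.integrable (by norm_num)
  have hp (G : Ω → ℝ) (hG : Measurable G) (hGi : Integrable G P) :
      IsFiniteMeasure (P.withDensity fun ω => ENNReal.ofReal (G ω)) :=
    isFiniteMeasure_withDensity_ofReal hGi.2
  have := hp F hFm' hFi
  have := hp (fun ω => -F ω) hFm'.neg hFi.neg
  have hexp (φ : StepFn) (t : ℝ) :
      Integrable (fun ω => F ω * Real.exp (t * φ.integral B ω)) P ∧
        ∫ ω, F ω * Real.exp (t * φ.integral B ω) ∂P = 0 := by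
    have e1 := integrable_mul_exp_stepIntegral hB h1 h2 hF (t • φ)
    have e2 := integral_mul_exp_stepIntegral_eq_zero hB h1 h2 h (t • φ)
    simp only [StepFn.integral_smul] at e1 e2
    exact ⟨e1, e2⟩
  have hwd (G : Ω → ℝ) (hG : Measurable G) (g : Ω → ℝ) :
      ∫ ω, g ω ∂P.withDensity (fun ω => ENNReal.ofReal (G ω)) = ∫ ω, max (G ω) 0 * g ω ∂P := by
    rw [integral_withDensity_eq_integral_toReal_smul hG.ennreal_ofReal (by simp)]
    simp [ENNReal.toReal_ofReal']
  have hmax (G : Ω → ℝ) (hG : Measurable G) (φ : StepFn) (t : ℝ)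
      (hi : Integrable (fun ω => G ω * Real.exp (t * φ.integral B ω)) P) :
      Integrable (fun ω => max (G ω) 0 * Real.exp (t * φ.integral B ω)) P := by
    have hm := StepFn.measurable_integral hB φ
    refine hi.mono (by fun_prop) (ae_of_all _ fun ω => ?_)
    rw [norm_mul, norm_mul]
    gcongr
    rw [Real.norm_eq_abs, Real.norm_eq_abs, abs_of_nonneg (le_max_right _ _)]
    exact max_le (le_abs_self _) (abs_nonneg _)
  have hneg (φ : StepFn) (t : ℝ) :
      Integrable (fun ω => -F ω * Real.exp (t * φ.integral B ω)) P := by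
    simpa using (hexp φ t).1.neg
  have hmgf (φ : StepFn) : (P.withDensity fun ω => ENNReal.ofReal (F ω)).map (φ.integral B)
      = (P.withDensity fun ω => ENNReal.ofReal (-F ω)).map (φ.integral B) := by
    have hm := StepFn.measurable_integral hB φ
    refine map_eq_of_mgf_eq hm.aemeasurable hm.aemeasurable (funext fun t => ?_) fun t => ?_
    · rw [mgf, mgf, hwd F hFm', hwd (fun ω => -F ω) hFm'.neg, ← sub_eq_zero,
        ← integral_sub (hmax F hFm' φ t (hexp φ t).1)
          (hmax (fun ω => -F ω) hFm'.neg φ t (hneg φ t))]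
      refine Eq.trans ?_ (hexp φ t).2
      congr 1
      ext ω
      rw [← sub_mul]
      congr 1
      rcases le_total 0 (F ω) with h0 | h0
      · rw [max_eq_left h0, max_eq_right (by linarith), sub_zero]
      · rw [max_eq_right h0, max_eq_left (by linarith), zero_sub, neg_neg]
    · rw [integrable_withDensity_iff_integrable_smul' hFm'.ennreal_ofReal (by simp)]
      simpa [ENNReal.toReal_ofReal'] using hmax F hFm' φ t (hexp φ t).1
  have hBm (t : ℝ≥0) : Measurable (B t) := hB.measurable t t.coe_nonneg
  have hm : Measurable fun ω (t : ℝ≥0) => B t ω := measurable_pi_lambda _ hBm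
  have hproc := map_process_eq hBm hmgf
  refine ae_eq_of_forall_setIntegral_eq_of_sigmaFinite' hle (fun _ _ _ => hFi.integrableOn)
    (fun _ _ _ => integrableOn_zero) (fun A hA _ => ?_) hFm.aestronglyMeasurable
    (aestronglyMeasurable_const (b := (0 : ℝ)))
  have hA' : MeasurableSet A := hle A hA
  rw [noiseAlgebra_eq_comap] at hA
  obtain ⟨T, hT, rfl⟩ := hA
  have h3 := congrArg (fun ν => (ν T).toReal) hproc
  simp only [Measure.map_apply hm hT, withDensity_apply _ hA'] at h3
  rw [integral_eq_lintegral_pos_part_sub_lintegral_neg_part hFi.integrableOn, h3]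
  simp

/-- The `S`-transform is injective on square integrable functionals of the noise. -/
lemma ae_eq_zero_of_sTransform_eq_zero (hB : IsFBM H B P) (h1 : 1 / 2 < H)
    (h2 : H < 1) (hF : MemL2Noise B P F) (h : ∀ φ, sTransform B P F φ = 0) : F =ᵐ[P] 0 := by
  obtain ⟨hF2, G, hG, hFG⟩ := hF
  refine hFG.trans (ae_eq_zero_of_sTransform_eq_zero_of_measurable hB h1 h2
    ((memLp_congr_ae hFG).1 hF2) hG fun φ => ?_)
  rw [← h φ]
  refine integral_congr_ae ?_
  filter_upwards [hFG] with ω hω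
  rw [hω]

/-! ### The solution of the diffusion equation -/

lemma IsWienerIntegral.memL2Noise_exp (hB : IsFBM H B P) (h1 : 1 / 2 < H) (h2 : H < 1)
    {f : ℝ → ℝ} {I : Ω → ℝ} (hf : BddSupp f) (hI : IsWienerIntegral H B P f I) (c : ℝ) :
    MemL2Noise B P fun ω => Real.exp (I ω - c) := by
  have hm := (hI.memL2Noise hB).2
  refine ⟨(memLp_two_iff_integrable_sq ?_).2 ?_, ?_⟩
  · have := hI.aemeasurable
    exact AEMeasurable.aestronglyMeasurable (by fun_prop)
  · refine ((hI.integrable_exp hB h1 h2 hf 2).mul_const (Real.exp (-2 * c))).congr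
      (ae_of_all _ fun ω => ?_)
    simp only
    rw [← Real.exp_add, ← Real.exp_nat_mul]
    congr 1
    push_cast
    ring
  · have hc : Continuous fun x : ℝ => Real.exp (x - c) := by fun_prop
    exact hc.comp_aestronglyMeasurable hm

variable {σ : ℝ → ℝ} {C s₀ : ℝ} {S : ℝ → Ω → ℝ}

lemma IsWISSolution.memL2Noise (hS : IsWISSolution B P (fun _ => 0) σ s₀ 1 S)
    {t : ℝ} (ht : t ∈ Set.Icc (0 : ℝ) 1) : MemL2Noise B P (S t) := by
  obtain ⟨Φ, ⟨-, hΦ, -⟩, hae⟩ := hS t ht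
  have e : (fun ω => s₀ + Φ ω) =ᵐ[P] S t := by
    filter_upwards [hae] with ω hω
    rw [hω.2]
    simp
  exact ⟨(memLp_congr_ae e).1 ((memLp_const s₀).add hΦ.1),
    ((aestronglyMeasurable_const (b := s₀)).add hΦ.2).congr e⟩

/-- The `S`-transform turns the stochastic equation into a linear integral equation, hence it is an
exponential. -/
lemma IsWISSolution.sTransform_eq (hB : IsFBM H B P) (h1 : 1 / 2 < H) (h2 : H < 1)
    (hσ_meas : AEMeasurable σ (volume.restrict (Set.Icc (0 : ℝ) 1)))
    (hC : ∀ t ∈ Set.Icc (0 : ℝ) 1, |σ t| ≤ C)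
    (hS : IsWISSolution B P (fun _ => 0) σ s₀ 1 S) (φ : StepFn) {t : ℝ}
    (ht : t ∈ Set.Icc (0 : ℝ) 1) :
    sTransform B P (S t) φ = s₀ * Real.exp (∫ u in (0 : ℝ)..t, σ u * stepKernel H φ u) := by
  have hw := continuous_stepKernel h1 φ
  obtain ⟨D, hD⟩ := isCompact_Icc.exists_bound_of_continuousOn (s := Set.Icc (0 : ℝ) 1)
    hw.continuousOn
  simp only [Real.norm_eq_abs] at hD
  have hK (u : ℝ) (hu : u ∈ Set.Icc (0 : ℝ) 1) : |σ u * stepKernel H φ u| ≤ C * D := by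
    rw [abs_mul]
    exact mul_le_mul (hC u hu) (hD u hu) (abs_nonneg _) ((abs_nonneg _).trans (hC u hu))
  have hcongr (t : ℝ) (ht : t ∈ Set.Icc (0 : ℝ) 1) : ∀ u ∈ Set.uIoc 0 t,
      sTransform B P (fun ω => σ u * S u ω) φ * whiteNoise B P u φ
        = σ u * stepKernel H φ u * sTransform B P (S u) φ := by
    intro u hu
    rw [Set.uIoc_of_le ht.1] at hu
    rw [sTransform_const_mul, whiteNoise_eq hB h1 h2 hu.1]
    ring
  refine eq_mul_exp_of_integral_eq (K := C * D) (g := fun t => sTransform B P (S t) φ) hK ?_ ?_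
    (fun t ht => ?_) t ht
  · rw [intervalIntegrable_iff, Set.uIoc_of_le zero_le_one, IntegrableOn]
    refine Integrable.of_bound (C := C * D) ?_ ?_
    · have := hσ_meas.mono_measure (Measure.restrict_mono Set.Ioc_subset_Icc_self le_rfl)
      exact (this.mul hw.measurable.aemeasurable).aestronglyMeasurable
    · filter_upwards [ae_restrict_mem measurableSet_Ioc] with u hu
      exact hK u (Set.Ioc_subset_Icc_self hu)
  · obtain ⟨Φ, ⟨-, -, hΦ⟩, -⟩ := hS 1 (by simp)
    exact IntervalIntegrable.congr (hcongr 1 (by simp)) (hΦ φ).1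
  · obtain ⟨Φ, ⟨-, hΦ2, hΦ⟩, hae⟩ := hS t ht
    have e : S t =ᵐ[P] fun ω => s₀ + Φ ω := by
      filter_upwards [hae] with ω hω
      rw [hω.2]
      simp
    have e2 : sTransform B P (S t) φ = sTransform B P (fun ω => s₀ + Φ ω) φ := by
      refine integral_congr_ae ?_
      filter_upwards [e] with ω hω
      rw [hω]
    rw [e2, sTransform_add hB h1 h2 (memLp_const s₀) hΦ2.1, sTransform_const hB h1 h2,
      (hΦ φ).2, intervalIntegral.integral_congr_ae (ae_of_all _ (hcongr t ht))]

/-- The solution of the diffusion equation without drift is the Wick exponential of the Wiener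
integral of `σ`. -/
theorem IsWISSolution.ae_eq_exp (hB : IsFBM H B P) (h1 : 1 / 2 < H) (h2 : H < 1)
    (hσ_meas : AEMeasurable σ (volume.restrict (Set.Icc (0 : ℝ) 1)))
    (hC : ∀ t ∈ Set.Icc (0 : ℝ) 1, |σ t| ≤ C)
    (hS : IsWISSolution B P (fun _ => 0) σ s₀ 1 S) {t : ℝ} (ht : t ∈ Set.Icc (0 : ℝ) 1)
    {f : ℝ → ℝ} {I : Ω → ℝ} (hf : BddSupp f) (hfσ : f =ᵐ[volume] (Set.Icc 0 t).indicator σ)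
    (hI : IsWienerIntegral H B P f I) :
    S t =ᵐ[P] fun ω => s₀ * Real.exp (I ω - fracInner H f f / 2) := by
  have hσ' : BddSupp (unitPart σ) := bddSupp_unitPart hσ_meas hC
  have hE := hI.memL2Noise_exp hB h1 h2 hf (fracInner H f f / 2)
  have hSt := hS.memL2Noise ht
  have hind : (Set.Icc 0 t).indicator σ = (Set.Icc 0 t).indicator (unitPart σ) := by
    ext u
    by_cases hu : u ∈ Set.Icc 0 t
    · have : u ∈ Set.Icc (0 : ℝ) 1 := ⟨hu.1, hu.2.trans ht.2⟩
      simp only [unitPart]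
      rw [Set.indicator_of_mem hu, Set.indicator_of_mem hu, Set.indicator_of_mem this]
    · simp [hu]
  have hE' : MemLp (fun ω => (-s₀) * Real.exp (I ω - fracInner H f f / 2)) 2 P := hE.1.const_mul _
  have hD : (fun ω => S t ω + (-s₀) * Real.exp (I ω - fracInner H f f / 2)) =ᵐ[P] 0 := by
    refine ae_eq_zero_of_sTransform_eq_zero hB h1 h2
      ⟨hSt.1.add hE', hSt.2.add (hE.2.const_mul _)⟩ fun φ => ?_
    rw [sTransform_add hB h1 h2 hSt.1 hE', sTransform_const_mul, hI.sTransform_exp hB h1 h2 hf,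
      hS.sTransform_eq hB h1 h2 hσ_meas hC φ ht, fracInner_congr_ae hfσ (ae_eq_refl _), hind,
      fracInner_indicator_stepFn h1 ht.1 (bddSupp_indicator hσ' measurableSet_Icc)]
    have : ∫ u in (0 : ℝ)..t, unitPart σ u * stepKernel H φ u
        = ∫ u in (0 : ℝ)..t, σ u * stepKernel H φ u := by
      refine intervalIntegral.integral_congr fun u hu => ?_
      rw [Set.uIcc_of_le ht.1] at hu
      simp only [unitPart]
      rw [Set.indicator_of_mem (show u ∈ Set.Icc (0 : ℝ) 1 from ⟨hu.1, hu.2.trans ht.2⟩)]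
    rw [this]
    ring
  filter_upwards [hD] with ω hω
  have : S t ω + (-s₀) * Real.exp (I ω - fracInner H f f / 2) = 0 := hω
  linarith

end

/-! ### Log-increments of the stock price -/

section

lemma sum_cellOne_ae_eq (N n : ℕ) :
    (fun x => ∑ i ∈ Finset.range n, cellOne N i x) =ᵐ[volume]
      (Set.Icc 0 ((n : ℝ) / N)).indicator fun _ => 1 := by
  induction n with
  | zero =>
    filter_upwards [compl_mem_ae_iff.2 (measure_singleton (0 : ℝ))] with x hx
    have hx : x ≠ 0 := hx
    simp [hx]
  | succ n ih =>
    filter_upwards [ih, cellOne_ae_eq (N := N) (m := n) (by positivity)] with x h1 h2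
    rw [Finset.sum_range_succ, h1, h2]
    push_cast
    ring

lemma volPiece_eq_cellOne_mul (σ : ℝ → ℝ) (N k : ℕ) (x : ℝ) :
    volPiece σ N k x = cellOne N k x * σ x := by
  by_cases hx : x ∈ cell N k
  · have hx' : x ∈ Set.Icc ((k : ℝ) / N) (((k : ℝ) + 1) / N) := hx
    rw [volPiece, cellOne, Set.indicator_of_mem hx, Set.indicator_of_mem hx', one_mul]
  · have hx' : x ∉ Set.Icc ((k : ℝ) / N) (((k : ℝ) + 1) / N) := hx
    rw [volPiece, cellOne, Set.indicator_of_notMem hx, Set.indicator_of_notMem hx', zero_mul]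

lemma sum_volPiece_ae_eq (σ : ℝ → ℝ) (N n : ℕ) :
    (fun x => ∑ i ∈ Finset.range n, volPiece σ N i x) =ᵐ[volume]
      (Set.Icc 0 ((n : ℝ) / N)).indicator σ := by
  filter_upwards [sum_cellOne_ae_eq N n] with x hx
  simp only [volPiece_eq_cellOne_mul, ← Finset.sum_mul]
  rw [hx]
  by_cases h : x ∈ Set.Icc 0 ((n : ℝ) / N)
  · rw [Set.indicator_of_mem h, Set.indicator_of_mem h, one_mul]
  · rw [Set.indicator_of_notMem h, Set.indicator_of_notMem h, zero_mul]

variable {H C : ℝ} {σ : ℝ → ℝ}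

lemma bddSupp_volPiece (hσ : BddSupp (unitPart σ)) {N k : ℕ} (hk : k < N) :
    BddSupp (volPiece σ N k) := by
  rw [volPiece_eq_indicator σ hk]
  exact bddSupp_indicator hσ (measurableSet_cell N k)

lemma volPiece_eq_zero {N k : ℕ} (hk : k < N) {x : ℝ} (hx : x ∉ Set.Icc (0 : ℝ) 1) :
    volPiece σ N k x = 0 := by
  rw [volPiece_eq_indicator σ hk]
  by_cases h : x ∈ cell N k
  · rw [Set.indicator_of_mem h, unitPart, Set.indicator_of_notMem hx]
  · rw [Set.indicator_of_notMem h]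

/-- The row sums of the covariance matrix of the Wiener integrals of the pieces of `σ` are of the
order of the mesh of the grid. -/
lemma sum_abs_fracInner_volPiece_le (h1 : 1 / 2 < H) (h2 : H < 1)
    (hC : ∀ t ∈ Set.Icc (0 : ℝ) 1, |σ t| ≤ C) {N k : ℕ} (hk : k < N) :
    ∑ i ∈ Finset.range N, |fracInner H (volPiece σ N i) (volPiece σ N k)|
      ≤ 2 * H * C ^ 2 / N := by
  have hN : (0 : ℝ) < N := by exact_mod_cast (Nat.zero_le k).trans_lt hk
  have hcell (i : ℕ) : BddSupp (cellOne N i) := bddSupp_cellOne N (by positivity)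
  have hone : (Set.Icc 0 ((N : ℝ) / N)) = Set.Icc (0 : ℝ) 1 := by rw [div_self hN.ne']
  have hint : ∫ u, cellOne N k u = 1 / N := by
    rw [cellOne, integral_indicator (measurableSet_cell N k), setIntegral_const, smul_eq_mul,
      mul_one,
      cell, Real.volume_real_Icc_of_le (by gcongr; linarith), cell_length]
  calc ∑ i ∈ Finset.range N, |fracInner H (volPiece σ N i) (volPiece σ N k)|
      ≤ ∑ i ∈ Finset.range N, C * C * fracInner H (cellOne N i) (cellOne N k) := by
        refine Finset.sum_le_sum fun i hi => ?_
        rw [volPiece_eq_indicator σ hk, volPiece_eq_indicator σ (Finset.mem_range.1 hi)]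
        exact abs_fracInner_le h1 (hcell i) (hcell k)
          (abs_indicator_cell_le (abs_unitPart_le hC) N i)
          (abs_indicator_cell_le (abs_unitPart_le hC) N k)
    _ = C * C * fracInner H (cellOne N k) ((Set.Icc (0 : ℝ) 1).indicator fun _ => 1) := by
        rw [← Finset.mul_sum, ← fracInner_sum_left h1 _ (fun i _ => hcell i) (hcell k),
          fracInner_congr_ae (sum_cellOne_ae_eq N N) (ae_eq_refl _), hone, fracInner_comm]
    _ = C * C * ∫ u, cellOne N k u * cellKernel H 0 1 u := by
        rw [fracInner_Icc_right h1 (hcell k) le_rfl zero_le_one]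
    _ ≤ C * C * ∫ u, cellOne N k u * (2 * H) := by
        refine mul_le_mul_of_nonneg_left ?_ (mul_self_nonneg C)
        refine integral_mono ((hcell k).integrable_mul fun T =>
          (continuous_cellKernel h1 _ _).integrableOn_Icc) ((hcell k).integrable.mul_const _)
          fun u => ?_
        have := cellKernel_le h1 h2 zero_le_one u
        rw [sub_zero, Real.one_rpow, mul_one] at this
        exact mul_le_mul_of_nonneg_left this (cellOne_nonneg N k u)
    _ = 2 * H * C ^ 2 / N := by
        rw [integral_mul_const, hint]
        ring

/-- Half the increment over the `k`-th cell of the variance of the Wiener integral of `σ`: the Itô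
correction in the log-increments. -/
noncomputable def itoCorrection (H : ℝ) (σ : ℝ → ℝ) (N k : ℕ) : ℝ :=
  fracInner H (fun x => ∑ i ∈ Finset.range k, volPiece σ N i x) (volPiece σ N k)
    + fracInner H (volPiece σ N k) (volPiece σ N k) / 2

lemma fracInner_sum_volPiece_succ (h1 : 1 / 2 < H) (hσ : BddSupp (unitPart σ)) {N k : ℕ}
    (hk : k < N) :
    fracInner H (fun x => ∑ i ∈ Finset.range (k + 1), volPiece σ N i x)
        (fun x => ∑ i ∈ Finset.range (k + 1), volPiece σ N i x)
      = fracInner H (fun x => ∑ i ∈ Finset.range k, volPiece σ N i x)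
        (fun x => ∑ i ∈ Finset.range k, volPiece σ N i x) + 2 * itoCorrection H σ N k := by
  have hF : BddSupp fun x => ∑ i ∈ Finset.range k, volPiece σ N i x :=
    BddSupp.sum _ fun i hi => bddSupp_volPiece hσ ((Finset.mem_range.1 hi).trans hk)
  have hf := bddSupp_volPiece hσ hk
  simp only [Finset.sum_range_succ, itoCorrection]
  rw [fracInner_add_left h1 hF hf (hF.add hf), fracInner_add_right h1 hF hf hF,
    fracInner_add_right h1 hF hf hf, fracInner_comm (volPiece σ N k)
      (fun x => ∑ i ∈ Finset.range k, volPiece σ N i x)]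
  ring

/-- An Itô correction is half the difference of two squared norms, a sum of covariances in one row
and hence of order `1/N`. -/
lemma abs_itoCorrection_le (h1 : 1 / 2 < H) (h2 : H < 1) (hσ : BddSupp (unitPart σ))
    (hC : ∀ t ∈ Set.Icc (0 : ℝ) 1, |σ t| ≤ C) {N k : ℕ} (hk : k < N) :
    |itoCorrection H σ N k| ≤ 2 * H * C ^ 2 / N := by
  refine le_trans ?_ (sum_abs_fracInner_volPiece_le h1 h2 hC hk)
  have hsub : Finset.range (k + 1) ⊆ Finset.range N := Finset.range_subset_range.2 hk
  refine le_trans ?_ (Finset.sum_le_sum_of_subset_of_nonneg hsub fun _ _ _ => abs_nonneg _)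
  rw [Finset.sum_range_succ, itoCorrection, fracInner_sum_left h1 _
    (fun i hi => bddSupp_volPiece hσ ((Finset.mem_range.1 hi).trans hk)) (bddSupp_volPiece hσ hk)]
  refine (abs_add_le _ _).trans (add_le_add (Finset.abs_sum_le_sum_abs _ _) ?_)
  rw [abs_div, abs_of_pos (zero_lt_two (α := ℝ))]
  exact half_le_self (abs_nonneg _)

variable {Ω : Type*} [MeasurableSpace Ω] {P : Measure Ω} {B : ℝ → Ω → ℝ} {s₀ : ℝ}
  {S : ℝ → Ω → ℝ}

lemma isWienerIntegral_volPiece (hB : IsFBM H B P) (h1 : 1 / 2 < H) (h2 : H < 1)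
    (hσ : BddSupp (unitPart σ)) {N k : ℕ} (hk : k < N) :
    IsWienerIntegral H B P (volPiece σ N k) (wienerIntegral H B P (volPiece σ N k)) :=
  wienerIntegral_spec hB h1 h2 (bddSupp_volPiece hσ hk) fun _ hx => volPiece_eq_zero hk hx

variable [IsProbabilityMeasure P]

lemma log_stock_ae_eq (hB : IsFBM H B P) (h1 : 1 / 2 < H) (h2 : H < 1)
    (hσ_meas : AEMeasurable σ (volume.restrict (Set.Icc (0 : ℝ) 1)))
    (hC : ∀ t ∈ Set.Icc (0 : ℝ) 1, |σ t| ≤ C) (hs₀ : 0 < s₀)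
    (hS : IsWISSolution B P (fun _ => 0) σ s₀ 1 S) {N n : ℕ} (hN : 0 < N) (hn : n ≤ N) :
    (fun ω => Real.log (S ((n : ℝ) / N) ω)) =ᵐ[P] fun ω => Real.log s₀
      + ((∑ i ∈ Finset.range n, wienerIntegral H B P (volPiece σ N i) ω)
        - fracInner H (fun x => ∑ i ∈ Finset.range n, volPiece σ N i x)
          (fun x => ∑ i ∈ Finset.range n, volPiece σ N i x) / 2) := by
  have hσ := bddSupp_unitPart hσ_meas hC
  have hN' : (0 : ℝ) < N := by exact_mod_cast hN
  have hlt {i : ℕ} (hi : i ∈ Finset.range n) : i < N := (Finset.mem_range.1 hi).trans_le hn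
  have ht : (n : ℝ) / N ∈ Set.Icc (0 : ℝ) 1 :=
    ⟨by positivity, (div_le_one hN').2 (by exact_mod_cast hn)⟩
  filter_upwards [hS.ae_eq_exp hB h1 h2 hσ_meas hC ht
    (BddSupp.sum _ fun i hi => bddSupp_volPiece hσ (hlt hi)) (sum_volPiece_ae_eq σ N n)
    (IsWienerIntegral.sum hB h1 h2 _ (fun i hi => bddSupp_volPiece hσ (hlt hi))
      fun i hi => isWienerIntegral_volPiece hB h1 h2 hσ (hlt hi))] with ω hω
  rw [hω, Real.log_mul hs₀.ne' (Real.exp_pos _).ne', Real.log_exp]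

/-- The logarithm of the Wick exponential is additive up to the deterministic Itô correction. -/
lemma log_increment_ae_eq (hB : IsFBM H B P) (h1 : 1 / 2 < H) (h2 : H < 1)
    (hσ_meas : AEMeasurable σ (volume.restrict (Set.Icc (0 : ℝ) 1)))
    (hC : ∀ t ∈ Set.Icc (0 : ℝ) 1, |σ t| ≤ C) (hs₀ : 0 < s₀)
    (hS : IsWISSolution B P (fun _ => 0) σ s₀ 1 S) {N k : ℕ} (hk : k < N) :
    (fun ω => Real.log (S (((k : ℝ) + 1) / N) ω) - Real.log (S ((k : ℝ) / N) ω)) =ᵐ[P]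
      fun ω => wienerIntegral H B P (volPiece σ N k) ω - itoCorrection H σ N k := by
  have hN : 0 < N := (Nat.zero_le k).trans_lt hk
  filter_upwards [log_stock_ae_eq hB h1 h2 hσ_meas hC hs₀ hS hN hk.le,
    log_stock_ae_eq hB h1 h2 hσ_meas hC hs₀ hS hN (Nat.succ_le_of_lt hk)] with ω e1 e2
  rw [Nat.succ_eq_add_one] at e2
  rw [fracInner_sum_volPiece_succ h1 (bddSupp_unitPart hσ_meas hC) hk, Finset.sum_range_succ] at e2
  push_cast at e2
  rw [e1, e2]
  ring

/-! ### Asymptotic normality of the estimator -/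

/-- The centred quadratic form in the Wiener integrals `η_k` that carries the fluctuations of the
estimator. -/
noncomputable def mainTerm (H : ℝ) (B : ℝ → Ω → ℝ) (P : Measure Ω) (σ : ℝ → ℝ) (N : ℕ)
    (ω : Ω) : ℝ :=
  √(N : ℝ) * (N : ℝ) ^ (2 * H - 1) * ∑ k : Fin N, (wienerIntegral H B P (volPiece σ N k) ω ^ 2
    - ∫ ω, wienerIntegral H B P (volPiece σ N k) ω ^ 2 ∂P)

lemma integral_wienerIntegral_volPiece_mul (hB : IsFBM H B P) (h1 : 1 / 2 < H) (h2 : H < 1)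
    (hσ : BddSupp (unitPart σ)) {N i j : ℕ} (hi : i < N) (hj : j < N) :
    ∫ ω, wienerIntegral H B P (volPiece σ N i) ω * wienerIntegral H B P (volPiece σ N j) ω ∂P
      = fracInner H (volPiece σ N i) (volPiece σ N j) :=
  (isWienerIntegral_volPiece hB h1 h2 hσ hi).integral_mul hB h1 h2 (bddSupp_volPiece hσ hi)
    (bddSupp_volPiece hσ hj) (isWienerIntegral_volPiece hB h1 h2 hσ hj)

lemma tendsto_rpow_natCast_zero {e : ℝ} (he : e < 0) (K : ℝ) :
    Tendsto (fun N : ℕ => K * (N : ℝ) ^ e) atTop (𝓝 0) := by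
  have := (tendsto_rpow_neg_atTop (neg_pos.2 he)).comp tendsto_natCast_atTop_atTop
  simpa [Function.comp_def] using this.const_mul K

lemma tendstoInDistribution_mainTerm (hB : IsFBM H B P) (h1 : 1 / 2 < H) (h2 : H < 3 / 4)
    (hσ : BddSupp (unitPart σ)) (hC : ∀ t ∈ Set.Icc (0 : ℝ) 1, |σ t| ≤ C) {v : ℝ≥0}
    (hv : Tendsto (approxVariance H σ) atTop (𝓝 (v : ℝ))) :
    TendstoInDistribution (mainTerm H B P σ) atTop (id : ℝ → ℝ) (fun _ => P)
      (gaussianReal 0 v) := by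
  have h3 : H < 1 := by linarith
  have hw (N : ℕ) (k : Fin N) := isWienerIntegral_volPiece hB h1 h3 hσ k.2
  have hb (N : ℕ) (k : Fin N) : BddSupp (volPiece σ N k) := bddSupp_volPiece hσ k.2
  have hmul (N : ℕ) (i j : Fin N) := integral_wienerIntegral_volPiece_mul hB h1 h3 hσ i.2 j.2
  refine tendstoInDistribution_quadraticForm
    (ξ := fun N (k : Fin N) => wienerIntegral H B P (volPiece σ N k))
    (r := fun N : ℕ => 2 * H * C ^ 2 * (N : ℝ) ^ (2 * H - 3 / 2))
    (fun N => hasGaussianLaw_wienerIntegral_pi hB h1 h3 (hb N) (hw N))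
    (fun N k => (hw N k).integral_eq_zero hB h1 h3 (hb N k)) ?_ (fun N i => ?_)
    (tendsto_rpow_natCast_zero (by linarith) _)
  · refine hv.congr' ?_
    filter_upwards [eventually_gt_atTop 0] with N hN
    have hN' : (0 : ℝ) < N := by exact_mod_cast hN
    have e : 2 * (√(N : ℝ) * (N : ℝ) ^ (2 * H - 1)) ^ 2 = (N : ℝ) ^ (4 * H - 1) * 2 := by
      rw [mul_pow, Real.sq_sqrt hN'.le, ← Real.rpow_natCast, ← Real.rpow_mul hN'.le]
      nth_rewrite 1 [← Real.rpow_one (N : ℝ)]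
      rw [← Real.rpow_add hN', mul_comm]
      congr 2
      push_cast
      ring
    rw [e, approxVariance, mul_assoc, Finset.sum_range]
    congr 2
    refine Finset.sum_congr rfl fun i _ => ?_
    rw [Finset.sum_range]
    refine Finset.sum_congr rfl fun j _ => ?_
    rw [hmul, integral_opM_mul h1 h3 (hb N i) (hb N j)]
  · have hN' : (0 : ℝ) < N := by exact_mod_cast (Nat.zero_le _).trans_lt i.2
    simp only [hmul]
    have hsum : ∑ j : Fin N, |fracInner H (volPiece σ N i) (volPiece σ N j)|
        ≤ 2 * H * C ^ 2 / N := by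
      rw [← Finset.sum_range fun j => |fracInner H (volPiece σ N i) (volPiece σ N j)|]
      simp_rw [fracInner_comm (volPiece σ N i)]
      exact sum_abs_fracInner_volPiece_le h1 h3 hC i.2
    rw [abs_of_nonneg (by positivity)]
    refine (mul_le_mul_of_nonneg_left hsum (by positivity)).trans_eq ?_
    rw [Real.sqrt_eq_rpow, show 2 * H - 3 / 2 = 1 / 2 + (2 * H - 1) - 1 by ring,
      Real.rpow_sub_one hN'.ne' (1 / 2 + (2 * H - 1)), Real.rpow_add hN']
    ring

/-- Up to the Itô corrections, the normalized error of the estimator is the main term. -/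
lemma sqrt_mul_volEstimator_sub_ae_eq (hB : IsFBM H B P) (h1 : 1 / 2 < H) (h2 : H < 1)
    (hσ_meas : AEMeasurable σ (volume.restrict (Set.Icc (0 : ℝ) 1)))
    (hC : ∀ t ∈ Set.Icc (0 : ℝ) 1, |σ t| ≤ C) (hs₀ : 0 < s₀)
    (hS : IsWISSolution B P (fun _ => 0) σ s₀ 1 S) (N : ℕ) :
    (fun ω => √(N : ℝ) * (volEstimator H S N ω - thetaTilde H B P σ N)) =ᵐ[P] fun ω =>
      mainTerm H B P σ N ω + √(N : ℝ) * (N : ℝ) ^ (2 * H - 1) *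
        (∑ k : Fin N, itoCorrection H σ N k ^ 2
          - 2 * ∑ k : Fin N, itoCorrection H σ N k * wienerIntegral H B P (volPiece σ N k) ω) := by
  rcases N.eq_zero_or_pos with rfl | hN
  · simp [mainTerm]
  have hN' : (0 : ℝ) < N := by exact_mod_cast hN
  have hinc : ∀ᵐ ω ∂P, ∀ k : Fin N,
      Real.log (S (((k : ℝ) + 1) / N) ω) - Real.log (S ((k : ℝ) / N) ω)
        = wienerIntegral H B P (volPiece σ N k) ω - itoCorrection H σ N k :=
    ae_all_iff.2 fun k => log_increment_ae_eq hB h1 h2 hσ_meas hC hs₀ hS k.2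
  filter_upwards [hinc] with ω hω
  have e1 : 1 / ((N : ℝ) * (1 / (N : ℝ)) ^ (2 * H)) = (N : ℝ) ^ (2 * H - 1) := by
    rw [Real.rpow_sub_one hN'.ne', one_div (N : ℝ), Real.inv_rpow hN'.le]
    field_simp
  have e2 : (1 / (N : ℝ)) ^ (-2 * H + 1) = (N : ℝ) ^ (2 * H - 1) := by
    rw [one_div, Real.inv_rpow hN'.le, ← Real.rpow_neg hN'.le]
    congr 1
    ring
  rw [volEstimator, thetaTilde, mainTerm, e1, e2, Finset.sum_range, Finset.sum_range,
    ← Finset.mul_sum, mul_assoc √(N : ℝ), mul_assoc √(N : ℝ), ← mul_add, ← mul_sub, ← mul_add,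
    Finset.mul_sum Finset.univ _ (2 : ℝ), ← Finset.sum_sub_distrib, ← Finset.sum_sub_distrib,
    ← Finset.sum_add_distrib]
  congr 2
  refine Finset.sum_congr rfl fun k _ => ?_
  rw [hω]
  ring

/-- The contribution of the Itô corrections to the normalized error is negligible in `L²`. -/
lemma tendsto_eLpNorm_remainder (hB : IsFBM H B P) (h1 : 1 / 2 < H) (h2 : H < 3 / 4)
    (hσ : BddSupp (unitPart σ)) (hC : ∀ t ∈ Set.Icc (0 : ℝ) 1, |σ t| ≤ C) :
    Tendsto (fun N : ℕ => eLpNorm (fun ω => √(N : ℝ) * (N : ℝ) ^ (2 * H - 1) *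
        (∑ k : Fin N, itoCorrection H σ N k ^ 2
          - 2 * ∑ k : Fin N, itoCorrection H σ N k * wienerIntegral H B P (volPiece σ N k) ω)) 2 P)
      atTop (𝓝 0) := by
  have h3 : H < 1 := by linarith
  set K := 2 * H * C ^ 2 with hK
  have hK0 : 0 ≤ K := by positivity
  have hw (N : ℕ) (k : Fin N) := isWienerIntegral_volPiece hB h1 h3 hσ k.2
  have hlin (N : ℕ) : MemLp (fun ω => ∑ k : Fin N,
      itoCorrection H σ N k * wienerIntegral H B P (volPiece σ N k) ω) 2 P :=
    memLp_finsetSum _ fun k _ => (hw N k).1.const_mul _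
  have hlin_sq (N : ℕ) (hN : 0 < N) : ∫ ω, (∑ k : Fin N,
      itoCorrection H σ N k * wienerIntegral H B P (volPiece σ N k) ω) ^ 2 ∂P ≤ K ^ 3 / N ^ 2 := by
    have hi (k : Fin N) : |itoCorrection H σ N k| ≤ K / N := abs_itoCorrection_le h1 h3 hσ hC k.2
    have hb (k : Fin N) := bddSupp_volPiece hσ k.2
    have hN' : (0 : ℝ) < N := by exact_mod_cast hN
    have hW := IsWienerIntegral.sum hB h1 h3 (Finset.univ : Finset (Fin N))
      (fun k _ => (hb k).const_mul (itoCorrection H σ N k))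
      fun k _ => (hw N k).const_mul h1 h3 (hb k) (itoCorrection H σ N k)
    have hbs : BddSupp fun x => ∑ k : Fin N, itoCorrection H σ N k * volPiece σ N k x :=
      BddSupp.sum _ fun k _ => (hb k).const_mul _
    rw [hW.integral_sq hB h1 h3 hbs,
      fracInner_sum_left h1 _ (fun k _ => (hb k).const_mul _) hbs]
    calc _ ≤ ∑ k : Fin N, (K / N) ^ 2 * (K / N) := Finset.sum_le_sum fun k _ => ?_
      _ = K ^ 3 / N ^ 2 := by
          rw [Finset.sum_const, Finset.card_univ, Fintype.card_fin, nsmul_eq_mul]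
          field_simp
    rw [fracInner_const_mul_left, fracInner_comm, fracInner_sum_left h1 _
      (fun i _ => (hb i).const_mul _) (hb k)]
    refine (le_abs_self _).trans ?_
    rw [abs_mul]
    calc _ ≤ |itoCorrection H σ N k| *
          ∑ i : Fin N, K / N * |fracInner H (volPiece σ N i) (volPiece σ N k)| := by
          refine mul_le_mul_of_nonneg_left ((Finset.abs_sum_le_sum_abs _ _).trans
            (Finset.sum_le_sum fun i _ => ?_)) (abs_nonneg _)
          rw [fracInner_const_mul_left, abs_mul]
          exact mul_le_mul_of_nonneg_right (hi i) (abs_nonneg _)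
      _ ≤ K / N * (K / N * (K / N)) := by
          refine mul_le_mul (hi k) ?_ (Finset.sum_nonneg fun i _ => by positivity) (by positivity)
          rw [← Finset.mul_sum,
            ← Finset.sum_range fun i => |fracInner H (volPiece σ N i) (volPiece σ N k)|]
          exact mul_le_mul_of_nonneg_left (sum_abs_fracInner_volPiece_le h1 h3 hC k.2)
            (by positivity)
      _ = _ := by ring
  have hsq (N : ℕ) (hN : 0 < N) : ∑ k : Fin N, itoCorrection H σ N k ^ 2 ≤ K ^ 2 / N := by
    have hN' : (0 : ℝ) < N := by exact_mod_cast hN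
    calc _ ≤ ∑ k : Fin N, (K / N) ^ 2 := Finset.sum_le_sum fun k _ => by
          rw [← sq_abs]
          exact pow_le_pow_left₀ (abs_nonneg _) (abs_itoCorrection_le h1 h3 hσ hC k.2) 2
      _ = _ := by
          rw [Finset.sum_const, Finset.card_univ, Fintype.card_fin, nsmul_eq_mul]
          field_simp
  have hmem (N : ℕ) : MemLp (fun ω => √(N : ℝ) * (N : ℝ) ^ (2 * H - 1) *
      (∑ k : Fin N, itoCorrection H σ N k ^ 2 - 2 * ∑ k : Fin N,
        itoCorrection H σ N k * wienerIntegral H B P (volPiece σ N k) ω)) 2 P :=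
    ((memLp_const _).sub ((hlin N).const_mul 2)).const_mul _
  simp only [fun N => eLpNorm_two_eq (hmem N)]
  rw [show (0 : ℝ≥0∞) = ENNReal.ofReal √0 by simp]
  refine ENNReal.tendsto_ofReal (Real.continuous_sqrt.continuousAt.tendsto.comp ?_)
  refine squeeze_zero' (Eventually.of_forall fun N => integral_nonneg fun ω => sq_nonneg _) ?_
    (tendsto_rpow_natCast_zero (e := 4 * H - 3) (by linarith) (2 * K ^ 4 + 8 * K ^ 3))
  filter_upwards [eventually_gt_atTop 0] with N hN
  have hN' : (0 : ℝ) < N := by exact_mod_cast hN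
  have e : (√(N : ℝ) * (N : ℝ) ^ (2 * H - 1)) ^ 2 = (N : ℝ) ^ (4 * H - 3) * N ^ 2 := by
    rw [mul_pow, Real.sq_sqrt hN'.le, ← Real.rpow_natCast, ← Real.rpow_mul hN'.le,
      ← Real.rpow_natCast, ← Real.rpow_add hN']
    nth_rewrite 1 [← Real.rpow_one (N : ℝ)]
    rw [← Real.rpow_add hN']
    congr 1
    push_cast
    ring
  simp only [mul_pow _ (_ - _), e]
  rw [integral_const_mul]
  have hq0 : 0 ≤ ∑ k : Fin N, itoCorrection H σ N k ^ 2 := Finset.sum_nonneg fun _ _ => sq_nonneg _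
  have hbound : ∫ ω, (∑ k : Fin N, itoCorrection H σ N k ^ 2 - 2 * ∑ k : Fin N,
      itoCorrection H σ N k * wienerIntegral H B P (volPiece σ N k) ω) ^ 2 ∂P
      ≤ 2 * (K ^ 2 / N) ^ 2 + 8 * (K ^ 3 / N ^ 2) := by
    calc _ ≤ ∫ ω, (2 * (∑ k : Fin N, itoCorrection H σ N k ^ 2) ^ 2 + 8 * (∑ k : Fin N,
            itoCorrection H σ N k * wienerIntegral H B P (volPiece σ N k) ω) ^ 2) ∂P := by
          refine integral_mono ((memLp_const _).sub ((hlin N).const_mul 2)).integrable_sq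
            ((integrable_const _).add ((hlin N).integrable_sq.const_mul 8)) fun ω => ?_
          have h4 (x y : ℝ) : (x - 2 * y) ^ 2 ≤ 2 * x ^ 2 + 8 * y ^ 2 := by
            nlinarith [sq_nonneg (x + 2 * y)]
          exact h4 _ _
      _ = 2 * (∑ k : Fin N, itoCorrection H σ N k ^ 2) ^ 2 + 8 * ∫ ω, (∑ k : Fin N,
            itoCorrection H σ N k * wienerIntegral H B P (volPiece σ N k) ω) ^ 2 ∂P := by
          rw [integral_add (integrable_const _) ((hlin N).integrable_sq.const_mul 8),
            integral_const, integral_const_mul]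
          simp
      _ ≤ _ := by
          have := hsq N hN
          have := hlin_sq N hN
          gcongr
  calc _ ≤ (N : ℝ) ^ (4 * H - 3) * N ^ 2 * (2 * (K ^ 2 / N) ^ 2 + 8 * (K ^ 3 / N ^ 2)) := by gcongr
    _ = _ := by field_simp

end

end FracMarket

theorem theorem3 {Ω : Type*} [MeasurableSpace Ω] (P : Measure Ω) [IsProbabilityMeasure P]
    (H : ℝ) (hH : H ∈ Set.Ioo (1 / 2 : ℝ) (3 / 4))
    (B : ℝ → Ω → ℝ) (hB : FracMarket.IsFBM H B P)
    (σ : ℝ → ℝ) (hσ_meas : AEMeasurable σ (volume.restrict (Set.Icc (0 : ℝ) 1)))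
    (hσ_bdd : ∃ C : ℝ, ∀ t ∈ Set.Icc (0 : ℝ) 1, |σ t| ≤ C)
    (s₀ : ℝ) (hs₀ : 0 < s₀)
    (S : ℝ → Ω → ℝ) (hS : FracMarket.IsWISSolution B P (fun _ => 0) σ s₀ 1 S) :
    ∃ v : ℝ≥0,
      Tendsto (FracMarket.approxVariance H σ) atTop (𝓝 (v : ℝ)) ∧
      TendstoInDistribution
        (fun (N : ℕ) (ω : Ω) =>
          √(N : ℝ) * (FracMarket.volEstimator H S N ω - FracMarket.thetaTilde H B P σ N))
        atTop (id : ℝ → ℝ) (fun _ => P) (gaussianReal 0 v) := by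
  obtain ⟨C, hC⟩ := hσ_bdd
  have h1 : 1 / 2 < H := hH.1
  have h3 : H < 1 := by linarith [hH.2]
  have hσ := FracMarket.bddSupp_unitPart hσ_meas hC
  obtain ⟨v, hv⟩ := FracMarket.exists_tendsto_approxVariance h1 hH.2 hσ hC
  refine ⟨v, hv, ?_⟩
  have hmain := FracMarket.tendstoInDistribution_mainTerm hB h1 hH.2 hσ hC hv
  have hrem := FracMarket.tendsto_eLpNorm_remainder hB h1 hH.2 hσ hC
  have hae := FracMarket.sqrt_mul_volEstimator_sub_ae_eq hB h1 h3 hσ_meas hC hs₀ hS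
  have hwm (N : ℕ) (k : Fin N) : AEMeasurable
      (FracMarket.wienerIntegral H B P (FracMarket.volPiece σ N k)) P :=
    (FracMarket.isWienerIntegral_volPiece hB h1 h3 hσ k.2).aemeasurable
  have hr (N : ℕ) : AEMeasurable (fun ω => √(N : ℝ) * (N : ℝ) ^ (2 * H - 1) *
      (∑ k : Fin N, FracMarket.itoCorrection H σ N k ^ 2 - 2 * ∑ k : Fin N,
        FracMarket.itoCorrection H σ N k *
          FracMarket.wienerIntegral H B P (FracMarket.volPiece σ N k) ω)) P := by
    have := hwm N
    fun_prop
  refine TendstoInDistribution.congr (fun N => (hae N).symm) (ae_eq_refl _) ?_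
  refine tendstoInDistribution_of_tendstoInMeasure_sub _ _ hmain
    (tendstoInMeasure_of_tendsto_eLpNorm two_ne_zero (fun N => ?_) aestronglyMeasurable_const ?_)
    fun N => ?_
  · exact (((hmain.forall_aemeasurable N).add (hr N)).sub
      (hmain.forall_aemeasurable N)).aestronglyMeasurable
  · refine hrem.congr fun N => ?_
    congr 1
    ext ω
    simp
  · exact (hmain.forall_aemeasurable N).add (hr N)
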